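/- Let $n\ge 1$ and $d=2^n$. A world model on $n$ qubits over sets of actions $\mathcal X,\mathcal Y,\mathcal Z$ consists of a state $\rho_x$ for each $x\in\mathcal X$, a channel (CPTP map) $\mathcal E_y$ for each $y\in\mathcal Y$ and a POVM $\mathcal M_z=\{M_{zb}\}_b$ with a finite nonempty outcome set for each $z\in\mathcal Z$. An experiment $(x,y_1,\dots,y_L,z)$ yields outcome $b$ with probability $\mathrm{Tr}(M_{zb}(\mathcal E_{y_L}\circ\dots\circ\mathcal E_{y_1})(\rho_x))$. A classical agent is a randomized adaptive procedure that conducts finitely many experiments and then produces an output. The agent knows the names of an action preparing a state $\rho_0$, of an action for each $n$-qubit Clifford gate $C$ (gates that differ by more than a global phase have different names), and of a measurement $\mathcal M_0=\{M_b\}_{b\in\{0,1\}^n}$, and nothing about the other actions. The noise on Clifford gates is gate-independent: there is a channel $\mathcal N$ with $\mathcal E_C(\rho)=\mathcal N(C\rho C^\dagger)$ for all Clifford gates $C$. Let $f=\langle 0^n|\rho_0|0^n\rangle$. For $0<\nu\le 0.1$, call the noise $\nu$-bounded if $f\ge 1-\nu$ and $\langle b|\mathcal N^\dagger(M_b)|b\rangle\ge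 1-\nu$ for all $b\in\{0,1\}^n$. (1) Let $0<\nu\le 0.1$, $0\le\eta<1$, and let $\mathcal Q$ be the class of all world models with gate-independent noise $\mathcal N$ on Clifford gates that is $\nu$-bounded and satisfies $\|\mathcal N-\mathcal I\|_\diamond\le\eta$. Then all states, channels and POVMs can be learned up to the single parameter $f$: for all $\epsilon,\delta>0$ and each action $x$ (resp. $y$; $z$ and outcome $b$) there is an agent that outputs a one-parameter family $\tilde\rho_x(\cdot)$ (resp. $\tilde{\mathcal E}_y(\cdot)$; $\tilde M_{zb}(\cdot)$) such that, for every world model in $\mathcal Q$, with probability at least $1-\delta$, $\|\rho_x-\tilde\rho_x(f)\|_1\le\epsilon$ (resp. $\|\mathcal E_y-\tilde{\mathcal E}_y(f)\|_\diamond\le\epsilon$; $\|M_{zb}-\tilde M_{zb}(f)\|_1\le\epsilon$), where $f$ is the true value of the parameter. The parameter $f$ itself is unlearnable: it is not true that for all $\epsilon,\delta>0$ there is an agent that outputs, for every world model in $\mathcal Q$, a value within $\epsilon$ of $f$ with probability at least $1-\delta$; indeed $\mathcal Q$ contains two world models with different values of $f$ that have the same outcome probabilities in all experiments. (2) There is an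 absolute constant $K>0$ such that for all $n\ge1$ and $\epsilon>0$ there is an agent, without knowledge of $f$, with the following property. It conducts at most $K d^4\log d/\epsilon^2$ experiments, each of which prepares $\rho_0$, applies one or two Clifford gates and measures $\mathcal M_0$; at most $K d^2/\epsilon^2$ of them apply only one gate. For every world model with gate-independent noise $\mathcal N$ on Clifford gates that is $0.1$-bounded and satisfies $\mathcal N(I)=I$, it outputs a matrix $\tilde\Phi$ with $\|\tilde\Phi-\Phi_{\mathcal N}\|_{\mathrm{HS}}<\epsilon$ with probability at least $0.99$. Here $\Phi_{\mathcal N}=(\mathcal N\otimes\mathcal I)(|\omega\rangle\langle\omega|)$, $|\omega\rangle=d^{-1/2}\sum_b|b\rangle\otimes|b\rangle$, is the Choi matrix of $\mathcal N$ and $\|\cdot\|_{\mathrm{HS}}$ is the Frobenius norm. -/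

import Mathlib

open scoped Matrix ComplexOrder

universe u v w t

noncomputable section

/-! ### Matrices, norms and channels -/

/-- The trace norm `‖A‖₁ = Tr √(A† A)`, i.e. the sum of the singular values of `A`. -/
def traceNorm {D : Type*} [Fintype D] [DecidableEq D] (A : Matrix D D ℂ) : ℝ :=
  ∑ i, Real.sqrt ((Matrix.isHermitian_conjTranspose_mul_self A).eigenvalues i)

/-- The Hilbert-Schmidt (Frobenius) norm. -/
def hsNorm {D : Type*} [Fintype D] (A : Matrix D D ℂ) : ℝ :=
  Real.sqrt (∑ i, ∑ j, ‖A i j‖ ^ 2)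

/-- Linear maps on `D × D` matrices. -/
abbrev SuperOp (D : Type*) : Type _ := Matrix D D ℂ →ₗ[ℂ] Matrix D D ℂ

/-- `(Φ ⊗ id_R)(A)`, where `R` indexes a basis of the ancilla: the `(r, s)` ancilla block
of `A` is mapped to its image under `Φ`. -/
def ampliation {D : Type*} (R : Type*) (Φ : SuperOp D) (A : Matrix (D × R) (D × R) ℂ) :
    Matrix (D × R) (D × R) ℂ :=
  Matrix.of fun p q => Φ (Matrix.of fun i j => A (i, p.2) (j, q.2)) p.1 q.1

/-- `‖Φ‖_⋄ ≤ c`: the map `Φ ⊗ id` with ancilla of the same dimension as the system has norm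
at most `c` with respect to the trace norm. -/
def DiamondNormLE {D : Type*} [Fintype D] [DecidableEq D] (Φ : SuperOp D) (c : ℝ) : Prop :=
  ∀ A : Matrix (D × D) (D × D) ℂ, traceNorm (ampliation D Φ A) ≤ c * traceNorm A

/-- Density matrices. -/
def IsState {D : Type*} [Fintype D] (ρ : Matrix D D ℂ) : Prop :=
  ρ.PosSemidef ∧ ρ.trace = 1

/-- Completely positive trace-preserving maps. -/
def IsCPTP {D : Type*} [Fintype D] (Φ : SuperOp D) : Prop :=
  (∀ (k : ℕ) (A : Matrix (D × Fin k) (D × Fin k) ℂ),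
      A.PosSemidef → (ampliation (Fin k) Φ A).PosSemidef) ∧
    ∀ A, (Φ A).trace = A.trace

/-- Positive-operator-valued measures with finitely many outcomes. -/
def IsPOVM {D β : Type*} [Fintype D] [DecidableEq D] [Fintype β] (M : β → Matrix D D ℂ) : Prop :=
  (∀ b, (M b).PosSemidef) ∧ ∑ b, M b = 1

/-- The maximally entangled state `|ω⟩⟨ω|`, `|ω⟩ = d^{-1/2} ∑_b |b⟩ ⊗ |b⟩`. -/
def maxEntangled (D : Type*) [Fintype D] [DecidableEq D] : Matrix (D × D) (D × D) ℂ :=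
  Matrix.of fun p q => if p.1 = p.2 ∧ q.1 = q.2 then (1 / Fintype.card D : ℂ) else 0

/-- The Choi matrix `(Φ ⊗ id)(|ω⟩⟨ω|)`. -/
def choi {D : Type*} [Fintype D] [DecidableEq D] (Φ : SuperOp D) : Matrix (D × D) (D × D) ℂ :=
  ampliation D Φ (maxEntangled D)

/-! ### World models and experiments -/

/-- A world model on a system with basis `D`: a state for every `x : X`, a channel for every
`y : Y` and a measurement with outcome set `B z` for every `z : Z`. -/
structure WorldModel (D : Type) [Fintype D] [DecidableEq D]
    (X : Type u) (Y : Type v) (Z : Type w) (B : Z → Type t) [∀ z, Fintype (B z)] where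
  state : X → Matrix D D ℂ
  channel : Y → SuperOp D
  povm : (z : Z) → B z → Matrix D D ℂ
  isState : ∀ x, IsState (state x)
  isCPTP : ∀ y, IsCPTP (channel y)
  isPOVM : ∀ z, IsPOVM (povm z)

/-- An experiment `(x, y₁, …, y_L, z)`. -/
structure Experiment (X : Type u) (Y : Type v) (Z : Type w) where
  prep : X
  evol : List Y
  meas : Z

namespace WorldModel

variable {D : Type} [Fintype D] [DecidableEq D] {X : Type u} {Y : Type v} {Z : Type w}
  {B : Z → Type t} [∀ z, Fintype (B z)]

/-- The probability `Tr(M_{zb} (E_{y_L} ∘ ⋯ ∘ E_{y_1})(ρ_x))` of outcome `b`. -/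
def outcomeProb (W : WorldModel D X Y Z B) (E : Experiment X Y Z) (b : B E.meas) : ℝ :=
  (W.povm E.meas b * E.evol.foldl (fun σ y => W.channel y σ) (W.state E.prep)).trace.re

/-- Two world models which give the same outcome statistics in all experiments. -/
def WeaklyIndistinguishable (W₁ W₂ : WorldModel D X Y Z B) : Prop :=
  ∀ (E : Experiment X Y Z) (b : B E.meas), W₁.outcomeProb E b = W₂.outcomeProb E b

end WorldModel

/-! ### Classical agents -/

/-- A randomized adaptive classical agent that conducts finitely many experiments and outputs
an element of `α`. It can stop, toss a coin with finitely many faces, or conduct an experiment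
and continue depending on the outcome. -/
inductive Agent (X : Type u) (Y : Type v) (Z : Type w) (B : Z → Type t) (α : Type) :
    Type (max u v w t) where
  | output (a : α) : Agent X Y Z B α
  | toss (k : ℕ) (p : stdSimplex ℝ (Fin k)) (next : Fin k → Agent X Y Z B α) : Agent X Y Z B α
  | experiment (E : Experiment X Y Z) (next : B E.meas → Agent X Y Z B α) : Agent X Y Z B α

namespace Agent

variable {X : Type u} {Y : Type v} {Z : Type w} {B : Z → Type t} [∀ z, Fintype (B z)] {α : Type}

open Classical in
/-- The probability that the output lies in `S` when the true world model is `W`. -/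
def prob {D : Type} [Fintype D] [DecidableEq D] (W : WorldModel D X Y Z B) (S : Set α) :
    Agent X Y Z B α → ℝ
  | output a => if a ∈ S then 1 else 0
  | toss _ p next => ∑ i, p.1 i * prob W S (next i)
  | experiment E next => ∑ b, W.outcomeProb E b * prob W S (next b)

open Classical in
/-- The maximal number, over all runs, of experiments with property `P`. -/
def count (P : Experiment X Y Z → Prop) : Agent X Y Z B α → ℕ
  | output _ => 0
  | toss _ _ next => Finset.univ.sup fun i => count P (next i)
  | experiment E next => (if P E then 1 else 0) + Finset.univ.sup fun b => count P (next b)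

end Agent

section Learning

variable {D : Type} [Fintype D] [DecidableEq D] {X : Type u} {Y : Type v} {Z : Type w}
  {B : Z → Type t} [∀ z, Fintype (B z)]

/-- The real-valued property `f` of world models in the class `Q` can be predicted to arbitrary
accuracy and confidence. -/
def Predictable (Q : Set (WorldModel D X Y Z B)) (f : WorldModel D X Y Z B → ℝ) : Prop :=
  ∀ ε > 0, ∀ δ > 0, ∃ A : Agent X Y Z B ℝ, ∀ W ∈ Q, 1 - δ ≤ A.prob W {o | |f W - o| ≤ ε}

/-- All states, channels and POVM elements of the world models in `Q` can be learned to arbitrary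
accuracy and confidence up to the one real parameter `f W`: the agent, which does not know `f W`,
outputs a one-parameter family of descriptions, whose member at the parameter `f W` is accurate. -/
def LearnableUpTo (Q : Set (WorldModel D X Y Z B)) (f : WorldModel D X Y Z B → ℝ) : Prop :=
  ∀ ε > 0, ∀ δ > 0,
    (∀ x, ∃ A : Agent X Y Z B (ℝ → Matrix D D ℂ), ∀ W ∈ Q,
      1 - δ ≤ A.prob W {F | traceNorm (W.state x - F (f W)) ≤ ε}) ∧
    (∀ y, ∃ A : Agent X Y Z B (ℝ → SuperOp D), ∀ W ∈ Q,
      1 - δ ≤ A.prob W {F | DiamondNormLE (W.channel y - F (f W)) ε}) ∧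
    (∀ z b, ∃ A : Agent X Y Z B (ℝ → Matrix D D ℂ), ∀ W ∈ Q,
      1 - δ ≤ A.prob W {F | traceNorm (W.povm z b - F (f W)) ≤ ε})

end Learning

/-! ### Qubits and Clifford gates -/

/-- Labels of the computational basis of `n` qubits. -/
abbrev Bits (n : ℕ) : Type := Fin n → Fin 2

/-- The Pauli matrices `I, X, Y, Z`. -/
def pauli : Fin 4 → Matrix (Fin 2) (Fin 2) ℂ :=
  ![1, !![0, 1; 1, 0], !![0, -Complex.I; Complex.I, 0], !![1, 0; 0, -1]]

/-- Tensor products of `n` Pauli matrices. -/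
def pauliString {n : ℕ} (s : Fin n → Fin 4) : Matrix (Bits n) (Bits n) ℂ :=
  Matrix.of fun a b => ∏ i, pauli (s i) (a i) (b i)

/-- Clifford gates: unitaries that conjugate every Pauli string to a Pauli string up to sign. -/
def IsClifford {n : ℕ} (C : Matrix (Bits n) (Bits n) ℂ) : Prop :=
  C ∈ Matrix.unitaryGroup (Bits n) ℂ ∧
    ∀ s, ∃ s', C * pauliString s * Cᴴ = pauliString s' ∨ C * pauliString s * Cᴴ = -pauliString s'

/-- The type of all `n`-qubit Clifford gates. -/
abbrev CliffordGate (n : ℕ) : Type := {C : Matrix (Bits n) (Bits n) ℂ // IsClifford C}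

/-- The projector `|b⟩⟨b|`. -/
def basisProj {n : ℕ} (b : Bits n) : Matrix (Bits n) (Bits n) ℂ := Matrix.single b b 1

/-! ### Gate-independent noise on Clifford gates -/

/-- The names, among all actions, of the preparation of the zero state, of the Clifford gates
and of the computational basis measurement. Gates which differ by more than a global phase have
different names. -/
structure CliffordLabels (n : ℕ) (X : Type u) (Y : Type v) (Z : Type w) (B : Z → Type t) where
  zero : X
  gate : CliffordGate n → Y
  comp : Z
  outcome : Bits n ≃ B comp
  gate_phase : ∀ C C', gate C = gate C' → ∃ c : ℂ, C.1 = c • C'.1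

namespace CliffordLabels

variable {n : ℕ} {X : Type u} {Y : Type v} {Z : Type w} {B : Z → Type t} [∀ z, Fintype (B z)]

/-- The fidelity `f = ⟨0ⁿ| ρ₀ |0ⁿ⟩` of the noisy zero state. -/
def fidelity (ℓ : CliffordLabels n X Y Z B) (W : WorldModel (Bits n) X Y Z B) : ℝ :=
  (W.state ℓ.zero 0 0).re

/-- The channel of every Clifford gate `C` is `ρ ↦ N(C ρ C†)` with the same channel `N`. -/
def GateIndependentNoise (ℓ : CliffordLabels n X Y Z B) (W : WorldModel (Bits n) X Y Z B)
    (N : SuperOp (Bits n)) : Prop :=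
  IsCPTP N ∧ ∀ (C : CliffordGate n) (ρ : Matrix (Bits n) (Bits n) ℂ),
    W.channel (ℓ.gate C) ρ = N (C.1 * ρ * C.1ᴴ)

/-- Bounded noise: `⟨0ⁿ| ρ₀ |0ⁿ⟩ ≥ 1 - ν` and `⟨b| N†(M_b) |b⟩ = Tr(M_b N(|b⟩⟨b|)) ≥ 1 - ν`
for all `b`. (These numbers are automatically at most one.) -/
def BoundedNoise (ℓ : CliffordLabels n X Y Z B) (ν : ℝ) (W : WorldModel (Bits n) X Y Z B)
    (N : SuperOp (Bits n)) : Prop :=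
  1 - ν ≤ ℓ.fidelity W ∧
    ∀ b : Bits n, 1 - ν ≤ (W.povm ℓ.comp (ℓ.outcome b) * N (basisProj b)).trace.re

/-- The class of all world models with gate-independent noise `N` on the Clifford gates, where
`‖N - id‖_⋄ ≤ η`, and bounded noise on the zero state and the computational basis measurement.
All other actions are arbitrary. -/
def modelClass (ℓ : CliffordLabels n X Y Z B) (ν η : ℝ) : Set (WorldModel (Bits n) X Y Z B) :=
  {W | ∃ N : SuperOp (Bits n), ℓ.GateIndependentNoise W N ∧ ℓ.BoundedNoise ν W N ∧
    DiamondNormLE (N - LinearMap.id) η}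

/-- Experiments: prepare the zero state, apply one Clifford gate, measure. -/
def OneGate (ℓ : CliffordLabels n X Y Z B) (E : Experiment X Y Z) : Prop :=
  ∃ C, E = ⟨ℓ.zero, [ℓ.gate C], ℓ.comp⟩

/-- Experiments: prepare the zero state, apply two Clifford gates, measure. -/
def TwoGate (ℓ : CliffordLabels n X Y Z B) (E : Experiment X Y Z) : Prop :=
  ∃ C₁ C₂, E = ⟨ℓ.zero, [ℓ.gate C₁, ℓ.gate C₂], ℓ.comp⟩

end CliffordLabels

end

/-! The engine is that Clifford conjugations form a unitary two-design. Pauli strings are a basis on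
which every conjugation acts by signed permutations. Averaging over conjugations by Pauli strings
kills all off-diagonal terms of the second moment, and transitivity on nonzero strings makes the
remaining diagonal terms equal (`twirlSum_eq`).

Since the noise is gate-independent, the noise of the last gate can be absorbed into the
measurement, which then has effects `N†(M_b)` preceded by an ideal Clifford gate. By the two-design
formula, this device performs tomography of any state up to contraction of its traceless part by one
scalar, the visibility α (`IsDesign.tomography`). One-gate experiments reveal the product `(f - 1/d)
α` (`IsDesign.calibration`), so a value of `f` fixes α. Moreover, weighting the orbit of the noisy
zero state by the ideal orbit reproduces every matrix, with coefficients that depend on the state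
only through `f` (`IsDesign.sum_prepCoeff`). Hence, for given `f`, tomography after one gate fixes
`N`. Because `‖N - id‖_⋄ ≤ η < 1`, the inverse of `N` is bounded uniformly over the class
(`exists_inverse_bound`), so channels and measurements can be separated from the noise which
precedes them.

All these steps are quantitative: two models with equal `f` and nearly equal probabilities in
finitely many experiments have nearly equal actions (`CliffordLabels.Comparable`). The agent
therefore only estimates these probabilities and, for each candidate `f`, outputs the action of an
arbitrary model in the class which fits them (`exists_learner`).

The fidelity is unlearnable because depolarizing the state or the measurement gives the same
statistics whenever all channels are unital: depolarization commutes with such channels, so it can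
be moved from one end of the circuit to the other (`exists_indistinguishable`).

For unital `N`, two random Clifford gates give a bounded unbiased estimator of an affine image of
the Choi matrix. The unknown scale is `(f - 1/d) α` times a known number, precisely the product
which one-gate experiments measure, so `f` is not needed (`sum_twoGate`,
`norm_choiEstimate_sub_lt`). Chebyshev's inequality for empirical means in Frobenius norm bounds the
number of samples. -/

noncomputable section

set_option linter.unusedSectionVars false

/-! ### Pauli strings -/

/-- The index of the product of two Pauli matrices. -/
def pauliMul : Fin 4 → Fin 4 → Fin 4 :=
  ![![0, 1, 2, 3], ![1, 0, 3, 2], ![2, 3, 0, 1], ![3, 2, 1, 0]]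

/-- The phase of the product of two Pauli matrices. -/
def pauliPhase : Fin 4 → Fin 4 → ℂ :=
  ![![1, 1, 1, 1], ![1, 1, Complex.I, -Complex.I], ![1, -Complex.I, 1, Complex.I],
    ![1, Complex.I, -Complex.I, 1]]

/-- The commutation sign of two Pauli matrices. -/
def pauliSign : Fin 4 → Fin 4 → ℤ :=
  ![![1, 1, 1, 1], ![1, 1, -1, -1], ![1, -1, 1, -1], ![1, -1, -1, 1]]

lemma pauli_mul_pauli (a b : Fin 4) :
    pauli a * pauli b = pauliPhase a b • pauli (pauliMul a b) := by
  fin_cases a <;> fin_cases b <;>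
    (ext i j; fin_cases i <;> fin_cases j <;>
      simp [pauli, pauliMul, pauliPhase, Matrix.mul_apply, Matrix.one_apply])

lemma pauli_commute (a b : Fin 4) :
    pauli a * pauli b = (pauliSign a b : ℂ) • (pauli b * pauli a) := by
  fin_cases a <;> fin_cases b <;>
    (ext i j; fin_cases i <;> fin_cases j <;>
      simp [pauli, pauliSign, Matrix.mul_apply, Matrix.one_apply])

lemma pauli_conjTranspose (a : Fin 4) : (pauli a)ᴴ = pauli a := by
  fin_cases a <;> (ext i j; fin_cases i <;> fin_cases j <;> simp [pauli])

lemma pauli_trace_mul (a b : Fin 4) :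
    (pauli a * pauli b).trace = if a = b then 2 else 0 := by
  fin_cases a <;> fin_cases b <;>
    simp [pauli, Matrix.trace] <;> norm_num

lemma pauliSign_mul (a b c : Fin 4) :
    pauliSign a (pauliMul b c) = pauliSign a b * pauliSign a c := by
  revert a b c; decide

lemma pauliSign_comm (a b : Fin 4) : pauliSign a b = pauliSign b a := by
  revert a b; decide

lemma pauliSign_self (a : Fin 4) : pauliSign a a = 1 := by
  revert a; decide

lemma pauliMul_cancel (a b : Fin 4) : pauliMul (pauliMul a b) a = b := by
  revert a b; decide

lemma pauliMul_eq_zero (a b : Fin 4) : pauliMul a b = 0 ↔ a = b := by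
  revert a b; decide

lemma sum_pauliSign (a : Fin 4) : ∑ u, pauliSign u a = if a = 0 then 4 else 0 := by
  revert a; decide

lemma pauliSign_sq (a b : Fin 4) : pauliSign a b * pauliSign a b = 1 := by
  revert a b; decide

section Strings

variable {n : ℕ}

/-- The tensor product of one-qubit matrices. -/
def qubitTensor (A : Fin n → Matrix (Fin 2) (Fin 2) ℂ) : Matrix (Bits n) (Bits n) ℂ :=
  Matrix.of fun a b => ∏ i, A i (a i) (b i)

lemma pauliString_eq (s : Fin n → Fin 4) : pauliString s = qubitTensor fun i => pauli (s i) := rfl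

lemma qubitTensor_mul (A B : Fin n → Matrix (Fin 2) (Fin 2) ℂ) :
    qubitTensor A * qubitTensor B = qubitTensor fun i => A i * B i := by
  ext a b
  simp only [qubitTensor, Matrix.mul_apply, Matrix.of_apply, ← Finset.prod_mul_distrib]
  rw [Finset.prod_univ_sum, Fintype.piFinset_univ]

lemma qubitTensor_trace (A : Fin n → Matrix (Fin 2) (Fin 2) ℂ) :
    (qubitTensor A).trace = ∏ i, (A i).trace := by
  simp only [qubitTensor, Matrix.trace, Matrix.diag_apply, Matrix.of_apply]
  rw [Finset.prod_univ_sum, Fintype.piFinset_univ]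

lemma qubitTensor_conjTranspose (A : Fin n → Matrix (Fin 2) (Fin 2) ℂ) :
    (qubitTensor A)ᴴ = qubitTensor fun i => (A i)ᴴ := by
  ext a b
  simp [qubitTensor, Matrix.conjTranspose_apply]

lemma qubitTensor_smul (c : Fin n → ℂ) (A : Fin n → Matrix (Fin 2) (Fin 2) ℂ) :
    (qubitTensor fun i => c i • A i) = (∏ i, c i) • qubitTensor A := by
  ext a b
  simp [qubitTensor, Finset.prod_mul_distrib]

lemma qubitTensor_one : (qubitTensor fun _ : Fin n => 1) = 1 := by
  ext a b
  simp only [qubitTensor, Matrix.of_apply, Matrix.one_apply]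
  by_cases h : a = b
  · simp [h]
  · rw [if_neg h]
    obtain ⟨i, hi⟩ := Function.ne_iff.1 h
    exact Finset.prod_eq_zero (Finset.mem_univ i) (by simp [hi])

/-- The index of the product of two Pauli strings. -/
def stringMul (s t : Fin n → Fin 4) : Fin n → Fin 4 := fun i => pauliMul (s i) (t i)

/-- The commutation sign of two Pauli strings. -/
def stringSign (s t : Fin n → Fin 4) : ℤ := ∏ i, pauliSign (s i) (t i)

lemma pauliString_zero : pauliString (0 : Fin n → Fin 4) = 1 := by
  rw [pauliString_eq, ← qubitTensor_one]; rfl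

lemma pauliString_mul (s t : Fin n → Fin 4) :
    pauliString s * pauliString t =
      (∏ i, pauliPhase (s i) (t i)) • pauliString (stringMul s t) := by
  simp only [pauliString_eq, qubitTensor_mul, pauli_mul_pauli, qubitTensor_smul]
  rfl

lemma pauliString_commute (s t : Fin n → Fin 4) :
    pauliString s * pauliString t = (stringSign s t : ℂ) • (pauliString t * pauliString s) := by
  rw [pauliString_eq, pauliString_eq, qubitTensor_mul, qubitTensor_mul]
  simp_rw [fun i => pauli_commute (s i) (t i)]
  rw [qubitTensor_smul]
  simp [stringSign]

lemma pauliString_conjTranspose (s : Fin n → Fin 4) : (pauliString s)ᴴ = pauliString s := by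
  simp only [pauliString_eq, qubitTensor_conjTranspose, pauli_conjTranspose]

lemma pauliString_trace_mul (s t : Fin n → Fin 4) :
    (pauliString s * pauliString t).trace = if s = t then (2 : ℂ) ^ n else 0 := by
  simp only [pauliString_eq, qubitTensor_mul, qubitTensor_trace, pauli_trace_mul]
  by_cases h : s = t
  · simp [h]
  · rw [if_neg h]
    obtain ⟨i, hi⟩ := Function.ne_iff.1 h
    exact Finset.prod_eq_zero (Finset.mem_univ i) (by simp [hi])

lemma pauliString_trace (s : Fin n → Fin 4) :
    (pauliString s).trace = if s = 0 then (2 : ℂ) ^ n else 0 := by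
  simpa [pauliString_zero] using pauliString_trace_mul s 0

lemma pauliString_sq (s : Fin n → Fin 4) : pauliString s * pauliString s = 1 := by
  rw [pauliString_eq, qubitTensor_mul, ← qubitTensor_one]
  congr 1
  ext1 i
  generalize s i = a
  fin_cases a <;> (ext i j; fin_cases i <;> fin_cases j <;>
    simp [pauli, Matrix.mul_apply, Matrix.one_apply])

lemma stringSign_mul (s t r : Fin n → Fin 4) :
    stringSign s (stringMul t r) = stringSign s t * stringSign s r := by
  simp only [stringSign, stringMul, pauliSign_mul, Finset.prod_mul_distrib]

lemma stringSign_comm (s t : Fin n → Fin 4) : stringSign s t = stringSign t s := by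
  simp only [stringSign, fun i => pauliSign_comm (s i) (t i)]

lemma stringSign_self (s : Fin n → Fin 4) : stringSign s s = 1 := by
  simp [stringSign, pauliSign_self]

lemma stringSign_sq (s t : Fin n → Fin 4) : stringSign s t * stringSign s t = 1 := by
  simp only [stringSign, ← Finset.prod_mul_distrib, pauliSign_sq, Finset.prod_const_one]

lemma stringSign_eq_or (s t : Fin n → Fin 4) : stringSign s t = 1 ∨ stringSign s t = -1 :=
  mul_self_eq_one_iff.1 (stringSign_sq s t)

lemma stringMul_cancel (s t : Fin n → Fin 4) : stringMul (stringMul s t) s = t := by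
  ext1 i; exact pauliMul_cancel _ _

lemma stringMul_eq_zero {s t : Fin n → Fin 4} : stringMul s t = 0 ↔ s = t := by
  simp only [funext_iff, stringMul, Pi.zero_apply, pauliMul_eq_zero]

lemma sum_stringSign (s : Fin n → Fin 4) :
    ∑ r, stringSign r s = if s = 0 then 4 ^ n else 0 := by
  have h : ∑ r, stringSign r s = ∏ i, ∑ a, pauliSign a (s i) := by
    rw [Finset.prod_univ_sum, Fintype.piFinset_univ]; rfl
  rw [h]
  simp only [sum_pauliSign]
  by_cases hs : s = 0
  · simp [hs]
  · rw [if_neg hs]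
    obtain ⟨i, hi⟩ := Function.ne_iff.1 hs
    exact Finset.prod_eq_zero (Finset.mem_univ i) (if_neg hi)

/-- Otherwise the character of the product string would be identically 1, while the sum of a
nontrivial character vanishes. -/
lemma exists_stringSign_ne {s t : Fin n → Fin 4} (h : s ≠ t) :
    ∃ r, stringSign r s * stringSign r t = -1 := by
  by_contra! hc
  have h1 : ∀ r, stringSign r (stringMul s t) = 1 := fun r =>
    (stringSign_eq_or r _).resolve_right (by rw [stringSign_mul]; exact hc r)
  have h2 := sum_stringSign (stringMul s t)
  rw [if_neg (fun h0 => h (stringMul_eq_zero.1 h0))] at h2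
  simp [h1] at h2

/-- Counting: a string which commutes with `s` or `t` contributes zero to the sum of `(1 - χ_s)(1 -
χ_t)`, but by orthogonality of characters this sum is at least `4 ^ n`. -/
lemma exists_common_anticommuting {s t : Fin n → Fin 4} (hs : s ≠ 0) (ht : t ≠ 0) :
    ∃ r, stringSign r s = -1 ∧ stringSign r t = -1 := by
  by_contra! hc
  have h1 : ∀ r, (1 - stringSign r s) * (1 - stringSign r t) = 0 := by
    intro r
    rcases stringSign_eq_or r s with h | h
    · simp [h]
    · simp [(stringSign_eq_or r t).resolve_right (hc r h)]
  have h2 : ∑ r : Fin n → Fin 4, (1 - stringSign r s) * (1 - stringSign r t) = 0 :=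
    Finset.sum_eq_zero fun r _ => h1 r
  have h3 : ∑ r : Fin n → Fin 4, (1 - stringSign r s) * (1 - stringSign r t) =
      4 ^ n - ∑ r, stringSign r s - ∑ r, stringSign r t + ∑ r, stringSign r (stringMul s t) := by
    have : (4 : ℤ) ^ n = ∑ _r : Fin n → Fin 4, 1 := by simp
    rw [this, ← Finset.sum_sub_distrib, ← Finset.sum_sub_distrib, ← Finset.sum_add_distrib]
    exact Finset.sum_congr rfl fun r _ => by rw [stringSign_mul]; ring
  rw [h3, sum_stringSign, sum_stringSign, sum_stringSign, if_neg hs, if_neg ht] at h2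
  have : (0 : ℤ) < 4 ^ n := by positivity
  split_ifs at h2 <;> omega

/-- Trace-orthogonality makes the strings independent, and there are as many of them as the
dimension `4 ^ n`. -/
lemma span_pauliString :
    Submodule.span ℂ (Set.range (pauliString (n := n))) = ⊤ := by
  have hli : LinearIndependent ℂ (pauliString (n := n)) := by
    rw [Fintype.linearIndependent_iff]
    intro g hg t
    have h := congrArg (fun A => (A * pauliString t).trace) hg
    simp only [Finset.sum_mul, Matrix.trace_sum, Matrix.smul_mul, Matrix.trace_smul,
      pauliString_trace_mul, smul_eq_mul, mul_ite, mul_zero, Finset.sum_ite_eq',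
      Finset.mem_univ, if_true, Matrix.zero_mul, Matrix.trace_zero] at h
    simpa using h
  refine hli.span_eq_top_of_card_eq_finrank' ?_
  rw [Module.finrank_matrix]
  simp [← mul_pow]

lemma pauliString_conj (r s : Fin n → Fin 4) :
    pauliString r * pauliString s * (pauliString r)ᴴ = (stringSign r s : ℂ) • pauliString s := by
  rw [pauliString_conjTranspose, pauliString_commute, Matrix.smul_mul, Matrix.mul_assoc,
    pauliString_sq, Matrix.mul_one]

lemma isClifford_pauliString (s : Fin n → Fin 4) : IsClifford (pauliString s) := by
  refine ⟨?_, fun t => ⟨t, ?_⟩⟩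
  · rw [Matrix.mem_unitaryGroup_iff, Matrix.star_eq_conjTranspose, pauliString_conjTranspose,
      pauliString_sq]
  · rw [pauliString_conj]
    rcases stringSign_eq_or s t with h | h <;> simp [h]

/-! ### The Clifford group and its transitivity on nonzero Pauli strings -/

lemma IsClifford.mul {C C' : Matrix (Bits n) (Bits n) ℂ} (h : IsClifford C) (h' : IsClifford C') :
    IsClifford (C * C') := by
  refine ⟨mul_mem h.1 h'.1, fun s => ?_⟩
  obtain ⟨s', hs⟩ := h'.2 s
  obtain ⟨s'', hs'⟩ := h.2 s'
  refine ⟨s'', ?_⟩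
  have e : C * C' * pauliString s * (C * C')ᴴ = C * (C' * pauliString s * C'ᴴ) * Cᴴ := by
    simp only [Matrix.conjTranspose_mul, Matrix.mul_assoc]
  rw [e]
  rcases hs with hs | hs <;> rcases hs' with hs' | hs' <;> simp [hs, hs']

lemma IsClifford.conjTranspose_mul_self {C : Matrix (Bits n) (Bits n) ℂ} (h : IsClifford C) :
    Cᴴ * C = 1 := Matrix.mem_unitaryGroup_iff'.1 h.1

lemma IsClifford.mul_conjTranspose_self {C : Matrix (Bits n) (Bits n) ℂ} (h : IsClifford C) :
    C * Cᴴ = 1 := Matrix.mem_unitaryGroup_iff.1 h.1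

lemma conj_trace {C A : Matrix (Bits n) (Bits n) ℂ} (h : Cᴴ * C = 1) :
    (C * A * Cᴴ).trace = A.trace := by
  rw [Matrix.trace_mul_comm, ← Matrix.mul_assoc, h, Matrix.one_mul]

/-- The induced map on string labels is injective, because strings with different labels are
orthogonal. As there are finitely many labels it is surjective, so every string has a signed
preimage. -/
lemma IsClifford.conjTranspose {C : Matrix (Bits n) (Bits n) ℂ} (h : IsClifford C) :
    IsClifford Cᴴ := by
  refine ⟨Unitary.star_mem h.1, ?_⟩
  have hc := h.conjTranspose_mul_self
  choose f hf using h.2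
  have key : ∀ s, Cᴴ * pauliString (f s) * Cᴴᴴ = pauliString s ∨
      Cᴴ * pauliString (f s) * Cᴴᴴ = -pauliString s := by
    intro s
    have e : Cᴴ * (C * pauliString s * Cᴴ) * Cᴴᴴ = pauliString s := by
      rw [Matrix.conjTranspose_conjTranspose]
      calc Cᴴ * (C * pauliString s * Cᴴ) * C = (Cᴴ * C) * pauliString s * (Cᴴ * C) := by
            simp only [Matrix.mul_assoc]
        _ = _ := by rw [hc, Matrix.one_mul, Matrix.mul_one]
    rcases hf s with hs | hs
    · left; rw [← hs, e]
    · right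
      rw [hs] at e
      rw [← e]; simp
  have hinj : Function.Injective f := by
    intro s t hst
    by_contra hne
    have hp : pauliString s = pauliString t ∨ pauliString s = -pauliString t := by
      have h1 := key s
      rw [hst] at h1
      rcases h1 with h1 | h1 <;> rcases key t with h2 | h2 <;> rw [h2] at h1
      · left; exact h1.symm
      · right; exact h1.symm
      · right; rw [h1]; simp
      · left; exact (neg_injective h1).symm
    have hz := pauliString_trace_mul s t
    have ht := pauliString_trace_mul t t
    rw [if_neg hne] at hz
    rw [if_pos rfl] at ht
    rcases hp with hp | hp <;> rw [hp] at hz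
    · exact pow_ne_zero n two_ne_zero (ht.symm.trans hz)
    · rw [Matrix.neg_mul, Matrix.trace_neg, ht] at hz
      exact pow_ne_zero n two_ne_zero (neg_eq_zero.1 hz)
  intro s
  obtain ⟨s', rfl⟩ := (Finite.injective_iff_surjective.1 hinj) s
  exact ⟨s', key s'⟩

/-- The square root `(1 + iP) / √2` of the Pauli rotation by `P`. -/
def pauliRoot (p : Fin n → Fin 4) : Matrix (Bits n) (Bits n) ℂ :=
  ((Real.sqrt 2 : ℝ) : ℂ)⁻¹ • (1 + Complex.I • pauliString p)

lemma inv_sqrt_two_sq : (((Real.sqrt 2 : ℝ) : ℂ)⁻¹) * (((Real.sqrt 2 : ℝ) : ℂ)⁻¹) = 1 / 2 := by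
  rw [← mul_inv, ← Complex.ofReal_mul, Real.mul_self_sqrt (by norm_num)]
  norm_num

lemma pauliRoot_conjTranspose (p : Fin n → Fin 4) :
    (pauliRoot p)ᴴ = ((Real.sqrt 2 : ℝ) : ℂ)⁻¹ • (1 - Complex.I • pauliString p) := by
  rw [pauliRoot, Matrix.conjTranspose_smul, Matrix.conjTranspose_add, Matrix.conjTranspose_smul,
    pauliString_conjTranspose, Matrix.conjTranspose_one]
  simp [sub_eq_add_neg]

lemma pauliRoot_conj_commute {p r : Fin n → Fin 4} (h : stringSign p r = 1) :
    pauliRoot p * pauliString r * (pauliRoot p)ᴴ = pauliString r := by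
  have hc := pauliString_commute p r
  rw [h, Int.cast_one, one_smul] at hc
  rw [pauliRoot_conjTranspose, pauliRoot, Matrix.smul_mul, Matrix.smul_mul, Matrix.mul_smul,
    smul_smul, inv_sqrt_two_sq]
  simp only [Matrix.smul_mul, Matrix.mul_smul, smul_smul, add_mul, mul_sub,
    Matrix.one_mul, Matrix.mul_one, hc, Matrix.mul_assoc, pauliString_sq, Complex.I_mul_I]
  module

lemma pauliRoot_conj_anticommute {p r : Fin n → Fin 4} (h : stringSign p r = -1) :
    pauliRoot p * pauliString r * (pauliRoot p)ᴴ =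
      Complex.I • (pauliString p * pauliString r) := by
  have hc := pauliString_commute r p
  rw [stringSign_comm, h, Int.cast_neg, Int.cast_one, neg_smul, one_smul] at hc
  rw [pauliRoot_conjTranspose, pauliRoot, Matrix.smul_mul, Matrix.smul_mul, Matrix.mul_smul,
    smul_smul, inv_sqrt_two_sq]
  simp only [Matrix.smul_mul, Matrix.mul_smul, smul_smul, add_mul, mul_sub,
    Matrix.one_mul, Matrix.mul_one, hc, Matrix.mul_assoc, Complex.I_mul_I, Matrix.mul_neg]
  rw [← Matrix.mul_assoc, pauliString_sq, Matrix.one_mul]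
  module

/-- The factor `i` makes the product of two anticommuting strings square to 1, so the phase in front
of the product string squares to 1 and is a sign. -/
lemma anticommute_product {p r : Fin n → Fin 4} (h : stringSign p r = -1) :
    Complex.I • (pauliString p * pauliString r) = pauliString (stringMul p r) ∨
      Complex.I • (pauliString p * pauliString r) = -pauliString (stringMul p r) := by
  have hsq : (Complex.I • (pauliString p * pauliString r)) *
      (Complex.I • (pauliString p * pauliString r)) = 1 := by
    have hc := pauliString_commute r p
    rw [stringSign_comm, h, Int.cast_neg, Int.cast_one, neg_smul, one_smul] at hc
    calc _ = (-1 : ℂ) • (pauliString p * (pauliString r * pauliString p) * pauliString r) := by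
          simp only [Matrix.smul_mul, Matrix.mul_smul, smul_smul, Complex.I_mul_I,
            Matrix.mul_assoc]
      _ = (pauliString p * pauliString p) * (pauliString r * pauliString r) := by
          rw [hc]
          simp [Matrix.mul_assoc]
      _ = 1 := by rw [pauliString_sq, pauliString_sq, Matrix.one_mul]
  rw [pauliString_mul, smul_smul] at hsq ⊢
  set c := Complex.I * ∏ i, pauliPhase (p i) (r i)
  rw [Matrix.smul_mul, Matrix.mul_smul, pauliString_sq, smul_smul] at hsq
  have hc : c * c = 1 := by simpa using congrFun (congrFun hsq 0) 0
  rcases mul_self_eq_one_iff.1 hc with h1 | h1 <;> simp [h1]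

lemma isClifford_pauliRoot (p : Fin n → Fin 4) : IsClifford (pauliRoot p) := by
  refine ⟨?_, fun r => ?_⟩
  · have := pauliRoot_conj_commute (p := p) (r := 0) (by simp [stringSign,
      show ∀ a, pauliSign a 0 = 1 by decide])
    rw [pauliString_zero, Matrix.mul_one] at this
    exact Matrix.mem_unitaryGroup_iff.2 this
  · rcases stringSign_eq_or p r with h | h
    · exact ⟨r, Or.inl (pauliRoot_conj_commute h)⟩
    · refine ⟨stringMul p r, ?_⟩
      rw [pauliRoot_conj_anticommute h]
      exact anticommute_product h

/-- The square root of the rotation by the product string of `s` and `t` works: it sends `s` to the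
product of that string with `s`, which is `t` up to sign. -/
lemma exists_clifford_of_anticommute {s t : Fin n → Fin 4} (h : stringSign s t = -1) :
    ∃ C, IsClifford C ∧ (C * pauliString s * Cᴴ = pauliString t ∨
      C * pauliString s * Cᴴ = -pauliString t) := by
  have h1 : stringSign (stringMul s t) s = -1 := by
    rw [stringSign_comm, stringSign_mul, stringSign_self, h]; rfl
  refine ⟨_, isClifford_pauliRoot (stringMul s t), ?_⟩
  have h2 := anticommute_product h1
  rw [stringMul_cancel] at h2
  rwa [pauliRoot_conj_anticommute h1]

/-- Two such rotations, through a string which anticommutes with both. -/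
lemma exists_clifford_conj {s t : Fin n → Fin 4} (hs : s ≠ 0) (ht : t ≠ 0) :
    ∃ C, IsClifford C ∧ (C * pauliString s * Cᴴ = pauliString t ∨
      C * pauliString s * Cᴴ = -pauliString t) := by
  obtain ⟨r, hrs, hrt⟩ := exists_common_anticommuting hs ht
  obtain ⟨C, hC, h1⟩ := exists_clifford_of_anticommute ((stringSign_comm s r).trans hrs)
  obtain ⟨C', hC', h2⟩ := exists_clifford_of_anticommute hrt
  refine ⟨C' * C, hC'.mul hC, ?_⟩
  have e : C' * C * pauliString s * (C' * C)ᴴ = C' * (C * pauliString s * Cᴴ) * C'ᴴ := by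
    simp only [Matrix.conjTranspose_mul, Matrix.mul_assoc]
  rw [e]
  rcases h1 with h1 | h1 <;> rcases h2 with h2 | h2 <;> simp [h1, h2]

/-! ### Clifford gates form a unitary two-design -/

/-- Conjugation by a matrix. -/
def conjMap (C : Matrix (Bits n) (Bits n) ℂ) : SuperOp (Bits n) where
  toFun A := C * A * Cᴴ
  map_add' A B := by simp only [Matrix.mul_add, Matrix.add_mul]
  map_smul' c A := by simp only [Matrix.mul_smul, Matrix.smul_mul, RingHom.id_apply]

lemma conjMap_apply (C A : Matrix (Bits n) (Bits n) ℂ) : conjMap C A = C * A * Cᴴ := rfl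

lemma conjMap_comp (C C' : Matrix (Bits n) (Bits n) ℂ) :
    conjMap C ∘ₗ conjMap C' = conjMap (C * C') := by
  ext1 A
  simp only [LinearMap.comp_apply, conjMap_apply, Matrix.conjTranspose_mul, Matrix.mul_assoc]

lemma superOp_ext_pauliString {Φ Ψ : SuperOp (Bits n)}
    (h : ∀ s, Φ (pauliString s) = Ψ (pauliString s)) : Φ = Ψ :=
  LinearMap.ext_on_range span_pauliString h

variable (n) in
/-- The set of all conjugations by Clifford gates. -/
def cliffordMaps : Set (SuperOp (Bits n)) := {Φ | ∃ C, IsClifford C ∧ conjMap C = Φ}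

variable (n) in
-- A conjugation is determined by its values on the Pauli strings, each in a finite set of signed
-- strings. Passing from gates to conjugations removes the global phases, so that group averages
-- become finite sums.
lemma finite_cliffordMaps : (cliffordMaps n).Finite := by
  refine Set.Finite.of_finite_image (f := fun Φ s => Φ (pauliString s)) ?_ ?_
  · refine Set.Finite.subset (Set.Finite.pi' (t := fun _ => Set.range (pauliString (n := n)) ∪
      Set.range fun s => -pauliString (n := n) s) fun _ =>
        (Set.finite_range _).union (Set.finite_range _)) ?_
    rintro _ ⟨_, ⟨C, hC, rfl⟩, rfl⟩ s
    obtain ⟨s', h | h⟩ := hC.2 s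
    · exact Or.inl ⟨s', h.symm⟩
    · exact Or.inr ⟨s', h.symm⟩
  · intro Φ _ Ψ _ h
    exact superOp_ext_pauliString (congrFun h)

instance : Fintype (cliffordMaps n) := (finite_cliffordMaps n).fintype

lemma conjMap_bijective {C : Matrix (Bits n) (Bits n) ℂ} (hC : IsClifford C) :
    conjMap C ∘ₗ conjMap Cᴴ = LinearMap.id ∧ conjMap Cᴴ ∘ₗ conjMap C = LinearMap.id := by
  rw [conjMap_comp, conjMap_comp, hC.mul_conjTranspose_self, hC.conjTranspose_mul_self]
  constructor <;> (ext1 A; simp [conjMap_apply])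

/-- Left composition with a Clifford gate permutes the Clifford maps. -/
def cliffordLeft {C : Matrix (Bits n) (Bits n) ℂ} (hC : IsClifford C) :
    cliffordMaps n ≃ cliffordMaps n where
  toFun g := ⟨conjMap C ∘ₗ g, by
    obtain ⟨_, C', hC', rfl⟩ := g
    exact ⟨C * C', hC.mul hC', (conjMap_comp _ _).symm⟩⟩
  invFun g := ⟨conjMap Cᴴ ∘ₗ g, by
    obtain ⟨_, C', hC', rfl⟩ := g
    exact ⟨Cᴴ * C', hC.conjTranspose.mul hC', (conjMap_comp _ _).symm⟩⟩
  left_inv g := Subtype.ext (by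
    change conjMap Cᴴ ∘ₗ conjMap C ∘ₗ g.1 = g.1
    rw [← LinearMap.comp_assoc, (conjMap_bijective hC).2, LinearMap.id_comp])
  right_inv g := Subtype.ext (by
    change conjMap C ∘ₗ conjMap Cᴴ ∘ₗ g.1 = g.1
    rw [← LinearMap.comp_assoc, (conjMap_bijective hC).1, LinearMap.id_comp])

/-- Right composition with a Clifford gate permutes the Clifford maps. -/
def cliffordRight {C : Matrix (Bits n) (Bits n) ℂ} (hC : IsClifford C) :
    cliffordMaps n ≃ cliffordMaps n where
  toFun g := ⟨g.1 ∘ₗ conjMap C, by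
    obtain ⟨_, C', hC', rfl⟩ := g
    exact ⟨C' * C, hC'.mul hC, (conjMap_comp _ _).symm⟩⟩
  invFun g := ⟨g.1 ∘ₗ conjMap Cᴴ, by
    obtain ⟨_, C', hC', rfl⟩ := g
    exact ⟨C' * Cᴴ, hC'.mul hC.conjTranspose, (conjMap_comp _ _).symm⟩⟩
  left_inv g := Subtype.ext (by
    change (g.1 ∘ₗ conjMap C) ∘ₗ conjMap Cᴴ = g.1
    rw [LinearMap.comp_assoc, (conjMap_bijective hC).1, LinearMap.comp_id])
  right_inv g := Subtype.ext (by
    change (g.1 ∘ₗ conjMap Cᴴ) ∘ₗ conjMap C = g.1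
    rw [LinearMap.comp_assoc, (conjMap_bijective hC).2, LinearMap.comp_id])

/-- The sum of `Tr (X g(A)) g(B)` over all Clifford maps `g`. -/
def twirlSum (X A B : Matrix (Bits n) (Bits n) ℂ) : Matrix (Bits n) (Bits n) ℂ :=
  ∑ g : cliffordMaps n, (X * g.1 A).trace • g.1 B

lemma cliffordMaps_pauliString (g : cliffordMaps n) (s : Fin n → Fin 4) :
    ∃ s', g.1 (pauliString s) = pauliString s' ∨ g.1 (pauliString s) = -pauliString s' := by
  obtain ⟨_, C, hC, rfl⟩ := g
  exact hC.2 s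

lemma cliffordMaps_trace (g : cliffordMaps n) (A : Matrix (Bits n) (Bits n) ℂ) :
    (g.1 A).trace = A.trace := by
  obtain ⟨_, C, hC, rfl⟩ := g
  exact conj_trace hC.conjTranspose_mul_self

lemma cliffordMaps_one (g : cliffordMaps n) : g.1 1 = 1 := by
  obtain ⟨_, C, hC, rfl⟩ := g
  rw [conjMap_apply, Matrix.mul_one, hC.mul_conjTranspose_self]

/-- Right translation by a Pauli string `r` permutes the summands and multiplies them by the signs
of `r` against `t` and `v`. Some `r` makes the product of these signs -1. -/
lemma twirlSum_pauliString_ne (X : Matrix (Bits n) (Bits n) ℂ) {t v : Fin n → Fin 4}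
    (h : t ≠ v) : twirlSum X (pauliString t) (pauliString v) = 0 := by
  obtain ⟨r, hr⟩ := exists_stringSign_ne h
  have hr' : (stringSign r t : ℂ) * (stringSign r v : ℂ) = -1 := by exact_mod_cast hr
  have h1 : twirlSum X (pauliString t) (pauliString v) =
      -twirlSum X (pauliString t) (pauliString v) := by
    conv_lhs => rw [twirlSum, ← Equiv.sum_comp (cliffordRight (isClifford_pauliString r))]
    rw [twirlSum, ← Finset.sum_neg_distrib]
    refine Finset.sum_congr rfl fun g _ => ?_
    change (X * g.1 (conjMap _ _)).trace • g.1 (conjMap _ _) = _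
    rw [conjMap_apply, conjMap_apply, pauliString_conj, pauliString_conj, map_smul, map_smul,
      Matrix.mul_smul, Matrix.trace_smul, smul_smul, smul_eq_mul, mul_right_comm, hr', neg_one_mul,
      neg_smul]
  ext i j
  exact self_eq_neg.1 (congrFun (congrFun h1 i) j)

/-- Left translation by a gate which maps one string to the other up to sign; the square absorbs the
sign. -/
lemma sum_trace_sq_eq {s t v : Fin n → Fin 4} (hs : s ≠ 0) (ht : t ≠ 0) :
    ∑ g : cliffordMaps n, (pauliString s * g.1 (pauliString v)).trace ^ 2 =
      ∑ g : cliffordMaps n, (pauliString t * g.1 (pauliString v)).trace ^ 2 := by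
  obtain ⟨C, hC, h⟩ := exists_clifford_conj ht hs
  rw [← Equiv.sum_comp (cliffordLeft hC)]
  refine Finset.sum_congr rfl fun g _ => ?_
  change (pauliString s * (C * _ * Cᴴ)).trace ^ 2 = _
  have e : ∀ P A : Matrix (Bits n) (Bits n) ℂ,
      ((C * P * Cᴴ) * (C * A * Cᴴ)).trace = (P * A).trace := by
    intro P A
    rw [← conj_trace (A := P * A) hC.conjTranspose_mul_self]
    congr 1
    calc C * P * Cᴴ * (C * A * Cᴴ) = C * P * (Cᴴ * C) * A * Cᴴ := by
          simp only [Matrix.mul_assoc]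
      _ = _ := by rw [hC.conjTranspose_mul_self, Matrix.mul_one]; simp only [Matrix.mul_assoc]
  rw [← e (pauliString t)]
  rcases h with h | h <;> simp [h]

/-- For each conjugation the squared overlaps with all strings sum to `4 ^ n`, as the image is a
single signed string. The identity string contributes nothing, and the other `4 ^ n - 1` strings
share the total equally. -/
lemma sum_trace_sq {s v : Fin n → Fin 4} (hs : s ≠ 0) (hv : v ≠ 0) :
    ((4 : ℂ) ^ n - 1) * ∑ g : cliffordMaps n, (pauliString s * g.1 (pauliString v)).trace ^ 2 =
      Fintype.card (cliffordMaps n) * (4 : ℂ) ^ n := by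
  have h1 : ∀ g : cliffordMaps n,
      ∑ r, (pauliString r * g.1 (pauliString v)).trace ^ 2 = (4 : ℂ) ^ n := by
    intro g
    have h4 : (4 : ℂ) ^ n = (2 ^ n) ^ 2 := by rw [← pow_mul, mul_comm, pow_mul]; norm_num
    obtain ⟨u, hu | hu⟩ := cliffordMaps_pauliString g v <;>
      simp [hu, pauliString_trace_mul, h4, ite_pow]
  have h2 : ∑ r, ∑ g : cliffordMaps n, (pauliString r * g.1 (pauliString v)).trace ^ 2 =
      Fintype.card (cliffordMaps n) * (4 : ℂ) ^ n := by
    rw [Finset.sum_comm]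
    simp [h1]
  have h0 : ∑ g : cliffordMaps n, (pauliString 0 * g.1 (pauliString v)).trace ^ 2 = 0 := by
    refine Finset.sum_eq_zero fun g _ => ?_
    rw [pauliString_zero, Matrix.one_mul, cliffordMaps_trace, pauliString_trace, if_neg hv]
    simp
  rw [← h2, ← Finset.add_sum_erase _ _ (Finset.mem_univ (0 : Fin n → Fin 4)), h0, zero_add,
    Finset.sum_congr rfl fun r hr => sum_trace_sq_eq (Finset.ne_of_mem_erase hr) hs,
    Finset.sum_const, Finset.card_erase_of_mem (Finset.mem_univ _), nsmul_eq_mul]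
  rw [Nat.cast_sub (by simp [Nat.one_le_pow])]
  simp

lemma twirlSum_pauliString_self {s v : Fin n → Fin 4} (hs : s ≠ 0) (hv : v ≠ 0) :
    ((4 : ℂ) ^ n - 1) • twirlSum (pauliString s) (pauliString v) (pauliString v) =
      (Fintype.card (cliffordMaps n) * (2 : ℂ) ^ n) • pauliString s := by
  have h4 : (4 : ℂ) ^ n = 2 ^ n * 2 ^ n := by rw [← mul_pow]; norm_num
  have h2 : (2 : ℂ) ^ n ≠ 0 := pow_ne_zero n two_ne_zero
  have h1 : ∀ g : cliffordMaps n,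
      (pauliString s * g.1 (pauliString v)).trace • g.1 (pauliString v) =
        (((2 : ℂ) ^ n)⁻¹ * (pauliString s * g.1 (pauliString v)).trace ^ 2) • pauliString s := by
    intro g
    obtain ⟨u, hu | hu⟩ := cliffordMaps_pauliString g v <;>
      rw [hu] <;> by_cases hsu : s = u <;>
      simp [hsu, pauliString_trace_mul, pow_two, h2]
  rw [twirlSum, Finset.sum_congr rfl fun g _ => h1 g, ← Finset.sum_smul, ← Finset.mul_sum,
    smul_smul, mul_left_comm, sum_trace_sq hs hv, h4]
  congr 1
  field_simp

/-- The two-design property of the Clifford group. -/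
lemma twirlSum_eq (hn : 1 ≤ n) (X A B : Matrix (Bits n) (Bits n) ℂ) :
    twirlSum X A B = (Fintype.card (cliffordMaps n) : ℂ) •
      (((A * B).trace - A.trace * B.trace / 2 ^ n) / (4 ^ n - 1)) •
        (X - (X.trace / 2 ^ n) • (1 : Matrix (Bits n) (Bits n) ℂ)) +
      (Fintype.card (cliffordMaps n) : ℂ) • (X.trace * A.trace * B.trace / 4 ^ n) •
        (1 : Matrix (Bits n) (Bits n) ℂ) := by
  have h4 : (4 : ℂ) ^ n = 2 ^ n * 2 ^ n := by rw [← mul_pow]; norm_num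
  have h2 : (2 : ℂ) ^ n ≠ 0 := pow_ne_zero n two_ne_zero
  have h41 : (4 : ℂ) ^ n - 1 ≠ 0 := by
    have : (4 : ℕ) ^ n ≠ 1 := by
      have := Nat.one_lt_pow (by omega : n ≠ 0) (by norm_num : 1 < 4); omega
    rw [sub_ne_zero]
    exact_mod_cast this
  have hX : X ∈ Submodule.span ℂ (Set.range (pauliString (n := n))) := span_pauliString ▸ trivial
  have hA : A ∈ Submodule.span ℂ (Set.range (pauliString (n := n))) := span_pauliString ▸ trivial
  have hB : B ∈ Submodule.span ℂ (Set.range (pauliString (n := n))) := span_pauliString ▸ trivial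
  -- Both sides are linear in each of the three matrices, so three span inductions reduce the claim
  -- to Pauli strings.
  induction hB using Submodule.span_induction with
  | zero => simp [twirlSum]
  | add B B' _ _ h h' =>
    have : twirlSum X A (B + B') = twirlSum X A B + twirlSum X A B' := by
      simp [twirlSum, Finset.sum_add_distrib]
    rw [this, h, h', Matrix.mul_add, Matrix.trace_add, Matrix.trace_add]
    module
  | smul c B _ h =>
    have : twirlSum X A (c • B) = c • twirlSum X A B := by
      simp [twirlSum, Finset.smul_sum, smul_comm c]
    rw [this, h, Matrix.mul_smul, Matrix.trace_smul, Matrix.trace_smul, smul_eq_mul, smul_eq_mul]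
    module
  | mem B hB =>
  obtain ⟨v, rfl⟩ := hB
  induction hA using Submodule.span_induction with
  | zero => simp [twirlSum]
  | add A A' _ _ h h' =>
    have : twirlSum X (A + A') (pauliString v) =
        twirlSum X A (pauliString v) + twirlSum X A' (pauliString v) := by
      simp [twirlSum, Finset.sum_add_distrib, Matrix.mul_add, add_smul]
    rw [this, h, h', Matrix.add_mul, Matrix.trace_add, Matrix.trace_add]
    module
  | smul c A _ h =>
    have : twirlSum X (c • A) (pauliString v) = c • twirlSum X A (pauliString v) := by
      simp [twirlSum, Finset.smul_sum, smul_smul]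
    rw [this, h, Matrix.smul_mul, Matrix.trace_smul, Matrix.trace_smul, smul_eq_mul, smul_eq_mul]
    module
  | mem A hA =>
  obtain ⟨t, rfl⟩ := hA
  induction hX using Submodule.span_induction with
  | zero => simp [twirlSum]
  | add X X' _ _ h h' =>
    have : twirlSum (X + X') (pauliString t) (pauliString v) =
        twirlSum X (pauliString t) (pauliString v) + twirlSum X' (pauliString t) (pauliString v) := by
      simp [twirlSum, Finset.sum_add_distrib, Matrix.add_mul, add_smul]
    rw [this, h, h', Matrix.trace_add]
    module
  | smul c X _ h =>
    have : twirlSum (c • X) (pauliString t) (pauliString v) =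
        c • twirlSum X (pauliString t) (pauliString v) := by
      simp [twirlSum, Finset.smul_sum, smul_smul]
    rw [this, h, Matrix.trace_smul, smul_eq_mul]
    module
  | mem X hX =>
  obtain ⟨s, rfl⟩ := hX
  by_cases htv : t = v
  swap
  · rw [twirlSum_pauliString_ne _ htv, pauliString_trace_mul, if_neg htv, pauliString_trace,
      pauliString_trace]
    by_cases ht : t = 0
    · have hv : v ≠ 0 := fun hv => htv (ht.trans hv.symm)
      simp [hv]
    · simp [ht]
  subst htv
  by_cases ht : t = 0
  · subst ht
    -- The identity string is fixed by all conjugations, so here the average is exactly the trace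
    -- term.
    have h1 : twirlSum (pauliString s) (pauliString (0 : Fin n → Fin 4)) (pauliString 0) =
        (Fintype.card (cliffordMaps n) : ℂ) • (pauliString s).trace • 1 := by
      simp [twirlSum, pauliString_zero, cliffordMaps_one, ← Nat.cast_smul_eq_nsmul ℂ]
    rw [h1, pauliString_trace_mul, pauliString_trace 0, if_pos rfl]
    rw [show ((2 : ℂ) ^ n - 2 ^ n * 2 ^ n / 2 ^ n) / (4 ^ n - 1) = 0 by field_simp; simp, zero_smul,
      smul_zero, zero_add, h4]
    congr 2
    field_simp
  · by_cases hs : s = 0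
    · subst hs
      have h1 : twirlSum (pauliString 0) (pauliString t) (pauliString t) = 0 := by
        refine Finset.sum_eq_zero fun g _ => ?_
        rw [pauliString_zero, Matrix.one_mul, cliffordMaps_trace, pauliString_trace, if_neg ht,
          zero_smul]
      rw [h1, pauliString_trace 0, if_pos rfl, pauliString_trace t, if_neg ht, pauliString_zero,
        div_self h2]
      simp
    · have h1 := twirlSum_pauliString_self hs ht
      rw [pauliString_trace_mul, if_pos rfl, pauliString_trace t, if_neg ht, pauliString_trace s,
        if_neg hs]
      have h3 := congrArg (fun M => ((4 : ℂ) ^ n - 1)⁻¹ • M) h1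
      simp only [smul_smul, inv_mul_cancel₀ h41, one_smul] at h3
      rw [h3]
      simp only [zero_div, zero_mul, sub_zero, zero_smul, smul_zero, add_zero, smul_smul]
      congr 1
      field_simp

/-- There is a finite family of Clifford gates which is a unitary two-design. -/
theorem exists_clifford_design (hn : 1 ≤ n) :
    ∃ (m : ℕ) (C : Fin m → CliffordGate n), 0 < m ∧ ∀ X A B : Matrix (Bits n) (Bits n) ℂ,
      ∑ i, (X * ((C i).1 * A * (C i).1ᴴ)).trace • ((C i).1 * B * (C i).1ᴴ) =
        (m : ℂ) • (((A * B).trace - A.trace * B.trace / 2 ^ n) / (4 ^ n - 1)) •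
          (X - (X.trace / 2 ^ n) • (1 : Matrix (Bits n) (Bits n) ℂ)) +
        (m : ℂ) • (X.trace * A.trace * B.trace / 4 ^ n) • (1 : Matrix (Bits n) (Bits n) ℂ) := by
  choose C hC hCg using fun g : cliffordMaps n => g.2
  let e := Fintype.equivFin (cliffordMaps n)
  have : Nonempty (cliffordMaps n) := ⟨⟨_, _, isClifford_pauliString 0, rfl⟩⟩
  refine ⟨Fintype.card (cliffordMaps n), fun i => ⟨C (e.symm i), hC _⟩, Fintype.card_pos,
    fun X A B => ?_⟩
  rw [← twirlSum_eq hn, twirlSum, ← Equiv.sum_comp e.symm]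
  refine Finset.sum_congr rfl fun i _ => ?_
  simp only [← hCg (e.symm i), conjMap_apply]

end Strings

/-! ### Outcome probabilities -/

open scoped MatrixOrder in
-- The trace of `A B` is the trace of the positive matrix `√A B √A`.
lemma trace_mul_nonneg {D : Type*} [Fintype D] [DecidableEq D] {A B : Matrix D D ℂ}
    (hA : A.PosSemidef) (hB : B.PosSemidef) : 0 ≤ (A * B).trace := by
  have h := (hB.mul_mul_conjTranspose_same (CFC.sqrt A)).trace_nonneg
  rwa [(Matrix.nonneg_iff_posSemidef.1 (CFC.sqrt_nonneg A)).1.eq, Matrix.mul_assoc, Matrix.trace_mul_comm,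
    Matrix.mul_assoc, CFC.sqrt_mul_sqrt_self A hA.nonneg, Matrix.trace_mul_comm] at h

lemma IsCPTP.posSemidef {D : Type*} [Fintype D] {Φ : SuperOp D} (h : IsCPTP Φ) {A : Matrix D D ℂ}
    (hA : A.PosSemidef) : (Φ A).PosSemidef :=
  (h.1 1 _ (hA.submatrix (Prod.fst : D × Fin 1 → D))).submatrix fun i => (i, 0)

lemma IsCPTP.isState {D : Type*} [Fintype D] {Φ : SuperOp D} (h : IsCPTP Φ) {A : Matrix D D ℂ}
    (hA : IsState A) : IsState (Φ A) :=
  ⟨h.posSemidef hA.1, (h.2 A).trans hA.2⟩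

namespace WorldModel

variable {D : Type} [Fintype D] [DecidableEq D] {X : Type u} {Y : Type v} {Z : Type w}
  {B : Z → Type t} [∀ z, Fintype (B z)]

lemma isState_foldl (W : WorldModel D X Y Z B) (l : List Y) {σ : Matrix D D ℂ} (h : IsState σ) :
    IsState (l.foldl (fun σ y => W.channel y σ) σ) := by
  induction l generalizing σ with
  | nil => exact h
  | cons y l ih => exact ih ((W.isCPTP y).isState h)

lemma outcomeProb_nonneg (W : WorldModel D X Y Z B) (E : Experiment X Y Z) (b : B E.meas) :
    0 ≤ W.outcomeProb E b :=
  (Complex.nonneg_iff.1 (trace_mul_nonneg ((W.isPOVM E.meas).1 b)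
    (W.isState_foldl E.evol (W.isState E.prep)).1)).1

/-- The trace is nonnegative in the order of `ℂ`, hence real. This permits complex-linear algebra
with the probabilities. -/
lemma outcomeProb_coe (W : WorldModel D X Y Z B) (E : Experiment X Y Z) (b : B E.meas) :
    (W.outcomeProb E b : ℂ) =
      (W.povm E.meas b * E.evol.foldl (fun σ y => W.channel y σ) (W.state E.prep)).trace :=
  (Complex.eq_re_of_ofReal_le (trace_mul_nonneg ((W.isPOVM E.meas).1 b)
    (W.isState_foldl E.evol (W.isState E.prep)).1)).symm

lemma sum_outcomeProb (W : WorldModel D X Y Z B) (E : Experiment X Y Z) :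
    ∑ b, W.outcomeProb E b = 1 := by
  have h : ((∑ b, W.outcomeProb E b : ℝ) : ℂ) = 1 := by
    push_cast
    simp only [outcomeProb_coe]
    rw [← Matrix.trace_sum, ← Finset.sum_mul, (W.isPOVM E.meas).2, Matrix.one_mul]
    exact (W.isState_foldl E.evol (W.isState E.prep)).2
  exact_mod_cast h

end WorldModel

/-! ### Expected values, composition and repetition of agents -/

namespace Agent

variable {X : Type u} {Y : Type v} {Z : Type w} {B : Z → Type t}
  {α β : Type}

/-- Run an agent and then continue depending on its output. -/
def bind : Agent X Y Z B α → (α → Agent X Y Z B β) → Agent X Y Z B β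
  | output a, f => f a
  | toss k p next, f => toss k p fun i => (next i).bind f
  | experiment E next, f => experiment E fun b => (next b).bind f

/-- Run an agent `k` times and output the list of its outputs. -/
def rep (A : Agent X Y Z B α) : ℕ → Agent X Y Z B (List α)
  | 0 => output []
  | k + 1 => A.bind fun a => (rep A k).bind fun l => output (a :: l)

/-- Toss a fair coin with `m` faces. -/
def uniform (m : ℕ) (hm : 0 < m) : Agent X Y Z B (Fin m) :=
  toss m ⟨fun _ => (m : ℝ)⁻¹, fun _ => by positivity, by
    have : (m : ℝ) ≠ 0 := by positivity
    simp [this]⟩ output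

variable [∀ z, Fintype (B z)]

section Expect

variable {D : Type} [Fintype D] [DecidableEq D]

/-- The expected value of a function of the output. -/
def expect (W : WorldModel D X Y Z B) (g : α → ℝ) : Agent X Y Z B α → ℝ
  | output a => g a
  | toss _ p next => ∑ i, p.1 i * expect W g (next i)
  | experiment E next => ∑ b, W.outcomeProb E b * expect W g (next b)

variable (W : WorldModel D X Y Z B)

open Classical in
lemma prob_eq_expect (S : Set α) (A : Agent X Y Z B α) :
    A.prob W S = A.expect W fun a => if a ∈ S then 1 else 0 := by
  induction A with
  | output a => rfl
  | toss k p next ih => simp only [prob, expect, ih]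
  | experiment E next ih => simp only [prob, expect, ih]

lemma expect_const (c : ℝ) (A : Agent X Y Z B α) : A.expect W (fun _ => c) = c := by
  induction A with
  | output a => rfl
  | toss k p next ih => simp only [expect, ih, ← Finset.sum_mul, p.2.2, one_mul]
  | experiment E next ih =>
    simp only [expect, ih, ← Finset.sum_mul, W.sum_outcomeProb, one_mul]

lemma expect_add (g h : α → ℝ) (A : Agent X Y Z B α) :
    A.expect W (fun a => g a + h a) = A.expect W g + A.expect W h := by
  induction A with
  | output a => rfl
  | toss k p next ih => simp only [expect, ih, mul_add, Finset.sum_add_distrib]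
  | experiment E next ih => simp only [expect, ih, mul_add, Finset.sum_add_distrib]

lemma expect_const_mul (c : ℝ) (g : α → ℝ) (A : Agent X Y Z B α) :
    A.expect W (fun a => c * g a) = c * A.expect W g := by
  induction A with
  | output a => rfl
  | toss k p next ih => simp only [expect, ih, Finset.mul_sum, mul_left_comm]
  | experiment E next ih => simp only [expect, ih, Finset.mul_sum, mul_left_comm]

lemma expect_sum {κ : Type*} (s : Finset κ) (g : κ → α → ℝ) (A : Agent X Y Z B α) :
    A.expect W (fun a => ∑ j ∈ s, g j a) = ∑ j ∈ s, A.expect W (g j) := by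
  classical
  induction s using Finset.induction_on with
  | empty => simpa using expect_const W 0 A
  | insert j s hj ih => simp only [Finset.sum_insert hj, expect_add, ih]

lemma expect_mono {g h : α → ℝ} (hgh : ∀ a, g a ≤ h a) (A : Agent X Y Z B α) :
    A.expect W g ≤ A.expect W h := by
  induction A with
  | output a => exact hgh a
  | toss k p next ih =>
    exact Finset.sum_le_sum fun i _ => mul_le_mul_of_nonneg_left (ih i) (p.2.1 i)
  | experiment E next ih =>
    exact Finset.sum_le_sum fun b _ =>
      mul_le_mul_of_nonneg_left (ih b) (W.outcomeProb_nonneg E b)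

lemma expect_bind (g : β → ℝ) (A : Agent X Y Z B α) (f : α → Agent X Y Z B β) :
    (A.bind f).expect W g = A.expect W fun a => (f a).expect W g := by
  induction A with
  | output a => rfl
  | toss k p next ih => simp only [bind, expect, ih]
  | experiment E next ih => simp only [bind, expect, ih]

lemma expect_uniform (m : ℕ) (hm : 0 < m) (g : Fin m → ℝ) :
    (uniform (X := X) (Y := Y) (Z := Z) (B := B) m hm).expect W g = (m : ℝ)⁻¹ * ∑ i, g i := by
  simp only [uniform, expect, Finset.mul_sum]

lemma expect_rep_sum (v : α → ℝ) (A : Agent X Y Z B α) (k : ℕ) :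
    (A.rep k).expect W (fun l => (l.map v).sum) = k * A.expect W v := by
  induction k with
  | zero => simp [rep, expect]
  | succ k ih =>
    simp only [rep, expect_bind, expect, List.map_cons, List.sum_cons, expect_add, expect_const,
      ih]
    push_cast; ring

/-- The runs are independent, so the cross terms in the square vanish and variances add. -/
lemma expect_rep_sq (v : α → ℝ) (A : Agent X Y Z B α) (k : ℕ) :
    (A.rep k).expect W (fun l => ((l.map v).sum - k * A.expect W v) ^ 2) =
      k * A.expect W (fun a => (v a - A.expect W v) ^ 2) := by
  induction k with
  | zero => simp [rep, expect]
  | succ k ih =>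
    set μ := A.expect W v with hμ
    have h1 : ∀ (a : α) (l : List α), (v a + (l.map v).sum - ((k + 1 : ℕ) : ℝ) * μ) ^ 2 =
        (v a - μ) ^ 2 + ((l.map v).sum - k * μ) ^ 2 +
          (2 * (v a - μ)) * ((l.map v).sum + -(k * μ)) := by
      intro a l; push_cast; ring
    have h2 : (A.rep k).expect W (fun l => (l.map v).sum + -(k * μ)) = 0 := by
      rw [expect_add, expect_rep_sum, expect_const, ← hμ]; ring
    simp only [rep, expect_bind, expect, List.map_cons, List.sum_cons, h1, expect_add,
      expect_const, expect_const_mul, ih, h2]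
    push_cast
    simp only [mul_zero, expect_const]
    ring

/-- The mean squared error of the empirical mean of a bounded vector-valued function. -/
lemma expect_rep_mean {κ : Type*} [Fintype κ] (v : α → κ → ℝ) {R : ℝ}
    (hR : ∀ a, ∑ j, v a j ^ 2 ≤ R) (A : Agent X Y Z B α) {k : ℕ} (hk : 0 < k) :
    (A.rep k).expect W (fun l => ∑ j, ((l.map fun a => v a j).sum / k -
      A.expect W fun a => v a j) ^ 2) ≤ R / k := by
  have hk' : (0 : ℝ) < k := by exact_mod_cast hk
  have h1 : ∀ (j : κ) (l : List α), ((l.map fun a => v a j).sum / k -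
      A.expect W fun a => v a j) ^ 2 = ((k : ℝ) ^ 2)⁻¹ *
        ((l.map fun a => v a j).sum - k * A.expect W fun a => v a j) ^ 2 := by
    intro j l; field_simp
  -- The variance is at most the second moment, which is where the bound `R` applies.
  have h2 : ∀ j, A.expect W (fun a => (v a j - A.expect W fun a => v a j) ^ 2) ≤
      A.expect W fun a => v a j ^ 2 := by
    intro j
    set μ := A.expect W fun a => v a j with hμ
    have h3 : ∀ a, (v a j - μ) ^ 2 = v a j ^ 2 + (-(2 * μ) * v a j + μ ^ 2) := by
      intro a; ring
    simp only [h3, expect_add, expect_const_mul, expect_const, ← hμ]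
    nlinarith [sq_nonneg μ]
  simp only [expect_sum, h1, expect_const_mul, expect_rep_sq]
  calc ∑ j, ((k : ℝ) ^ 2)⁻¹ * (k * A.expect W fun a => (v a j - A.expect W fun a => v a j) ^ 2)
      ≤ ∑ j, ((k : ℝ) ^ 2)⁻¹ * (k * A.expect W fun a => v a j ^ 2) := by
        refine Finset.sum_le_sum fun j _ => ?_
        gcongr
        exact h2 j
    _ = (k : ℝ)⁻¹ * A.expect W fun a => ∑ j, v a j ^ 2 := by
        rw [expect_sum, Finset.mul_sum]
        refine Finset.sum_congr rfl fun j _ => ?_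
        field_simp
    _ ≤ (k : ℝ)⁻¹ * R := by
        gcongr
        exact (expect_mono W hR A).trans (expect_const W R A).le
    _ = R / k := by rw [div_eq_inv_mul]

/-- A Markov inequality. -/
lemma le_prob_of_expect_le {S : Set α} (g : α → ℝ) {δ : ℝ} (A : Agent X Y Z B α)
    (hg : A.expect W g ≤ δ) (h0 : ∀ a, 0 ≤ g a) (h1 : ∀ a, g a < 1 → a ∈ S) :
    1 - δ ≤ A.prob W S := by
  classical
  rw [prob_eq_expect]
  calc 1 - δ ≤ A.expect W fun a => 1 + (-1) * g a := by
        rw [expect_add, expect_const, expect_const_mul]; linarith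
    _ ≤ _ := expect_mono W (fun a => by
        split_ifs with h
        · linarith [h0 a]
        · linarith [not_lt.1 fun hl => h (h1 a hl)]) A

lemma prob_bind_output (S : Set β) (A : Agent X Y Z B α) (f : α → β) :
    (A.bind fun a => output (f a)).prob W S = A.prob W (f ⁻¹' S) := by
  classical
  rw [prob_eq_expect, prob_eq_expect, expect_bind]
  rfl

end Expect

section Count

variable (P : Experiment X Y Z → Prop)

lemma count_bind_le (A : Agent X Y Z B α) (f : α → Agent X Y Z B β) {c : ℕ}
    (hf : ∀ a, (f a).count P ≤ c) : (A.bind f).count P ≤ A.count P + c := by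
  induction A with
  | output a => simpa [bind, count] using hf a
  | toss k p next ih =>
    refine Finset.sup_le fun i _ => (ih i).trans ?_
    gcongr
    exact Finset.le_sup (f := fun i => count P (next i)) (Finset.mem_univ i)
  | experiment E next ih =>
    simp only [bind, count]
    rw [add_assoc]
    gcongr
    refine Finset.sup_le fun b _ => (ih b).trans ?_
    gcongr
    exact Finset.le_sup (f := fun b => count P (next b)) (Finset.mem_univ b)

lemma count_rep_le (A : Agent X Y Z B α) (k : ℕ) : (A.rep k).count P ≤ k * A.count P := by
  induction k with
  | zero => simp [rep, count]
  | succ k ih =>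
    have h : ∀ a, ((A.rep k).bind fun l => output (B := B) (a :: l)).count P ≤ k * A.count P :=
      fun a => (count_bind_le P _ _ (c := 0) fun l => le_rfl).trans (by simpa using ih)
    calc _ ≤ A.count P + k * A.count P := count_bind_le P _ _ h
      _ = _ := by ring

lemma count_uniform (m : ℕ) (hm : 0 < m) :
    (uniform (X := X) (Y := Y) (Z := Z) (B := B) m hm).count P = 0 :=
  Nat.le_zero.1 (Finset.sup_le fun _ _ => le_rfl)

end Count

end Agent

/-! ### Trace norm, Hilbert-Schmidt norm and diamond norm -/

attribute [local instance] Matrix.frobeniusNormedAddCommGroup Matrix.frobeniusNormedSpace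

section Norms

variable {D : Type*} [Fintype D] [DecidableEq D]

lemma frobenius_norm_sq {R : Type*} [Fintype R] (A : Matrix D R ℂ) :
    ‖A‖ ^ 2 = ∑ i, ∑ j, ‖A i j‖ ^ 2 := by
  rw [Matrix.frobenius_norm_def, ← Real.sqrt_eq_rpow, Real.sq_sqrt (by positivity)]
  simp

lemma hsNorm_eq_norm (A : Matrix D D ℂ) : hsNorm A = ‖A‖ := by
  rw [hsNorm, ← frobenius_norm_sq, Real.sqrt_sq (norm_nonneg _)]

lemma trace_conjTranspose_mul_self (A : Matrix D D ℂ) : (Aᴴ * A).trace = ((‖A‖ ^ 2 : ℝ) : ℂ) := by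
  rw [frobenius_norm_sq, Finset.sum_comm]
  simp only [Matrix.trace, Matrix.diag_apply, Matrix.mul_apply, Matrix.conjTranspose_apply]
  push_cast
  refine Finset.sum_congr rfl fun i _ => Finset.sum_congr rfl fun j _ => ?_
  rw [Complex.star_def, Complex.conj_mul']

lemma sum_eigenvalues_conjTranspose_mul_self (A : Matrix D D ℂ) :
    ∑ i, (Matrix.isHermitian_conjTranspose_mul_self A).eigenvalues i = ‖A‖ ^ 2 := by
  have h := (Matrix.isHermitian_conjTranspose_mul_self A).trace_eq_sum_eigenvalues
  rw [trace_conjTranspose_mul_self] at h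
  simpa [← Complex.ofReal_pow] using congrArg Complex.re h.symm

lemma eigenvalues_conjTranspose_mul_self_nonneg (A : Matrix D D ℂ) (i : D) :
    0 ≤ (Matrix.isHermitian_conjTranspose_mul_self A).eigenvalues i :=
  (Matrix.posSemidef_conjTranspose_mul_self A).eigenvalues_nonneg i

lemma traceNorm_nonneg (A : Matrix D D ℂ) : 0 ≤ traceNorm A :=
  Finset.sum_nonneg fun _ _ => Real.sqrt_nonneg _

lemma norm_le_traceNorm (A : Matrix D D ℂ) : ‖A‖ ≤ traceNorm A := by
  refine le_of_sq_le_sq ?_ (traceNorm_nonneg A)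
  rw [← sum_eigenvalues_conjTranspose_mul_self, traceNorm]
  refine le_trans (le_of_eq ?_) (Finset.sum_sq_le_sq_sum_of_nonneg fun i _ => Real.sqrt_nonneg _)
  exact Finset.sum_congr rfl fun i _ =>
    (Real.sq_sqrt (eigenvalues_conjTranspose_mul_self_nonneg A i)).symm

/-- Cauchy–Schwarz for the singular values. This and `norm_le_traceNorm` let all estimates be made
in the Frobenius norm. -/
lemma traceNorm_le (A : Matrix D D ℂ) : traceNorm A ≤ Real.sqrt (Fintype.card D) * ‖A‖ := by
  refine le_of_sq_le_sq ?_ (by positivity)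
  rw [mul_pow, Real.sq_sqrt (by positivity), ← sum_eigenvalues_conjTranspose_mul_self, traceNorm]
  refine sq_sum_le_card_mul_sum_sq.trans (le_of_eq ?_)
  congr 1
  exact Finset.sum_congr rfl fun i _ =>
    Real.sq_sqrt (eigenvalues_conjTranspose_mul_self_nonneg A i)

lemma norm_trace_mul_le (A B : Matrix D D ℂ) : ‖(A * B).trace‖ ≤ ‖A‖ * ‖B‖ := by
  have h : (A * B).trace = ∑ p : D × D, A p.1 p.2 * B p.2 p.1 := by
    rw [Fintype.sum_prod_type]
    simp only [Matrix.trace, Matrix.diag_apply, Matrix.mul_apply]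
  have hA : ‖A‖ = Real.sqrt (∑ p : D × D, ‖A p.1 p.2‖ ^ 2) := by
    rw [Fintype.sum_prod_type]
    change _ = Real.sqrt (∑ i, ∑ j, ‖A i j‖ ^ 2)
    rw [← frobenius_norm_sq, Real.sqrt_sq (norm_nonneg _)]
  have hB : ‖B‖ = Real.sqrt (∑ p : D × D, ‖B p.2 p.1‖ ^ 2) := by
    rw [Fintype.sum_prod_type_right]
    change _ = Real.sqrt (∑ i, ∑ j, ‖B i j‖ ^ 2)
    rw [← frobenius_norm_sq, Real.sqrt_sq (norm_nonneg _)]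
  rw [h, hA, hB]
  refine (norm_sum_le _ _).trans ?_
  simp only [norm_mul]
  exact Real.sum_mul_le_sqrt_mul_sqrt _ _ _

lemma norm_entry_le {R : Type*} [Fintype R] (A : Matrix D R ℂ) (i : D) (j : R) : ‖A i j‖ ≤ ‖A‖ := by
  refine le_of_sq_le_sq ?_ (norm_nonneg A)
  rw [frobenius_norm_sq]
  exact (Finset.single_le_sum (f := fun j => ‖A i j‖ ^ 2) (fun _ _ => sq_nonneg _)
    (Finset.mem_univ j)).trans (Finset.single_le_sum (f := fun i => ∑ j, ‖A i j‖ ^ 2)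
      (fun _ _ => Finset.sum_nonneg fun _ _ => sq_nonneg _) (Finset.mem_univ i))

lemma norm_one_sq : ‖(1 : Matrix D D ℂ)‖ ^ 2 = Fintype.card D := by
  have h := trace_conjTranspose_mul_self (1 : Matrix D D ℂ)
  rw [Matrix.conjTranspose_one, Matrix.one_mul, Matrix.trace_one] at h
  exact_mod_cast h.symm

lemma norm_conj {C : Matrix D D ℂ} (hC : Cᴴ * C = 1) (A : Matrix D D ℂ) :
    ‖C * A * Cᴴ‖ = ‖A‖ := by
  refine (sq_eq_sq₀ (norm_nonneg _) (norm_nonneg _)).1 ?_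
  have h := trace_conjTranspose_mul_self (C * A * Cᴴ)
  have e : (C * A * Cᴴ)ᴴ * (C * A * Cᴴ) = C * (Aᴴ * A) * Cᴴ := by
    simp only [Matrix.conjTranspose_mul, Matrix.conjTranspose_conjTranspose]
    calc C * (Aᴴ * Cᴴ) * (C * A * Cᴴ) = C * Aᴴ * (Cᴴ * C) * A * Cᴴ := by
          simp only [Matrix.mul_assoc]
      _ = _ := by rw [hC, Matrix.mul_one]; simp only [Matrix.mul_assoc]
  rw [e, Matrix.trace_mul_comm, ← Matrix.mul_assoc, hC, Matrix.one_mul,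
    trace_conjTranspose_mul_self] at h
  exact_mod_cast h.symm

/-- The principal minor on the rows `i`, `j` is nonnegative. -/
lemma posSemidef_norm_entry_sq_le {A : Matrix D D ℂ} (hA : A.PosSemidef) (i j : D) :
    ‖A i j‖ ^ 2 ≤ (A i i).re * (A j j).re := by
  have hdet := (hA.submatrix ![i, j]).det_nonneg
  rw [Matrix.det_fin_two] at hdet
  simp only [Matrix.submatrix_apply, Matrix.cons_val_zero, Matrix.cons_val_one] at hdet
  have h1 : A j i = star (A i j) := (hA.1.apply j i).symm
  have hd : ∀ k, A k k = ((A k k).re : ℂ) := fun k =>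
    Complex.eq_re_of_ofReal_le (r := 0) (by simpa using hA.diag_nonneg)
  rw [h1, Complex.star_def, Complex.mul_conj', hd i, hd j] at hdet
  have : (0 : ℝ) ≤ (A i i).re * (A j j).re - ‖A i j‖ ^ 2 := by exact_mod_cast hdet
  linarith

lemma posSemidef_norm_le_trace {A : Matrix D D ℂ} (h : A.PosSemidef) : ‖A‖ ≤ A.trace.re := by
  have htr : A.trace.re = ∑ i, (A i i).re := by simp [Matrix.trace]
  refine le_of_sq_le_sq ?_ (Complex.nonneg_iff.1 h.trace_nonneg).1
  rw [frobenius_norm_sq]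
  calc ∑ i, ∑ j, ‖A i j‖ ^ 2 ≤ ∑ i, ∑ j, (A i i).re * (A j j).re :=
        Finset.sum_le_sum fun i _ => Finset.sum_le_sum fun j _ =>
          posSemidef_norm_entry_sq_le h i j
    _ = A.trace.re ^ 2 := by rw [← Finset.sum_mul_sum, htr, sq]

lemma IsState.norm_le_one {ρ : Matrix D D ℂ} (h : IsState ρ) : ‖ρ‖ ≤ 1 :=
  (posSemidef_norm_le_trace h.1).trans (by rw [h.2, Complex.one_re])

lemma ampliation_norm_sq (R : Type*) [Fintype R] [DecidableEq R] (Φ : SuperOp D)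
    (A : Matrix (D × R) (D × R) ℂ) :
    ‖ampliation R Φ A‖ ^ 2 = ∑ r, ∑ s, ‖Φ (Matrix.of fun i j => A (i, r) (j, s))‖ ^ 2 := by
  simp only [frobenius_norm_sq, Fintype.sum_prod_type, ampliation, Matrix.of_apply]
  calc ∑ i, ∑ r, ∑ j, ∑ s, ‖Φ (Matrix.of fun i j => A (i, r) (j, s)) i j‖ ^ 2
      = ∑ i, ∑ r, ∑ s, ∑ j, ‖Φ (Matrix.of fun i j => A (i, r) (j, s)) i j‖ ^ 2 :=
        Finset.sum_congr rfl fun i _ => Finset.sum_congr rfl fun r _ => Finset.sum_comm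
    _ = ∑ r, ∑ i, ∑ s, ∑ j, ‖Φ (Matrix.of fun i j => A (i, r) (j, s)) i j‖ ^ 2 :=
        Finset.sum_comm
    _ = _ := Finset.sum_congr rfl fun r _ => Finset.sum_comm

lemma ampliation_id (R : Type*) (A : Matrix (D × R) (D × R) ℂ) :
    ampliation R (LinearMap.id : SuperOp D) A = A := rfl

/-- The ampliation acts block by block, so it has the same Frobenius bound. The factor is `√(d²) =
d`, the cost of passing to the trace norm on the doubled system. -/
lemma diamondNormLE_of_norm_le {Φ : SuperOp D} {c : ℝ} (hc : 0 ≤ c)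
    (h : ∀ A, ‖Φ A‖ ≤ c * ‖A‖) : DiamondNormLE Φ (Fintype.card D * c) := by
  intro A
  have h1 : ‖ampliation D Φ A‖ ≤ c * ‖A‖ := by
    refine le_of_sq_le_sq ?_ (by positivity)
    rw [mul_pow, ampliation_norm_sq, ← ampliation_id D A, ampliation_norm_sq, Finset.mul_sum]
    simp only [Finset.mul_sum, ← mul_pow]
    refine Finset.sum_le_sum fun r _ => Finset.sum_le_sum fun s _ => ?_
    gcongr
    exact h _
  calc traceNorm (ampliation D Φ A) ≤ Real.sqrt (Fintype.card (D × D)) * ‖ampliation D Φ A‖ :=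
        traceNorm_le _
    _ = Fintype.card D * ‖ampliation D Φ A‖ := by
        rw [Fintype.card_prod, Nat.cast_mul, Real.sqrt_mul_self (by positivity)]
    _ ≤ Fintype.card D * (c * traceNorm A) := by
        gcongr
        exact h1.trans (by gcongr; exact norm_le_traceNorm A)
    _ = _ := by ring

/-- The block matrix whose `(r, r)` ancilla block is `A` and whose other blocks vanish. -/
def ancillaBlock (r : D) (A : Matrix D D ℂ) : Matrix (D × D) (D × D) ℂ :=
  Matrix.of fun p q => if p.2 = r ∧ q.2 = r then A p.1 q.1 else 0

lemma ampliation_ancillaBlock (r : D) (Φ : SuperOp D) (A : Matrix D D ℂ) :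
    ampliation D Φ (ancillaBlock r A) = ancillaBlock r (Φ A) := by
  ext p q
  simp only [ampliation, ancillaBlock, Matrix.of_apply]
  split_ifs with h
  · rfl
  · have : (Matrix.of fun _ _ => 0 : Matrix D D ℂ) = 0 := rfl
    rw [this, map_zero, Matrix.zero_apply]

lemma norm_ancillaBlock (r : D) (A : Matrix D D ℂ) : ‖ancillaBlock r A‖ = ‖A‖ := by
  refine (sq_eq_sq₀ (norm_nonneg _) (norm_nonneg _)).1 ?_
  rw [← ampliation_id D (ancillaBlock r A), ampliation_norm_sq,
    Finset.sum_eq_single r, Finset.sum_eq_single r]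
  · simp only [ancillaBlock, Matrix.of_apply, and_self, if_true]
    rfl
  · intro s _ hs
    simp [ancillaBlock, hs, frobenius_norm_sq]
  · simp
  · intro s _ hs
    simp [ancillaBlock, hs, frobenius_norm_sq]
  · simp

/-- The contraction is iterated in the trace norm on a single ancilla block, and only then converted
to the Frobenius norm. Thus the dimension is paid once and not once per power. -/
lemma DiamondNormLE.norm_pow_le [Nonempty D] {T : SuperOp D} {η : ℝ} (h0 : 0 ≤ η)
    (h : DiamondNormLE T η) (k : ℕ) (A : Matrix D D ℂ) :
    ‖(T ^ k) A‖ ≤ Fintype.card D * η ^ k * ‖A‖ := by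
  obtain ⟨r⟩ := ‹Nonempty D›
  have h1 : traceNorm (ancillaBlock r ((T ^ k) A)) ≤ η ^ k * traceNorm (ancillaBlock r A) := by
    induction k with
    | zero => simp
    | succ k ih =>
      rw [pow_succ', Module.End.mul_apply, ← ampliation_ancillaBlock]
      refine (h _).trans ?_
      rw [pow_succ', mul_assoc]
      gcongr
  calc ‖(T ^ k) A‖ = ‖ancillaBlock r ((T ^ k) A)‖ := (norm_ancillaBlock _ _).symm
    _ ≤ η ^ k * traceNorm (ancillaBlock r A) := (norm_le_traceNorm _).trans h1
    _ ≤ η ^ k * (Real.sqrt (Fintype.card (D × D)) * ‖ancillaBlock r A‖) := by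
        gcongr
        exact traceNorm_le _
    _ = _ := by
        rw [Fintype.card_prod, Nat.cast_mul, Real.sqrt_mul_self (by positivity),
          norm_ancillaBlock]
        ring

variable (D) in
/-- Maps which are close to the identity in diamond norm have uniformly bounded inverses. -/
lemma exists_inverse_bound [Nonempty D] {η : ℝ} (h0 : 0 ≤ η) (h1 : η < 1) :
    ∃ c : ℝ, 0 < c ∧ ∀ N : SuperOp D, DiamondNormLE (N - LinearMap.id) η →
      ∀ A, ‖A‖ ≤ c * ‖N A‖ := by
  have hd : (0 : ℝ) < Fintype.card D := by exact_mod_cast Fintype.card_pos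
  -- In the Frobenius norm `N - id` itself need not be a contraction, but its `k`-th power has norm
  -- at most 1/2 once `d η ^ k < 1/2`.
  obtain ⟨k, hk⟩ := exists_pow_lt_of_lt_one (show 0 < 1 / (2 * Fintype.card D : ℝ) by positivity) h1
  refine ⟨2 * ∑ j ∈ Finset.range k, (Fintype.card D * η ^ j) + 1, by positivity, fun N hN A => ?_⟩
  set T : SuperOp D := N - LinearMap.id with hT
  have hneg : ∀ (j : ℕ) (A : Matrix D D ℂ), ‖((-T) ^ j) A‖ ≤ Fintype.card D * η ^ j * ‖A‖ := by
    intro j A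
    rw [show (-T) ^ j = (-1) ^ j * T ^ j from neg_pow (R := Module.End ℂ (Matrix D D ℂ)) T j,
      Module.End.mul_apply]
    rcases neg_one_pow_eq_or (SuperOp D) j with h | h <;> rw [h]
    · simpa using hN.norm_pow_le h0 j A
    · simpa using hN.norm_pow_le h0 j A
  -- The Neumann series of the inverse of `id + T`, truncated after `k` terms; the remainder is
  -- absorbed into the left side.
  have hgeom : A = ∑ j ∈ Finset.range k, ((-T) ^ j) (N A) + ((-T) ^ k) A := by
    have h2 := congrArg (fun Φ : SuperOp D => Φ A) (geom_sum_mul_neg (-T) k)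
    have h3 : (1 : SuperOp D) - -T = N := by rw [hT]; ext1 A; simp
    rw [h3] at h2
    simp only [Module.End.mul_apply, LinearMap.sum_apply, LinearMap.sub_apply,
      Module.End.one_apply] at h2
    rw [h2]; abel
  have hk' : Fintype.card D * η ^ k * ‖A‖ ≤ 1 / 2 * ‖A‖ := by
    gcongr
    rw [lt_div_iff₀ (by positivity)] at hk
    linarith
  have h4 : ‖A‖ ≤ ∑ j ∈ Finset.range k, (Fintype.card D * η ^ j * ‖N A‖) + 1 / 2 * ‖A‖ := by
    conv_lhs => rw [hgeom]
    refine (norm_add_le _ _).trans (add_le_add ((norm_sum_le _ _).trans ?_)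
      ((hneg k A).trans hk'))
    exact Finset.sum_le_sum fun j _ => hneg j _
  rw [← Finset.sum_mul] at h4
  nlinarith [norm_nonneg (N A)]

end Norms

/-! ### Channels -/

section Channels

variable {D : Type*} [Fintype D] [DecidableEq D]

lemma matrix_eq_sum_smul_single (A : Matrix D D ℂ) :
    A = ∑ i, ∑ j, A i j • Matrix.single i j (1 : ℂ) := by
  conv_lhs => rw [Matrix.matrix_eq_sum_single A]
  simp [Matrix.smul_single]

lemma choi_apply (Φ : SuperOp D) (i r j s : D) :
    choi Φ (i, r) (j, s) = (Fintype.card D : ℂ)⁻¹ * Φ (Matrix.single r s 1) i j := by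
  have h : (Matrix.of fun i j => maxEntangled D (i, r) (j, s)) =
      (Fintype.card D : ℂ)⁻¹ • Matrix.single r s (1 : ℂ) := by
    ext a b
    simp [maxEntangled, Matrix.single_apply, eq_comm]
  change Φ (Matrix.of fun i j => maxEntangled D (i, r) (j, s)) i j = _
  rw [h, map_smul, Matrix.smul_apply, smul_eq_mul]

lemma maxEntangled_posSemidef : (maxEntangled D).PosSemidef := by
  have h : maxEntangled D = (Fintype.card D : ℂ)⁻¹ •
      Matrix.vecMulVec (fun p : D × D => if p.1 = p.2 then (1 : ℂ) else 0)
        (star fun p : D × D => if p.1 = p.2 then (1 : ℂ) else 0) := by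
    ext p q
    simp only [maxEntangled, Matrix.of_apply, Matrix.smul_apply, Matrix.vecMulVec_apply,
      Pi.star_apply, smul_eq_mul]
    by_cases h1 : p.1 = p.2 <;> by_cases h2 : q.1 = q.2 <;> simp [h1, h2]
  rw [h]
  refine (Matrix.posSemidef_vecMulVec_self_star _).smul ?_
  have h0 : (0 : ℂ) ≤ (((Fintype.card D : ℝ)⁻¹ : ℝ) : ℂ) :=
    Complex.zero_le_real.2 (by positivity)
  push_cast at h0
  exact h0

lemma IsCPTP.isState_choi [Nonempty D] {Φ : SuperOp D} (h : IsCPTP Φ) : IsState (choi Φ) := by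
  have hd : (Fintype.card D : ℂ) ≠ 0 := by exact_mod_cast Fintype.card_ne_zero
  constructor
  -- Complete positivity is stated for ancillas `Fin k`, so the ancilla `D` is enumerated.
  · let e := Fintype.equivFin D
    have h1 := (h.1 _ _ (maxEntangled_posSemidef.submatrix (Prod.map id e.symm))).submatrix
      (Prod.map id e)
    convert h1 using 1
    ext p q
    simp [choi, ampliation]
  · simp only [Matrix.trace, Matrix.diag_apply, Fintype.sum_prod_type_right, choi_apply]
    simp_rw [← Finset.mul_sum]
    have h2 : ∀ r, ∑ i, Φ (Matrix.single r r 1) i i = 1 := fun r =>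
      (h.2 _).trans (by simp)
    simp [h2, hd]

/-- The images of matrix units are `d` times blocks of the Choi matrix, which has norm at most 1,
and there are `d²` matrix units. The bound is crude but uniform over all channels. -/
lemma IsCPTP.norm_apply_le [Nonempty D] {Φ : SuperOp D} (h : IsCPTP Φ) (A : Matrix D D ℂ) :
    ‖Φ A‖ ≤ Fintype.card D ^ 3 * ‖A‖ := by
  have hd : (Fintype.card D : ℝ) ≠ 0 := by exact_mod_cast Fintype.card_ne_zero
  have h1 : ∀ r s, ‖Φ (Matrix.single r s 1)‖ ≤ Fintype.card D := by
    intro r s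
    have h2 : Φ (Matrix.single r s 1) =
        (Fintype.card D : ℂ) • (choi Φ).submatrix (fun i => (i, r)) (fun j => (j, s)) := by
      ext i j
      have hd' : (Fintype.card D : ℂ) ≠ 0 := by exact_mod_cast Fintype.card_ne_zero
      simp [choi_apply, hd']
    have h3 : ‖(choi Φ).submatrix (fun i => (i, r)) (fun j => (j, s))‖ ≤ ‖choi Φ‖ := by
      refine le_of_sq_le_sq ?_ (norm_nonneg _)
      rw [← ampliation_id D (choi Φ), ampliation_norm_sq]
      exact (Finset.single_le_sum (f := fun s => ‖(LinearMap.id : SuperOp D)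
        (Matrix.of fun i j => choi Φ (i, r) (j, s))‖ ^ 2) (fun _ _ => sq_nonneg _)
        (Finset.mem_univ s)).trans (Finset.single_le_sum (f := fun r => ∑ s,
          ‖(LinearMap.id : SuperOp D) (Matrix.of fun i j => choi Φ (i, r) (j, s))‖ ^ 2)
          (fun _ _ => Finset.sum_nonneg fun _ _ => sq_nonneg _) (Finset.mem_univ r))
    rw [h2, norm_smul, Complex.norm_natCast]
    have := h3.trans h.isState_choi.norm_le_one
    calc _ ≤ (Fintype.card D : ℝ) * 1 := by gcongr
      _ = _ := mul_one _
  conv_lhs => rw [matrix_eq_sum_smul_single A]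
  simp only [map_sum, map_smul]
  calc _ ≤ ∑ i, ∑ j, ‖A i j • Φ (Matrix.single i j 1)‖ :=
        (norm_sum_le _ _).trans (Finset.sum_le_sum fun i _ => norm_sum_le _ _)
    _ ≤ ∑ _i : D, ∑ _j : D, ‖A‖ * Fintype.card D := by
        refine Finset.sum_le_sum fun i _ => Finset.sum_le_sum fun j _ => ?_
        rw [norm_smul]
        gcongr
        · exact norm_entry_le A i j
        · exact h1 i j
    _ = _ := by
        simp only [Finset.sum_const, Finset.card_univ, nsmul_eq_mul]
        ring

/-- The matrix representing the functional `A ↦ Tr (M N(A))`. -/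
def effectiveEffect (N : SuperOp D) (M : Matrix D D ℂ) : Matrix D D ℂ :=
  Matrix.of fun j i => (M * N (Matrix.single i j 1)).trace

lemma trace_effectiveEffect_mul (N : SuperOp D) (M A : Matrix D D ℂ) :
    (effectiveEffect N M * A).trace = (M * N A).trace := by
  have h : (effectiveEffect N M * A).trace = ∑ j, ∑ i, effectiveEffect N M j i * A i j := by
    simp only [Matrix.trace, Matrix.diag_apply, Matrix.mul_apply]
  rw [h, Finset.sum_comm]
  conv_rhs => rw [matrix_eq_sum_smul_single A]
  simp only [map_sum, map_smul, Matrix.mul_sum, Matrix.trace_sum, Matrix.mul_smul,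
    Matrix.trace_smul, smul_eq_mul]
  exact Finset.sum_congr rfl fun i _ => Finset.sum_congr rfl fun j _ => mul_comm _ _

end Channels

/-! ### Averages over a Clifford design -/

section Design

variable {n m : ℕ}

/-- The family `C` of Clifford gates is a unitary two-design. -/
def IsDesign (C : Fin m → CliffordGate n) : Prop :=
  ∀ X A B : Matrix (Bits n) (Bits n) ℂ,
    ∑ i, (X * ((C i).1 * A * (C i).1ᴴ)).trace • ((C i).1 * B * (C i).1ᴴ) =
      (m : ℂ) • (((A * B).trace - A.trace * B.trace / 2 ^ n) / (4 ^ n - 1)) •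
        (X - (X.trace / 2 ^ n) • (1 : Matrix (Bits n) (Bits n) ℂ)) +
      (m : ℂ) • (X.trace * A.trace * B.trace / 4 ^ n) • (1 : Matrix (Bits n) (Bits n) ℂ)

/-- The adjoint Clifford gate. -/
def CliffordGate.adjoint (C : CliffordGate n) : CliffordGate n := ⟨C.1ᴴ, C.2.conjTranspose⟩

lemma four_pow_eq : (4 : ℂ) ^ n = 2 ^ n * 2 ^ n := by rw [← mul_pow]; norm_num

lemma trace_one_bits : (1 : Matrix (Bits n) (Bits n) ℂ).trace = 2 ^ n := by simp

lemma basisProj_trace (b : Bits n) : (basisProj b).trace = 1 := by simp [basisProj]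

lemma basisProj_isState (b : Bits n) : IsState (basisProj b) := by
  refine ⟨?_, basisProj_trace b⟩
  have h : basisProj b = Matrix.vecMulVec (Pi.single b (1 : ℂ)) (star (Pi.single b (1 : ℂ))) := by
    ext i j
    simp only [basisProj, Matrix.single_apply, Matrix.vecMulVec_apply, Pi.star_apply,
      Pi.single_apply, eq_comm]
    by_cases h1 : b = i <;> by_cases h2 : b = j <;> simp [h1, h2]
  rw [h]
  exact Matrix.posSemidef_vecMulVec_self_star _

lemma trace_mul_basisProj (A : Matrix (Bits n) (Bits n) ℂ) (b : Bits n) :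
    (A * basisProj b).trace = A b b := by
  rw [Matrix.trace_mul_comm, basisProj]
  simp [Matrix.trace_single_mul]

lemma trace_mul_conj_comm (C A B : Matrix (Bits n) (Bits n) ℂ) :
    (A * (Cᴴ * B * C)).trace = (B * (C * A * Cᴴ)).trace := by
  calc (A * (Cᴴ * B * C)).trace = (A * Cᴴ * B * C).trace := by simp only [Matrix.mul_assoc]
    _ = (C * A * Cᴴ * B).trace := by
        rw [Matrix.trace_mul_comm]; simp only [Matrix.mul_assoc]
    _ = _ := Matrix.trace_mul_comm _ _

variable {C : Fin m → CliffordGate n}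

/-- A design averages every matrix to a multiple of the identity. -/
lemma IsDesign.sum_conj (hC : IsDesign C) (B : Matrix (Bits n) (Bits n) ℂ) :
    ∑ i, (C i).1 * B * (C i).1ᴴ =
      (m : ℂ) • (B.trace / 2 ^ n) • (1 : Matrix (Bits n) (Bits n) ℂ) := by
  have h2 : (2 : ℂ) ^ n ≠ 0 := pow_ne_zero n two_ne_zero
  have h := hC 1 1 B
  have h1 : ∀ i, (1 * ((C i).1 * 1 * (C i).1ᴴ)).trace = (2 : ℂ) ^ n := fun i => by
    rw [Matrix.one_mul, Matrix.mul_one, (C i).2.mul_conjTranspose_self, trace_one_bits]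
  simp only [h1, ← Finset.smul_sum] at h
  simp only [Matrix.one_mul, trace_one_bits, div_self h2, one_smul, sub_self,
    smul_zero, zero_add] at h
  have h3 := congrArg (fun M => ((2 : ℂ) ^ n)⁻¹ • M) h
  simp only [smul_smul, inv_mul_cancel₀ h2, one_smul] at h3
  rw [h3, smul_smul, four_pow_eq]
  congr 1
  field_simp

/-- State tomography with a design and a measurement with effects `E b`. -/
lemma IsDesign.tomography (hC : IsDesign C) {E : Bits n → Matrix (Bits n) (Bits n) ℂ}
    (hE : ∑ b, (E b).trace = 2 ^ n) (σ : Matrix (Bits n) (Bits n) ℂ) :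
    ∑ i, ∑ b, (E b * ((C i).1ᴴ * σ * (C i).1)).trace • ((C i).1 * basisProj b * (C i).1ᴴ) =
      (m : ℂ) • (((∑ b, (E b * basisProj b).trace - 1) / (4 ^ n - 1)) •
        (σ - (σ.trace / 2 ^ n) • (1 : Matrix (Bits n) (Bits n) ℂ)) +
        (σ.trace / 2 ^ n) • (1 : Matrix (Bits n) (Bits n) ℂ)) := by
  have h2 : (2 : ℂ) ^ n ≠ 0 := pow_ne_zero n two_ne_zero
  rw [Finset.sum_comm]
  simp only [trace_mul_conj_comm]
  -- For each outcome the two-design formula is applied with the state in the role of `X`. After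
  -- summing over outcomes, the effects enter only through `∑ Tr E_b = d` and the diagonal sum in
  -- the statement.
  rw [Finset.sum_congr rfl fun b _ => hC σ (E b) (basisProj b)]
  simp only [basisProj_trace, mul_one]
  rw [Finset.sum_add_distrib, ← Finset.smul_sum, ← Finset.smul_sum, ← Finset.sum_smul,
    ← Finset.sum_smul, ← Finset.sum_div, ← Finset.sum_div, Finset.sum_sub_distrib,
    ← Finset.sum_div, ← Finset.mul_sum, hE, div_self h2, smul_add, four_pow_eq,
    mul_div_mul_right _ _ h2]

/-- Calibration of the preparation of a state and a measurement with effects `E b`. -/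
lemma IsDesign.calibration (hC : IsDesign C) {E : Bits n → Matrix (Bits n) (Bits n) ℂ}
    (hE : ∑ b, (E b).trace = 2 ^ n) {ρ : Matrix (Bits n) (Bits n) ℂ} (hρ : ρ.trace = 1) :
    ∑ i, ∑ b, (E b * ((C i).1 * ρ * (C i).1ᴴ)).trace *
        (basisProj b * ((C i).1 * basisProj 0 * (C i).1ᴴ)).trace =
      m * ((ρ 0 0 - 1 / 2 ^ n) * ((∑ b, (E b * basisProj b).trace - 1) / (4 ^ n - 1)) +
        1 / 2 ^ n) := by
  have h2 : (2 : ℂ) ^ n ≠ 0 := pow_ne_zero n two_ne_zero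
  have h1 : ∀ b, ∑ i, (E b * ((C i).1 * ρ * (C i).1ᴴ)).trace *
      (basisProj b * ((C i).1 * basisProj 0 * (C i).1ᴴ)).trace =
      m * ((ρ 0 0 - 1 / 2 ^ n) / (4 ^ n - 1) *
        ((E b * basisProj b).trace - (E b).trace / 2 ^ n) + (E b).trace / 4 ^ n) := by
    intro b
    have h := congrArg (fun M => (basisProj b * M).trace) (hC (E b) ρ (basisProj 0))
    simp only [Matrix.mul_sum, Matrix.mul_smul, Matrix.trace_sum, Matrix.trace_smul, smul_eq_mul,
      Matrix.mul_add, Matrix.mul_sub, Matrix.trace_add, Matrix.trace_sub, Matrix.mul_one,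
      basisProj_trace, hρ, trace_mul_basisProj ρ] at h
    rw [h, Matrix.trace_mul_comm (basisProj b)]
    ring
  rw [Finset.sum_comm, Finset.sum_congr rfl fun b _ => h1 b, ← Finset.mul_sum,
    Finset.sum_add_distrib, ← Finset.mul_sum, Finset.sum_sub_distrib, ← Finset.sum_div,
    ← Finset.sum_div, hE, div_self h2, four_pow_eq]
  field_simp

/-- The orbit of a state under a design, weighted by the ideal orbit. -/
lemma IsDesign.sum_prep (hC : IsDesign C) {ρ : Matrix (Bits n) (Bits n) ℂ} (hρ : ρ.trace = 1)
    (Y : Matrix (Bits n) (Bits n) ℂ) :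
    ∑ i, (Y * ((C i).1 * basisProj 0 * (C i).1ᴴ)).trace • ((C i).1 * ρ * (C i).1ᴴ) =
      (m : ℂ) • (((ρ 0 0 - 1 / 2 ^ n) / (4 ^ n - 1)) •
        (Y - (Y.trace / 2 ^ n) • (1 : Matrix (Bits n) (Bits n) ℂ)) +
        (Y.trace / 4 ^ n) • (1 : Matrix (Bits n) (Bits n) ℂ)) := by
  rw [hC, Matrix.trace_mul_comm (basisProj 0), trace_mul_basisProj, basisProj_trace, hρ, smul_add]
  simp only [mul_one]

/-- The coefficients of `Y` with respect to the orbit of a state with fidelity `f`. -/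
def prepCoeff (C : Fin m → CliffordGate n) (f : ℝ) (Y : Matrix (Bits n) (Bits n) ℂ) (i : Fin m) :
    ℂ :=
  ((m : ℂ) * ((f - 1 / 2 ^ n) / (4 ^ n - 1)))⁻¹ *
    ((Y * ((C i).1 * basisProj 0 * (C i).1ᴴ)).trace -
      Y.trace * (1 / 2 ^ n - (f - 1 / 2 ^ n) / (4 ^ n - 1)))

end Design

/-! ### Numerical bounds on the weight of the prepared orbit -/

section RealBounds

lemma two_le_two_pow {n : ℕ} (hn : 1 ≤ n) : (2 : ℝ) ≤ 2 ^ n := by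
  simpa using pow_le_pow_right₀ (one_le_two : (1 : ℝ) ≤ 2) hn

lemma four_pow_eq_real (n : ℕ) : (4 : ℝ) ^ n = 2 ^ n * 2 ^ n := by rw [← mul_pow]; norm_num

lemma four_pow_sub_one_pos {n : ℕ} (hn : 1 ≤ n) : (0 : ℝ) < 4 ^ n - 1 := by
  rw [four_pow_eq_real]; nlinarith [two_le_two_pow hn]

lemma fidelity_sub_ge {n : ℕ} (hn : 1 ≤ n) {f : ℝ} (hf : 9 / 10 ≤ f) :
    2 / 5 ≤ f - 1 / 2 ^ n := by
  have : (1 : ℝ) / 2 ^ n ≤ 1 / 2 := one_div_le_one_div_of_le (by norm_num) (two_le_two_pow hn)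
  linarith

lemma prepWeight_ge {n : ℕ} (hn : 1 ≤ n) {f : ℝ} (hf : 9 / 10 ≤ f) :
    2 / 5 / (2 ^ n * 2 ^ n) ≤ (f - 1 / 2 ^ n) / (4 ^ n - 1) := by
  have h := fidelity_sub_ge hn hf
  have h4 := four_pow_sub_one_pos hn
  have : (4 : ℝ) ^ n - 1 ≤ 2 ^ n * 2 ^ n := by rw [four_pow_eq_real]; linarith
  gcongr

lemma prepWeight_le {n : ℕ} (hn : 1 ≤ n) {f : ℝ} (hf : f ≤ 1) :
    (f - 1 / 2 ^ n) / (4 ^ n - 1) ≤ 1 := by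
  rw [div_le_one (four_pow_sub_one_pos hn), four_pow_eq_real]
  have : (0 : ℝ) < 1 / 2 ^ n := by positivity
  nlinarith [two_le_two_pow hn]

end RealBounds

/-! ### Expansion of matrices in the orbit of the noisy zero state -/

section Design

variable {n m : ℕ} {C : Fin m → CliffordGate n}

lemma prepWeight_coe (n : ℕ) (f : ℝ) :
    (((f : ℂ) - 1 / 2 ^ n) / (4 ^ n - 1)) = (((f - 1 / 2 ^ n) / (4 ^ n - 1) : ℝ) : ℂ) := by
  push_cast; rfl

/-- This inverts `IsDesign.sum_prep`: dividing by the weight restores the traceless part, and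
subtracting a multiple of the uniform orbit average, itself a multiple of 1, corrects the trace
part. The coefficients depend on `ρ` only through `f`, so the same ones serve for two models with
equal fidelity. -/
lemma IsDesign.sum_prepCoeff (hn : 1 ≤ n) (hm : 0 < m) (hC : IsDesign C)
    {ρ : Matrix (Bits n) (Bits n) ℂ} (hρ : ρ.trace = 1) {f : ℝ} (hf : 9 / 10 ≤ f)
    (hρf : ρ 0 0 = f) (Y : Matrix (Bits n) (Bits n) ℂ) :
    ∑ i, prepCoeff C f Y i • ((C i).1 * ρ * (C i).1ᴴ) = Y := by
  have h2 : (2 : ℂ) ^ n ≠ 0 := pow_ne_zero n two_ne_zero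
  have hm' : (m : ℂ) ≠ 0 := by exact_mod_cast hm.ne'
  have hβ0 : ((f : ℂ) - 1 / 2 ^ n) / (4 ^ n - 1) ≠ 0 := by
    rw [prepWeight_coe]
    have := prepWeight_ge hn hf
    have h3 : (0 : ℝ) < 2 / 5 / (2 ^ n * 2 ^ n) := by positivity
    exact_mod_cast (h3.trans_le this).ne'
  have h := hC.sum_prep hρ Y
  rw [hρf] at h
  simp only [prepCoeff]
  set β := ((f : ℂ) - 1 / 2 ^ n) / (4 ^ n - 1)
  obtain ⟨γ, hγ⟩ : ∃ γ, γ = 1 / 2 ^ n - β := ⟨_, rfl⟩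
  simp only [← hγ, mul_smul, sub_smul]
  rw [← Finset.smul_sum, Finset.sum_sub_distrib, h, ← Finset.smul_sum, ← Finset.smul_sum,
    hC.sum_conj, hρ, four_pow_eq, hγ]
  ext i j
  simp only [Matrix.smul_apply, Matrix.sub_apply, Matrix.add_apply, smul_eq_mul]
  field_simp
  ring

lemma norm_one_bits_le : ‖(1 : Matrix (Bits n) (Bits n) ℂ)‖ ≤ 2 ^ n := by
  refine le_of_sq_le_sq ?_ (by positivity)
  rw [norm_one_sq]
  have : (1 : ℝ) ≤ 2 ^ n := one_le_pow₀ one_le_two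
  simp only [Fintype.card_pi, Fintype.card_fin, Finset.prod_const, Finset.card_univ]
  push_cast
  nlinarith

lemma norm_conj_basisProj_le (C : CliffordGate n) (b : Bits n) :
    ‖C.1 * basisProj b * C.1ᴴ‖ ≤ 1 := by
  rw [norm_conj C.2.conjTranspose_mul_self]
  exact (basisProj_isState b).norm_le_one

lemma norm_prepCoeff_le (hn : 1 ≤ n) (hm : 0 < m) {f : ℝ} (hf : 9 / 10 ≤ f) (hf1 : f ≤ 1)
    (Y : Matrix (Bits n) (Bits n) ℂ) (i : Fin m) :
    ‖prepCoeff C f Y i‖ ≤ (m : ℝ)⁻¹ * (5 * (2 ^ n) ^ 3 * ‖Y‖) := by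
  have hd := two_le_two_pow hn
  have h1 := prepWeight_ge hn hf
  have h2 := prepWeight_le hn hf1
  have hm' : (0 : ℝ) < m := by exact_mod_cast hm
  rw [prepCoeff, prepWeight_coe]
  -- The inverse of β is at most `5/2 d²`, and the bracket is at most `(1 + d) ‖Y‖ ≤ 2 d ‖Y‖`;
  -- together they give the factor `5 d³`.
  set β : ℝ := (f - 1 / 2 ^ n) / (4 ^ n - 1)
  have hβ : 0 < β := lt_of_lt_of_le (by positivity) h1
  have h3 : ‖((m : ℂ) * (β : ℂ))⁻¹‖ ≤ (m : ℝ)⁻¹ * (5 / 2 * (2 ^ n) ^ 2) := by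
    rw [norm_inv, norm_mul, Complex.norm_natCast, Complex.norm_real, Real.norm_of_nonneg hβ.le,
      mul_inv]
    gcongr
    rw [inv_le_comm₀ hβ (by positivity)]
    refine le_trans (le_of_eq ?_) h1
    field_simp
  have h4 : ‖(Y * ((C i).1 * basisProj 0 * (C i).1ᴴ)).trace‖ ≤ ‖Y‖ :=
    (norm_trace_mul_le _ _).trans (mul_le_of_le_one_right (norm_nonneg _)
      (norm_conj_basisProj_le _ _))
  have h5 : ‖Y.trace‖ ≤ ‖Y‖ * 2 ^ n := by
    have := norm_trace_mul_le Y 1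
    rw [Matrix.mul_one] at this
    exact this.trans (by gcongr; exact norm_one_bits_le)
  have h6 : ‖(1 / 2 ^ n - (β : ℂ))‖ ≤ 1 := by
    have e : (1 / 2 ^ n - (β : ℂ)) = ((1 / 2 ^ n - β : ℝ) : ℂ) := by push_cast; rfl
    rw [e, Complex.norm_real, Real.norm_eq_abs, abs_le]
    have : (1 : ℝ) / 2 ^ n ≤ 1 := (div_le_one (by positivity)).2 (by linarith)
    have : (0 : ℝ) < 1 / 2 ^ n := by positivity
    constructor <;> linarith
  rw [norm_mul]
  calc _ ≤ ((m : ℝ)⁻¹ * (5 / 2 * (2 ^ n) ^ 2)) * (‖Y‖ + ‖Y‖ * 2 ^ n * 1) := by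
        gcongr
        refine (norm_sub_le _ _).trans (add_le_add h4 ?_)
        rw [norm_mul]
        gcongr
    _ ≤ ((m : ℝ)⁻¹ * (5 / 2 * (2 ^ n) ^ 2)) * (2 * 2 ^ n * ‖Y‖) := by
        gcongr
        nlinarith [norm_nonneg Y]
    _ = _ := by ring

/-- Linear maps which nearly agree on the orbits of two states of the same fidelity are close. -/
lemma IsDesign.norm_sub_le_of_orbit (hn : 1 ≤ n) (hm : 0 < m) (hC : IsDesign C)
    {V : Type*} [NormedAddCommGroup V] [NormedSpace ℂ V]
    (L L' : Matrix (Bits n) (Bits n) ℂ →ₗ[ℂ] V) {ρ ρ' : Matrix (Bits n) (Bits n) ℂ}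
    (hρ : ρ.trace = 1) (hρ' : ρ'.trace = 1) {f : ℝ} (hf : 9 / 10 ≤ f) (hf1 : f ≤ 1)
    (hρf : ρ 0 0 = f) (hρf' : ρ' 0 0 = f) {κ : ℝ}
    (h : ∀ i, ‖L ((C i).1 * ρ * (C i).1ᴴ) - L' ((C i).1 * ρ' * (C i).1ᴴ)‖ ≤ κ)
    (Y : Matrix (Bits n) (Bits n) ℂ) : ‖L Y - L' Y‖ ≤ 5 * (2 ^ n) ^ 3 * κ * ‖Y‖ := by
  have hm' : (m : ℝ) ≠ 0 := by exact_mod_cast hm.ne'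
  have e1 := congrArg L (hC.sum_prepCoeff hn hm hρ hf hρf Y)
  have e2 := congrArg L' (hC.sum_prepCoeff hn hm hρ' hf hρf' Y)
  rw [← e1, ← e2]
  simp only [map_sum, map_smul]
  rw [← Finset.sum_sub_distrib]
  simp only [← smul_sub]
  calc _ ≤ ∑ i, ‖prepCoeff C f Y i • (L ((C i).1 * ρ * (C i).1ᴴ) -
        L' ((C i).1 * ρ' * (C i).1ᴴ))‖ := norm_sum_le _ _
    _ ≤ ∑ _i : Fin m, (m : ℝ)⁻¹ * (5 * (2 ^ n) ^ 3 * ‖Y‖) * κ := by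
        refine Finset.sum_le_sum fun i _ => ?_
        rw [norm_smul]
        exact mul_le_mul (norm_prepCoeff_le hn hm hf hf1 Y i) (h i) (norm_nonneg _) (by positivity)
    _ = _ := by
        rw [Finset.sum_const, Finset.card_univ, Fintype.card_fin, nsmul_eq_mul]
        field_simp

end Design

/-! ### Gate-independent noise -/

namespace CliffordLabels

variable {n : ℕ} {X : Type u} {Y : Type v} {Z : Type w} {B : Z → Type t} [∀ z, Fintype (B z)]
  {ℓ : CliffordLabels n X Y Z B} {W : WorldModel (Bits n) X Y Z B} {N : SuperOp (Bits n)}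

variable (ℓ W N) in
/-- The effect of the noise followed by the outcome `b` of the noisy measurement. -/
def effect (b : Bits n) : Matrix (Bits n) (Bits n) ℂ :=
  effectiveEffect N (W.povm ℓ.comp (ℓ.outcome b))

variable (ℓ W N) in
/-- The factor by which the noisy measurement contracts traceless matrices. -/
def visibility : ℝ :=
  (∑ b, (W.povm ℓ.comp (ℓ.outcome b) * N (basisProj b)).trace.re - 1) / (4 ^ n - 1)

lemma sum_effect_trace (hN : IsCPTP N) : ∑ b, (ℓ.effect W N b).trace = 2 ^ n := by
  have h : ∀ b, (ℓ.effect W N b).trace = (W.povm ℓ.comp (ℓ.outcome b) * N 1).trace := fun b => by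
    rw [← trace_effectiveEffect_mul, Matrix.mul_one]; rfl
  simp only [h]
  rw [← Matrix.trace_sum, ← Finset.sum_mul,
    Equiv.sum_comp ℓ.outcome (fun b => W.povm ℓ.comp b), (W.isPOVM ℓ.comp).2,
    Matrix.one_mul, hN.2, trace_one_bits]

lemma visibility_coe (hN : IsCPTP N) :
    (∑ b, (ℓ.effect W N b * basisProj b).trace - 1) / (4 ^ n - 1) = (ℓ.visibility W N : ℂ) := by
  rw [visibility]
  push_cast
  congr 2
  refine Finset.sum_congr rfl fun b _ => ?_
  rw [effect, trace_effectiveEffect_mul]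
  exact Complex.eq_re_of_ofReal_le (r := 0) (by
    simpa using trace_mul_nonneg ((W.isPOVM ℓ.comp).1 _)
      (hN.posSemidef (basisProj_isState b).1))

/-- For `d ≥ 2` one has `0.9 d - 1 ≥ 0.4 d`, and the denominator is less than `d²`. -/
lemma visibility_ge (hn : 1 ≤ n) (h : ℓ.BoundedNoise (1 / 10) W N) :
    2 / 5 / 2 ^ n ≤ ℓ.visibility W N := by
  have hd := two_le_two_pow hn
  have h1 : 9 / 10 * (2 : ℝ) ^ n ≤
      ∑ b, (W.povm ℓ.comp (ℓ.outcome b) * N (basisProj b)).trace.re := by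
    calc 9 / 10 * (2 : ℝ) ^ n = ∑ _b : Bits n, (9 / 10 : ℝ) := by
          simp [mul_comm]
      _ ≤ _ := Finset.sum_le_sum fun b _ => by linarith [h.2 b]
  rw [visibility, div_le_div_iff₀ (by positivity) (four_pow_sub_one_pos hn), four_pow_eq_real]
  nlinarith

lemma fidelity_coe : W.state ℓ.zero 0 0 = ℓ.fidelity W :=
  Complex.eq_re_of_ofReal_le (r := 0) (by
    simpa using (W.isState ℓ.zero).1.diag_nonneg)

lemma fidelity_le_one : ℓ.fidelity W ≤ 1 :=
  (Complex.re_le_norm _).trans ((norm_entry_le _ 0 0).trans (W.isState ℓ.zero).norm_le_one)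

/-- The noise of the last gate is moved into the measurement, so that the gate itself acts ideally.
-/
lemma outcomeProb_gate (hN : ℓ.GateIndependentNoise W N) (x : X) (l : List Y) (C : CliffordGate n)
    (b : Bits n) :
    (W.outcomeProb ⟨x, l ++ [ℓ.gate C], ℓ.comp⟩ (ℓ.outcome b) : ℂ) =
      (ℓ.effect W N b *
        (C.1 * l.foldl (fun σ y => W.channel y σ) (W.state x) * C.1ᴴ)).trace := by
  rw [W.outcomeProb_coe, effect, trace_effectiveEffect_mul, List.foldl_append, List.foldl_cons,
    List.foldl_nil, hN.2]

/-- Calibration of the visibility by experiments with one gate. -/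
lemma GateIndependentNoise.calibration {m : ℕ} {C : Fin m → CliffordGate n}
    (hN : ℓ.GateIndependentNoise W N) (hC : IsDesign C) :
    ∑ i, ∑ b, (W.outcomeProb ⟨ℓ.zero, [ℓ.gate (C i)], ℓ.comp⟩ (ℓ.outcome b) : ℂ) *
        (basisProj b * ((C i).1 * basisProj 0 * (C i).1ᴴ)).trace =
      m * ((ℓ.fidelity W - 1 / 2 ^ n) * ℓ.visibility W N + 1 / 2 ^ n) := by
  have h := hC.calibration (sum_effect_trace (ℓ := ℓ) (W := W) hN.1) (W.isState ℓ.zero).2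
  rw [visibility_coe hN.1, fidelity_coe] at h
  rw [← h]
  refine Finset.sum_congr rfl fun i _ => Finset.sum_congr rfl fun b _ => ?_
  rw [show [ℓ.gate (C i)] = [] ++ [ℓ.gate (C i)] from rfl, outcomeProb_gate hN]
  rfl

end CliffordLabels

/-! ### Stability of the actions under perturbations of the outcome probabilities -/

/-- A map which is bounded below is injective, hence surjective in finite dimension. -/
lemma exists_preimage {n : ℕ} {N : SuperOp (Bits n)} {c : ℝ} (hc : ∀ A, ‖A‖ ≤ c * ‖N A‖)
    (A : Matrix (Bits n) (Bits n) ℂ) :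
    ∃ A', N A' = A ∧ ‖A'‖ ≤ c * ‖A‖ := by
  have hinj : Function.Injective N := by
    rw [injective_iff_map_eq_zero]
    intro A hA
    have := hc A
    rw [hA, norm_zero, mul_zero] at this
    exact norm_le_zero_iff.1 this
  obtain ⟨A', rfl⟩ := LinearMap.injective_iff_surjective.1 hinj A
  exact ⟨A', rfl, hc A'⟩

namespace CliffordLabels

section Stability

variable {n m : ℕ} {X : Type u} {Y : Type v} {Z : Type w} {B : Z → Type t} [∀ z, Fintype (B z)]
  {ℓ : CliffordLabels n X Y Z B} {W W' : WorldModel (Bits n) X Y Z B} {N N' : SuperOp (Bits n)}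
  {C : Fin m → CliffordGate n} {τ : ℝ}

/-- The outcome probabilities of two world models in the experiments which prepare the zero
state and apply one gate of the design `C` differ by at most `τ`. -/
def OneGateClose (ℓ : CliffordLabels n X Y Z B) (C : Fin m → CliffordGate n) (τ : ℝ)
    (W W' : WorldModel (Bits n) X Y Z B) : Prop :=
  ∀ i b, |W.outcomeProb ⟨ℓ.zero, [ℓ.gate (C i)], ℓ.comp⟩ (ℓ.outcome b) -
    W'.outcomeProb ⟨ℓ.zero, [ℓ.gate (C i)], ℓ.comp⟩ (ℓ.outcome b)| ≤ τ

/-- The outcome probabilities of two world models, when the action sequence `x, l` is followed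
by an adjoint gate of the design `C` and the noisy measurement, differ by at most `τ`. -/
def TomographyClose (ℓ : CliffordLabels n X Y Z B) (C : Fin m → CliffordGate n) (τ : ℝ)
    (W W' : WorldModel (Bits n) X Y Z B) (x : X) (l : List Y) : Prop :=
  ∀ i b, |W.outcomeProb ⟨x, l ++ [ℓ.gate (C i).adjoint], ℓ.comp⟩ (ℓ.outcome b) -
    W'.outcomeProb ⟨x, l ++ [ℓ.gate (C i).adjoint], ℓ.comp⟩ (ℓ.outcome b)| ≤ τ

lemma norm_sum_sum_le {V : Type*} [SeminormedAddCommGroup V] (F : Fin m → Bits n → V)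
    (h : ∀ i b, ‖F i b‖ ≤ τ) : ‖∑ i, ∑ b, F i b‖ ≤ m * (2 ^ n * τ) := by
  calc _ ≤ ∑ i, ∑ b, ‖F i b‖ :=
        (norm_sum_le _ _).trans (Finset.sum_le_sum fun i _ => norm_sum_le _ _)
    _ ≤ ∑ _i : Fin m, ∑ _b : Bits n, τ :=
        Finset.sum_le_sum fun i _ => Finset.sum_le_sum fun b _ => h i b
    _ = _ := by simp

/-- One-gate data determine the product of the visibility with `f - 1/d`. The second factor is
common to both models and at least 2/5, whence the factor 5/2. -/
lemma abs_visibility_sub_le (hn : 1 ≤ n) (hm : 0 < m) (hC : IsDesign C)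
    (hN : ℓ.GateIndependentNoise W N) (hN' : ℓ.GateIndependentNoise W' N')
    (hf : 9 / 10 ≤ ℓ.fidelity W) (hff : ℓ.fidelity W = ℓ.fidelity W')
    (h1 : ℓ.OneGateClose C τ W W') :
    |ℓ.visibility W N - ℓ.visibility W' N'| ≤ 5 / 2 * (2 ^ n * τ) := by
  have hm' : (0 : ℝ) < m := by exact_mod_cast hm
  have e1 := hN.calibration hC
  have e2 := hN'.calibration hC
  rw [← hff] at e2
  have e3 : ∑ i, ∑ b, (((W.outcomeProb ⟨ℓ.zero, [ℓ.gate (C i)], ℓ.comp⟩ (ℓ.outcome b) -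
      W'.outcomeProb ⟨ℓ.zero, [ℓ.gate (C i)], ℓ.comp⟩ (ℓ.outcome b) : ℝ) : ℂ) *
        (basisProj b * ((C i).1 * basisProj 0 * (C i).1ᴴ)).trace) =
      ((m * ((ℓ.fidelity W - 1 / 2 ^ n) * (ℓ.visibility W N - ℓ.visibility W' N')) : ℝ) : ℂ) := by
    push_cast
    simp only [sub_mul, Finset.sum_sub_distrib, e1, e2]
    ring
  have h2 := norm_sum_sum_le (τ := τ) (fun i b =>
      (((W.outcomeProb ⟨ℓ.zero, [ℓ.gate (C i)], ℓ.comp⟩ (ℓ.outcome b) -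
      W'.outcomeProb ⟨ℓ.zero, [ℓ.gate (C i)], ℓ.comp⟩ (ℓ.outcome b) : ℝ) : ℂ) *
        (basisProj b * ((C i).1 * basisProj 0 * (C i).1ᴴ)).trace)) (fun i b => by
    rw [norm_mul, Complex.norm_real, Real.norm_eq_abs]
    have h3 : ‖(basisProj b * ((C i).1 * basisProj 0 * (C i).1ᴴ)).trace‖ ≤ 1 :=
      (norm_trace_mul_le _ _).trans (mul_le_one₀ (basisProj_isState b).norm_le_one
        (norm_nonneg _) (norm_conj_basisProj_le _ _))
    exact (mul_le_of_le_one_right (abs_nonneg _) h3).trans (h1 i b))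
  rw [e3, Complex.norm_real, Real.norm_eq_abs, abs_mul, abs_mul, abs_of_pos hm'] at h2
  have h4 := le_of_mul_le_mul_left h2 hm'
  have hf' := fidelity_sub_ge hn hf
  rw [abs_of_nonneg (by linarith : 0 ≤ ℓ.fidelity W - 1 / 2 ^ n)] at h4
  nlinarith [abs_nonneg (ℓ.visibility W N - ℓ.visibility W' N')]

/-- Tomography yields the traceless part of the state times the visibility, and calibration controls
the visibility. The data error `d τ` and the calibration error `5 d τ`, divided by the least
visibility `2 / (5 d)`, give `15 d² τ`. -/
lemma norm_foldl_sub_le (hn : 1 ≤ n) (hm : 0 < m) (hC : IsDesign C)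
    (hN : ℓ.GateIndependentNoise W N) (hN' : ℓ.GateIndependentNoise W' N')
    (hb : ℓ.BoundedNoise (1 / 10) W N) (hff : ℓ.fidelity W = ℓ.fidelity W')
    (h1 : ℓ.OneGateClose C τ W W') {x : X} {l : List Y}
    (h2 : ℓ.TomographyClose C τ W W' x l) :
    ‖l.foldl (fun σ y => W.channel y σ) (W.state x) -
      l.foldl (fun σ y => W'.channel y σ) (W'.state x)‖ ≤ 15 * (2 ^ n) ^ 2 * τ := by
  have hm' : (0 : ℝ) < m := by exact_mod_cast hm
  have hd := two_le_two_pow hn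
  have hs := W.isState_foldl l (W.isState x)
  have hs' := W'.isState_foldl l (W'.isState x)
  have hα := visibility_ge hn hb
  have hαα := abs_visibility_sub_le hn hm hC hN hN' (by linarith [hb.1]) hff h1
  have e1 := hC.tomography (sum_effect_trace (ℓ := ℓ) (W := W) hN.1)
    (l.foldl (fun σ y => W.channel y σ) (W.state x))
  have e2 := hC.tomography (sum_effect_trace (ℓ := ℓ) (W := W') hN'.1)
    (l.foldl (fun σ y => W'.channel y σ) (W'.state x))
  have h2' : ∀ i b, ‖(ℓ.effect W N b * ((C i).1ᴴ *
        l.foldl (fun σ y => W.channel y σ) (W.state x) * (C i).1)).trace -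
      (ℓ.effect W' N' b * ((C i).1ᴴ *
        l.foldl (fun σ y => W'.channel y σ) (W'.state x) * (C i).1)).trace‖ ≤ τ := by
    intro i b
    have a1 := outcomeProb_gate hN x l (C i).adjoint b
    have a2 := outcomeProb_gate hN' x l (C i).adjoint b
    simp only [CliffordGate.adjoint, Matrix.conjTranspose_conjTranspose] at a1 a2
    rw [← a1, ← a2, ← Complex.ofReal_sub, Complex.norm_real]
    exact h2 i b
  rw [visibility_coe hN.1] at e1
  rw [visibility_coe hN'.1] at e2
  set σ := l.foldl (fun σ y => W.channel y σ) (W.state x)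
  set σ' := l.foldl (fun σ y => W'.channel y σ) (W'.state x)
  set α := ℓ.visibility W N
  set α' := ℓ.visibility W' N'
  rw [hs.2] at e1
  rw [hs'.2] at e2
  have h3 := norm_sum_sum_le (τ := τ) (fun i b =>
    ((ℓ.effect W N b * ((C i).1ᴴ * σ * (C i).1)).trace -
      (ℓ.effect W' N' b * ((C i).1ᴴ * σ' * (C i).1)).trace) •
        ((C i).1 * basisProj b * (C i).1ᴴ)) (fun i b => by
    rw [norm_smul]
    exact (mul_le_of_le_one_right (norm_nonneg _) (norm_conj_basisProj_le _ _)).trans (h2' i b))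
  set J : Matrix (Bits n) (Bits n) ℂ := ((1 : ℂ) / 2 ^ n) • 1
  have e3 : ∑ i, ∑ b, ((ℓ.effect W N b * ((C i).1ᴴ * σ * (C i).1)).trace -
      (ℓ.effect W' N' b * ((C i).1ᴴ * σ' * (C i).1)).trace) •
        ((C i).1 * basisProj b * (C i).1ᴴ) =
      (m : ℂ) • ((α : ℂ) • (σ - σ') + ((α - α' : ℝ) : ℂ) • (σ' - J)) := by
    simp only [sub_smul, Finset.sum_sub_distrib, e1, e2, ← smul_sub]
    congr 1
    push_cast
    module
  rw [e3, norm_smul, Complex.norm_natCast] at h3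
  have h4 := le_of_mul_le_mul_left h3 hm'
  have hJ : ‖J‖ ≤ 1 := by
    rw [norm_smul, norm_div, norm_one, norm_pow, Complex.norm_ofNat, one_div,
      inv_mul_le_iff₀ (by positivity), mul_one]
    exact norm_one_bits_le
  have h5 : ‖σ' - J‖ ≤ 2 := (norm_sub_le _ _).trans (by linarith [hs'.norm_le_one])
  have h6 : ‖(α : ℂ) • (σ - σ')‖ ≤ 2 ^ n * τ + 5 / 2 * (2 ^ n * τ) * 2 := by
    have e4 : (α : ℂ) • (σ - σ') = ((α : ℂ) • (σ - σ') + ((α - α' : ℝ) : ℂ) • (σ' - J)) -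
        ((α - α' : ℝ) : ℂ) • (σ' - J) := by abel
    rw [e4]
    refine (norm_sub_le _ _).trans (add_le_add h4 ?_)
    rw [norm_smul, Complex.norm_real, Real.norm_eq_abs]
    exact mul_le_mul hαα h5 (norm_nonneg _) ((abs_nonneg _).trans hαα)
  rw [norm_smul, Complex.norm_real, Real.norm_of_nonneg (le_trans (by positivity) hα)] at h6
  have h7 := (mul_le_mul_of_nonneg_right hα (norm_nonneg (σ - σ'))).trans h6
  rw [div_mul_eq_mul_div, div_le_iff₀ (by positivity)] at h7
  nlinarith

/-- The hypotheses on two world models under which their actions are compared. -/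
structure Comparable (ℓ : CliffordLabels n X Y Z B) (C : Fin m → CliffordGate n)
    (τ : ℝ) (W W' : WorldModel (Bits n) X Y Z B) (N N' : SuperOp (Bits n)) : Prop where
  pos : 1 ≤ n
  posDesign : 0 < m
  design : IsDesign C
  noise : ℓ.GateIndependentNoise W N
  noise' : ℓ.GateIndependentNoise W' N'
  bounded : ℓ.BoundedNoise (1 / 10) W N
  fidelity_eq : ℓ.fidelity W = ℓ.fidelity W'
  oneGate : ℓ.OneGateClose C τ W W'
  twoGate : ∀ i, ℓ.TomographyClose C τ W W' ℓ.zero [ℓ.gate (C i)]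

namespace Comparable

lemma norm_sub_le_of_orbit (h : ℓ.Comparable C τ W W' N N')
    {V : Type*} [NormedAddCommGroup V] [NormedSpace ℂ V]
    (L L' : Matrix (Bits n) (Bits n) ℂ →ₗ[ℂ] V) {κ : ℝ}
    (hL : ∀ i, ‖L ((C i).1 * W.state ℓ.zero * (C i).1ᴴ) -
      L' ((C i).1 * W'.state ℓ.zero * (C i).1ᴴ)‖ ≤ κ)
    (A : Matrix (Bits n) (Bits n) ℂ) : ‖L A - L' A‖ ≤ 5 * (2 ^ n) ^ 3 * κ * ‖A‖ :=
  h.design.norm_sub_le_of_orbit h.pos h.posDesign L L' (W.isState ℓ.zero).2 (W'.isState ℓ.zero).2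
    (by linarith [h.bounded.1]) fidelity_le_one fidelity_coe
    (by rw [fidelity_coe, h.fidelity_eq]) hL A

/-- Tomography after one gate compares the noise on the orbit of the zero state, and the orbit
spans: `75 d⁵` is `5 d³` times `15 d²`. -/
lemma norm_noise_sub_le (h : ℓ.Comparable C τ W W' N N')
    (A : Matrix (Bits n) (Bits n) ℂ) :
    ‖N A - N' A‖ ≤ 75 * (2 ^ n) ^ 5 * τ * ‖A‖ := by
  refine (h.norm_sub_le_of_orbit N N' (κ := 15 * (2 ^ n) ^ 2 * τ) (fun i => ?_) A).trans
    (le_of_eq (by ring))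
  have h1 := norm_foldl_sub_le h.pos h.posDesign h.design h.noise h.noise' h.bounded h.fidelity_eq
    h.oneGate (h.twoGate i)
  simpa only [List.foldl_cons, List.foldl_nil, h.noise.2, h.noise'.2] using h1

lemma norm_state_sub_le (h : ℓ.Comparable C τ W W' N N') {x : X}
    (hx : ℓ.TomographyClose C τ W W' x []) :
    ‖W.state x - W'.state x‖ ≤ 15 * (2 ^ n) ^ 2 * τ := by
  have h1 := norm_foldl_sub_le h.pos h.posDesign h.design h.noise h.noise' h.bounded h.fidelity_eq
    h.oneGate hx
  simpa only [List.foldl_nil] using h1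

lemma nonneg (h : ℓ.Comparable C τ W W' N N') : 0 ≤ τ :=
  (abs_nonneg _).trans (h.oneGate ⟨0, h.posDesign⟩ 0)

/-- The data compare the channels only after the noise, that is, the compositions with `N` and `N'`.
Every matrix is `N A'` with `A'` bounded, and replacing `N'` by `N` under the second channel costs
its norm bound `d³` times the distance of the noises. -/
lemma norm_channel_sub_le (h : ℓ.Comparable C τ W W' N N') {c : ℝ}
    (hc : ∀ A, ‖A‖ ≤ c * ‖N A‖) {y : Y}
    (hy : ∀ i, ℓ.TomographyClose C τ W W' ℓ.zero [ℓ.gate (C i), y])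
    (A : Matrix (Bits n) (Bits n) ℂ) :
    ‖(W.channel y - W'.channel y) A‖ ≤ 150 * (2 ^ n) ^ 8 * c * τ * ‖A‖ := by
  have hτ := h.nonneg
  have hd : (1 : ℝ) ≤ 2 ^ n := one_le_pow₀ one_le_two
  obtain ⟨A', rfl, hA⟩ := exists_preimage hc A
  have h1 : ‖(W.channel y ∘ₗ N) A' - (W'.channel y ∘ₗ N') A'‖ ≤
      75 * (2 ^ n) ^ 5 * τ * ‖A'‖ := by
    refine (h.norm_sub_le_of_orbit _ _ (κ := 15 * (2 ^ n) ^ 2 * τ) (fun i => ?_) A').trans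
      (le_of_eq (by ring))
    have h1 := norm_foldl_sub_le h.pos h.posDesign h.design h.noise h.noise' h.bounded
      h.fidelity_eq h.oneGate (hy i)
    simpa only [List.foldl_cons, List.foldl_nil, h.noise.2, h.noise'.2, LinearMap.comp_apply]
      using h1
  have h2 : ‖W'.channel y (N A' - N' A')‖ ≤ (2 ^ n) ^ 3 * (75 * (2 ^ n) ^ 5 * τ * ‖A'‖) := by
    refine ((W'.isCPTP y).norm_apply_le _).trans ?_
    have : (Fintype.card (Bits n) : ℝ) = 2 ^ n := by simp
    rw [this]
    gcongr
    exact h.norm_noise_sub_le A'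
  have e : (W.channel y - W'.channel y) (N A') =
      ((W.channel y ∘ₗ N) A' - (W'.channel y ∘ₗ N') A') - W'.channel y (N A' - N' A') := by
    simp only [LinearMap.sub_apply, LinearMap.comp_apply, map_sub]
    abel
  rw [e]
  calc _ ≤ 75 * (2 ^ n) ^ 5 * τ * ‖A'‖ + (2 ^ n) ^ 3 * (75 * (2 ^ n) ^ 5 * τ * ‖A'‖) :=
        (norm_sub_le _ _).trans (add_le_add h1 h2)
    _ ≤ 75 * (2 ^ n) ^ 8 * τ * ‖A'‖ + (2 ^ n) ^ 3 * (75 * (2 ^ n) ^ 5 * τ * ‖A'‖) := by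
        gcongr
        norm_num
    _ = 150 * (2 ^ n) ^ 8 * τ * ‖A'‖ := by ring
    _ ≤ 150 * (2 ^ n) ^ 8 * τ * (c * ‖N A'‖) := by gcongr
    _ = _ := by ring

/-- Duality: with `N A = (M - M')ᴴ`, the squared norm of `M - M'` is a difference of functionals
compared on the orbit plus an error from the difference of the noises. One factor of the norm is
then cancelled. -/
lemma norm_povm_sub_le (h : ℓ.Comparable C τ W W' N N') {c : ℝ}
    (hc0 : 0 ≤ c) (hc : ∀ A, ‖A‖ ≤ c * ‖N A‖) {z : Z} {b : B z}
    (hz : ∀ i, |W.outcomeProb ⟨ℓ.zero, [ℓ.gate (C i)], z⟩ b -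
      W'.outcomeProb ⟨ℓ.zero, [ℓ.gate (C i)], z⟩ b| ≤ τ) :
    ‖W.povm z b - W'.povm z b‖ ≤ 80 * (2 ^ n) ^ 6 * c * τ := by
  have hτ := h.nonneg
  have hd : (1 : ℝ) ≤ 2 ^ n := one_le_pow₀ one_le_two
  set M := W.povm z b
  set M' := W'.povm z b with hM'
  obtain ⟨A, hA, hAn⟩ := exists_preimage hc (M - M')ᴴ
  rw [Matrix.frobenius_norm_conjTranspose] at hAn
  have h1 : ‖(M * N A).trace - (M' * N' A).trace‖ ≤ 5 * (2 ^ n) ^ 3 * τ * ‖A‖ := by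
    refine h.norm_sub_le_of_orbit
      (Matrix.traceLinearMap (Bits n) ℂ ℂ ∘ₗ LinearMap.mulLeft ℂ M ∘ₗ N)
      (Matrix.traceLinearMap (Bits n) ℂ ℂ ∘ₗ LinearMap.mulLeft ℂ M' ∘ₗ N') (fun i => ?_) A
    have a1 := W.outcomeProb_coe ⟨ℓ.zero, [ℓ.gate (C i)], z⟩ b
    have a2 := W'.outcomeProb_coe ⟨ℓ.zero, [ℓ.gate (C i)], z⟩ b
    simp only [List.foldl_cons, List.foldl_nil, h.noise.2, h.noise'.2] at a1 a2
    simp only [LinearMap.comp_apply, LinearMap.mulLeft_apply, Matrix.traceLinearMap_apply]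
    rw [← a1, ← a2, ← Complex.ofReal_sub, Complex.norm_real]
    exact hz i
  have hMn : ‖M'‖ ≤ 2 ^ n := by
    refine (posSemidef_norm_le_trace ((W'.isPOVM z).1 b)).trans ?_
    have h2 : ∑ b, (W'.povm z b).trace.re = 2 ^ n := by
      rw [← Complex.re_sum, ← Matrix.trace_sum, (W'.isPOVM z).2, trace_one_bits]
      exact_mod_cast Complex.ofReal_re ((2 : ℝ) ^ n)
    rw [← h2]
    exact Finset.single_le_sum (f := fun b => (W'.povm z b).trace.re)
      (fun b _ => (Complex.nonneg_iff.1 ((W'.isPOVM z).1 b).trace_nonneg).1) (Finset.mem_univ b)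
  have h3 : ‖(M' * (N' A - N A)).trace‖ ≤ 2 ^ n * (75 * (2 ^ n) ^ 5 * τ * ‖A‖) := by
    refine (norm_trace_mul_le _ _).trans ?_
    rw [norm_sub_rev]
    exact mul_le_mul hMn (h.norm_noise_sub_le A) (norm_nonneg _) (by positivity)
  have e : (((‖M - M'‖ ^ 2 : ℝ)) : ℂ) =
      ((M * N A).trace - (M' * N' A).trace) + (M' * (N' A - N A)).trace := by
    rw [← trace_conjTranspose_mul_self, Matrix.trace_mul_comm, ← hA, Matrix.sub_mul,
      Matrix.mul_sub, Matrix.trace_sub, Matrix.trace_sub]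
    ring
  have h4 : ‖M - M'‖ ^ 2 ≤ 80 * (2 ^ n) ^ 6 * c * τ * ‖M - M'‖ := by
    calc ‖M - M'‖ ^ 2 = ‖(((‖M - M'‖ ^ 2 : ℝ)) : ℂ)‖ := by
          rw [Complex.norm_real, Real.norm_of_nonneg (by positivity)]
      _ ≤ 5 * (2 ^ n) ^ 3 * τ * ‖A‖ + 2 ^ n * (75 * (2 ^ n) ^ 5 * τ * ‖A‖) := by
          rw [e]
          exact (norm_add_le _ _).trans (add_le_add h1 h3)
      _ ≤ 5 * (2 ^ n) ^ 6 * τ * ‖A‖ + 2 ^ n * (75 * (2 ^ n) ^ 5 * τ * ‖A‖) := by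
          gcongr
          norm_num
      _ = 80 * (2 ^ n) ^ 6 * τ * ‖A‖ := by ring
      _ ≤ 80 * (2 ^ n) ^ 6 * τ * (c * ‖M - M'‖) := by gcongr
      _ = _ := by ring
  rcases (norm_nonneg (M - M')).eq_or_lt with h0 | h0
  · rw [← h0]; positivity
  · rw [sq] at h4
    exact le_of_mul_le_mul_right h4 h0

end Comparable

end Stability

end CliffordLabels

/-! ### Learning by estimating outcome probabilities -/

section Learners

variable {D : Type} [Fintype D] [DecidableEq D] {X : Type u} {Y : Type v} {Z : Type w}
  {B : Z → Type t} [∀ z, Fintype (B z)]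

lemma sum_ite_eq_sq {κ : Type*} [Fintype κ] [DecidableEq κ] (i : κ) (c : ℝ) :
    ∑ j, (if i = j then c else 0) ^ 2 = c ^ 2 := by
  simp [ite_pow]

open Classical in
/-- Finitely many outcome probabilities can be estimated. -/
lemma exists_estimator {M : ℕ} (hM : 0 < M)
    (e : Fin M → Σ E : Experiment X Y Z, B E.meas) {τ δ : ℝ} (hτ : 0 < τ) (hδ : 0 < δ) :
    ∃ A : Agent X Y Z B (Fin M → ℝ), ∀ W : WorldModel D X Y Z B,
      1 - δ ≤ A.prob W {p | ∀ i, |p i - W.outcomeProb (e i).1 (e i).2| ≤ τ} := by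
  have hM' : (0 : ℝ) < M := by exact_mod_cast hM
  -- One sample runs a uniformly random experiment. The weight `M` in `v` undoes the probability `1
  -- / M`, so each sample is an unbiased estimate of the whole probability vector, and one
  -- application of Chebyshev covers all coordinates.
  let A₀ : Agent X Y Z B (Fin M × Bool) := (Agent.uniform M hM).bind fun i =>
    Agent.experiment (e i).1 fun b => Agent.output (i, decide (b = (e i).2))
  let v : Fin M × Bool → Fin M → ℝ := fun a j => if a.1 = j then (if a.2 then (M : ℝ) else 0) else 0
  have hv : ∀ a, ∑ j, v a j ^ 2 ≤ (M : ℝ) ^ 2 := by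
    intro a
    rw [sum_ite_eq_sq]
    split_ifs
    · exact le_rfl
    · rw [zero_pow two_ne_zero]; positivity
  have hE : ∀ (W : WorldModel D X Y Z B) j,
      A₀.expect W (fun a => v a j) = W.outcomeProb (e j).1 (e j).2 := by
    intro W j
    have h1 : ∀ i, (∑ b, W.outcomeProb (e i).1 b * v (i, decide (b = (e i).2)) j) =
        if i = j then M * W.outcomeProb (e i).1 (e i).2 else 0 := by
      intro i
      by_cases hij : i = j <;> simp [v, hij, mul_comm]
    simp only [A₀, Agent.expect_bind, Agent.expect_uniform, Agent.expect]
    simp only [h1, Finset.sum_ite_eq', Finset.mem_univ, if_true]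
    field_simp
  obtain ⟨k, hk⟩ := exists_nat_gt ((M : ℝ) ^ 2 / (δ * τ ^ 2))
  have hk0 : (0 : ℝ) < k := lt_of_le_of_lt (by positivity) hk
  refine ⟨(A₀.rep k).bind fun l => Agent.output fun j => (l.map fun a => v a j).sum / k,
    fun W => ?_⟩
  rw [Agent.prob_bind_output]
  refine Agent.le_prob_of_expect_le W (fun l => (τ ^ 2)⁻¹ * ∑ j, ((l.map fun a => v a j).sum / k -
      A₀.expect W fun a => v a j) ^ 2) _ ?_
    (fun l => mul_nonneg (by positivity) (Finset.sum_nonneg fun _ _ => sq_nonneg _)) ?_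
  · rw [Agent.expect_const_mul]
    have h2 := Agent.expect_rep_mean W v hv A₀ (by exact_mod_cast hk0)
    calc _ ≤ (τ ^ 2)⁻¹ * ((M : ℝ) ^ 2 / k) := by gcongr
      _ ≤ δ := by
        rw [div_lt_iff₀ (by positivity)] at hk
        rw [inv_mul_le_iff₀ (by positivity), div_le_iff₀ hk0]
        nlinarith
  · intro l hl i
    rw [inv_mul_lt_iff₀ (by positivity), mul_one] at hl
    rw [← hE W i]
    refine abs_le_of_sq_le_sq ?_ hτ.le
    exact (Finset.single_le_sum (f := fun j => ((l.map fun a => v a j).sum / (k : ℝ) -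
      A₀.expect W fun a => v a j) ^ 2) (fun _ _ => sq_nonneg _) (Finset.mem_univ i)).trans hl.le

open Classical in
/-- A property which depends continuously on finitely many outcome probabilities and on the
parameter `f` can be learned up to the parameter `f`. -/
lemma exists_learner {V : Type} [Nonempty V] (Q : Set (WorldModel D X Y Z B))
    (f : WorldModel D X Y Z B → ℝ) (prop : WorldModel D X Y Z B → V) (R : V → V → Prop)
    {ι : Type} [Fintype ι] [Nonempty ι] (e : ι → Σ E : Experiment X Y Z, B E.meas) {τ : ℝ}
    (hτ : 0 < τ)
    (H : ∀ W ∈ Q, ∀ W' ∈ Q, f W = f W' →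
      (∀ i, |W.outcomeProb (e i).1 (e i).2 - W'.outcomeProb (e i).1 (e i).2| ≤ τ) →
        R (prop W) (prop W')) {δ : ℝ} (hδ : 0 < δ) :
    ∃ A : Agent X Y Z B (ℝ → V), ∀ W ∈ Q, 1 - δ ≤ A.prob W {F | R (prop W) (F (f W))} := by
  let g := Fintype.equivFin ι
  -- Accuracy `τ / 2`, since the true model and the chosen one are both compared with the estimates.
  obtain ⟨A, hA⟩ := exists_estimator (D := D) (B := B) Fintype.card_pos (fun i => e (g.symm i))
    (half_pos hτ) hδ
  let P : (Fin (Fintype.card ι) → ℝ) → ℝ → WorldModel D X Y Z B → Prop := fun p x W =>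
    W ∈ Q ∧ f W = x ∧ ∀ i, |p i - W.outcomeProb (e (g.symm i)).1 (e (g.symm i)).2| ≤ τ / 2
  -- For each candidate parameter any fitting model of the class is chosen. At the true parameter
  -- the true model fits when the estimates are good, so the choice is not the default value and `H`
  -- applies to it.
  let dec : (Fin (Fintype.card ι) → ℝ) → ℝ → V := fun p x =>
    if h : ∃ W, P p x W then prop h.choose else Classical.arbitrary V
  refine ⟨A.bind fun p => Agent.output (dec p), fun W hW => (hA W).trans ?_⟩
  rw [Agent.prob_bind_output, Agent.prob_eq_expect, Agent.prob_eq_expect]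
  refine Agent.expect_mono W (fun p => ?_) A
  by_cases hp : p ∈ {p | ∀ i, |p i -
      W.outcomeProb (e (g.symm i)).1 (e (g.symm i)).2| ≤ τ / 2}
  · rw [if_pos hp, if_pos]
    have hex : ∃ W', P p (f W) W' := ⟨W, hW, rfl, hp⟩
    obtain ⟨h1, h2, h3⟩ := hex.choose_spec
    change R (prop W) (dec p (f W))
    simp only [dec, dif_pos hex]
    refine H W hW _ h1 h2.symm fun i => ?_
    have h4 := abs_sub_le_iff.1 (hp (g i))
    have h5 := abs_sub_le_iff.1 (h3 (g i))
    have h6 : ∀ W : WorldModel D X Y Z B,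
        W.outcomeProb (e (g.symm (g i))).1 (e (g.symm (g i))).2 = W.outcomeProb (e i).1 (e i).2 :=
      fun W => by rw [Equiv.symm_apply_apply]
    rw [h6] at h4 h5
    rw [abs_sub_le_iff]
    constructor <;> linarith [h4.1, h4.2, h5.1, h5.2]
  · rw [if_neg hp]
    split_ifs <;> norm_num

end Learners

namespace CliffordLabels

variable {n m : ℕ} {X : Type u} {Y : Type v} {Z : Type w} {B : Z → Type t} [∀ z, Fintype (B z)]

/-- The one- and two-gate experiments with the gates of a design, and additional experiments. -/
def learningExperiments (ℓ : CliffordLabels n X Y Z B) (C : Fin m → CliffordGate n) {T : Type}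
    (e : T → Σ E : Experiment X Y Z, B E.meas) :
    (Fin m × Bits n) ⊕ (Fin m × Fin m × Bits n) ⊕ T → Σ E : Experiment X Y Z, B E.meas
  | .inl (i, b) => ⟨⟨ℓ.zero, [ℓ.gate (C i)], ℓ.comp⟩, ℓ.outcome b⟩
  | .inr (.inl (i, j, b)) =>
    ⟨⟨ℓ.zero, [ℓ.gate (C i)] ++ [ℓ.gate (C j).adjoint], ℓ.comp⟩, ℓ.outcome b⟩
  | .inr (.inr s) => e s

/-- Properties which are stable under perturbations of the outcome probabilities are learnable
up to the fidelity of the zero state. -/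
lemma exists_learner_of_stable (ℓ : CliffordLabels n X Y Z B) {ν η : ℝ} (hn : 1 ≤ n)
    (hν : ν ≤ 1 / 10) (hm : 0 < m) {C : Fin m → CliffordGate n} (hC : IsDesign C)
    {V : Type} [Nonempty V] (prop : WorldModel (Bits n) X Y Z B → V) (R : V → V → Prop)
    {T : Type} [Fintype T] (e : T → Σ E : Experiment X Y Z, B E.meas) {τ : ℝ} (hτ : 0 < τ)
    (H : ∀ W W' N N', ℓ.Comparable C τ W W' N N' → DiamondNormLE (N - LinearMap.id) η →
      (∀ s, |W.outcomeProb (e s).1 (e s).2 - W'.outcomeProb (e s).1 (e s).2| ≤ τ) →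
        R (prop W) (prop W')) {δ : ℝ} (hδ : 0 < δ) :
    ∃ A : Agent X Y Z B (ℝ → V), ∀ W ∈ ℓ.modelClass ν η,
      1 - δ ≤ A.prob W {F | R (prop W) (F (ℓ.fidelity W))} := by
  have : Nonempty (Fin m) := ⟨⟨0, hm⟩⟩
  refine exists_learner _ _ prop R (ℓ.learningExperiments C e) hτ ?_ hδ
  rintro W ⟨N, hN, hb, hη⟩ W' ⟨N', hN', -, -⟩ hff hp
  refine H W W' N N' ⟨hn, hm, hC, hN, hN', ⟨by linarith [hb.1], fun b => by linarith [hb.2 b]⟩, hff,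
    fun i b => hp (.inl (i, b)), fun i j b => hp (.inr (.inl (i, j, b)))⟩ hη
    fun s => hp (.inr (.inr s))

/-- Each kind of action adds the experiments needed by its stability bound. The thresholds τ make
the bounds equal to `ε` after one more factor `d` for the change of norm. -/
theorem learnableUpTo_fidelity (ℓ : CliffordLabels n X Y Z B) {ν η : ℝ} (hn : 1 ≤ n)
    (hν : ν ≤ 1 / 10) (hη : 0 ≤ η) (hη1 : η < 1) :
    LearnableUpTo (ℓ.modelClass ν η) ℓ.fidelity := by
  obtain ⟨m, C, hm, hC⟩ := exists_clifford_design hn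
  replace hC : IsDesign C := hC
  obtain ⟨c, hc0, hc⟩ := exists_inverse_bound (Bits n) hη hη1
  have hcard : (Fintype.card (Bits n) : ℝ) = 2 ^ n := by simp
  have hsqrt : Real.sqrt (Fintype.card (Bits n)) ≤ 2 ^ n := by
    rw [hcard, Real.sqrt_le_left (by positivity)]
    have : (1 : ℝ) ≤ 2 ^ n := one_le_pow₀ one_le_two
    nlinarith
  have htr : ∀ (A : Matrix (Bits n) (Bits n) ℂ) {r : ℝ}, ‖A‖ ≤ r → traceNorm A ≤ 2 ^ n * r :=
    fun A r h => (traceNorm_le A).trans (mul_le_mul hsqrt h (norm_nonneg _) (by positivity))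
  intro ε hε δ hδ
  refine ⟨fun x => ?_, fun y => ?_, fun z b => ?_⟩
  · refine ℓ.exists_learner_of_stable hn hν hm hC (fun W => W.state x)
      (fun A A' => traceNorm (A - A') ≤ ε) (T := Fin m × Bits n)
      (fun s => ⟨⟨x, [] ++ [ℓ.gate (C s.1).adjoint], ℓ.comp⟩, ℓ.outcome s.2⟩)
      (τ := ε / (15 * (2 ^ n) ^ 3)) (by positivity) ?_ hδ
    intro W W' N N' h _ hs
    refine (htr _ (h.norm_state_sub_le fun i b => hs (i, b))).trans (le_of_eq ?_)
    field_simp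
  · refine ℓ.exists_learner_of_stable hn hν hm hC (fun W => W.channel y)
      (fun A A' => DiamondNormLE (A - A') ε) (T := Fin m × Fin m × Bits n)
      (fun s => ⟨⟨ℓ.zero, [ℓ.gate (C s.1), y] ++ [ℓ.gate (C s.2.1).adjoint], ℓ.comp⟩,
        ℓ.outcome s.2.2⟩)
      (τ := ε / (150 * (2 ^ n) ^ 9 * c)) (by positivity) ?_ hδ
    intro W W' N N' h hN hs
    have h1 := diamondNormLE_of_norm_le (by have := h.nonneg; positivity)
      (h.norm_channel_sub_le (hc N hN) fun i j b => hs (i, j, b))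
    convert h1 using 1
    rw [hcard]
    field_simp
  · refine ℓ.exists_learner_of_stable hn hν hm hC (fun W => W.povm z b)
      (fun A A' => traceNorm (A - A') ≤ ε) (T := Fin m)
      (fun s => ⟨⟨ℓ.zero, [ℓ.gate (C s)], z⟩, b⟩)
      (τ := ε / (80 * (2 ^ n) ^ 7 * c)) (by positivity) ?_ hδ
    intro W W' N N' h hN hs
    refine (htr _ (h.norm_povm_sub_le hc0.le (hc N hN) hs)).trans (le_of_eq ?_)
    field_simp

end CliffordLabels

/-! ### The fidelity of the zero state cannot be learned -/

section Indistinguishable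

variable {D : Type} [Fintype D] [DecidableEq D] {X : Type u} {Y : Type v} {Z : Type w}
  {B : Z → Type t} [∀ z, Fintype (B z)]

lemma Agent.prob_eq_of_indistinguishable {α : Type} {W W' : WorldModel D X Y Z B}
    (h : W.WeaklyIndistinguishable W') (S : Set α) (A : Agent X Y Z B α) :
    A.prob W S = A.prob W' S := by
  induction A with
  | output a => rfl
  | toss k p next ih => simp only [prob, ih]
  | experiment E next ih => simp only [prob, ih, h E]

lemma not_predictable_of_indistinguishable {Q : Set (WorldModel D X Y Z B)}
    {f : WorldModel D X Y Z B → ℝ} {W W' : WorldModel D X Y Z B} (hW : W ∈ Q) (hW' : W' ∈ Q)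
    (h : W.WeaklyIndistinguishable W') (hf : f W ≠ f W') : ¬ Predictable Q f := by
  classical
  intro hp
  have hpos : 0 < |f W - f W'| := abs_pos.2 (sub_ne_zero.2 hf)
  -- With accuracy a third of the gap the two success events are disjoint, yet each would have
  -- probability at least 3/4 under one common output distribution.
  obtain ⟨A, hA⟩ := hp (|f W - f W'| / 3) (by positivity) (1 / 4) (by norm_num)
  have h1 := hA W hW
  have h2 := hA W' hW'
  rw [← A.prob_eq_of_indistinguishable h] at h2
  rw [Agent.prob_eq_expect] at h1 h2
  have h3 := Agent.expect_mono W (h := fun _ => (1 : ℝ)) (fun o => ?_ : ∀ o : ℝ,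
    (if o ∈ {o | |f W - o| ≤ |f W - f W'| / 3} then (1 : ℝ) else 0) +
      (if o ∈ {o | |f W' - o| ≤ |f W - f W'| / 3} then (1 : ℝ) else 0) ≤ 1) A
  · rw [Agent.expect_add, Agent.expect_const] at h3
    linarith
  · by_cases ha : |f W - o| ≤ |f W - f W'| / 3 <;> by_cases hb : |f W' - o| ≤ |f W - f W'| / 3
    · exfalso
      have := abs_sub_le (f W) o (f W')
      rw [abs_sub_comm o] at this
      linarith
    all_goals simp [ha, hb]

end Indistinguishable

/-! ### Depolarized states and measurements, and ideal actions -/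

section Depolarization

variable {n : ℕ}

/-- Depolarization to the fraction `r`. -/
def depolarize (r : ℝ) (A : Matrix (Bits n) (Bits n) ℂ) : Matrix (Bits n) (Bits n) ℂ :=
  (r : ℂ) • A + (((1 - r : ℝ) : ℂ) * (A.trace / 2 ^ n)) • (1 : Matrix (Bits n) (Bits n) ℂ)

lemma depolarize_trace (r : ℝ) (A : Matrix (Bits n) (Bits n) ℂ) :
    (depolarize r A).trace = A.trace := by
  have h2 : (2 : ℂ) ^ n ≠ 0 := pow_ne_zero n two_ne_zero
  rw [depolarize, Matrix.trace_add, Matrix.trace_smul, Matrix.trace_smul, trace_one_bits,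
    smul_eq_mul, smul_eq_mul]
  push_cast
  field_simp
  ring

lemma depolarize_basisProj_apply (r : ℝ) (b : Bits n) :
    depolarize r (basisProj b) b b = ((r + (1 - r) / 2 ^ n : ℝ) : ℂ) := by
  rw [depolarize, basisProj_trace]
  simp only [Matrix.add_apply, Matrix.smul_apply, Matrix.one_apply_eq, basisProj,
    Matrix.single_apply_same, smul_eq_mul]
  push_cast
  ring

lemma depolarize_posSemidef {r : ℝ} (h0 : 0 ≤ r) (h1 : r ≤ 1) {A : Matrix (Bits n) (Bits n) ℂ}
    (hA : A.PosSemidef) : (depolarize r A).PosSemidef := by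
  refine (hA.smul (Complex.zero_le_real.2 h0)).add (Matrix.PosSemidef.one.smul ?_)
  refine mul_nonneg (Complex.zero_le_real.2 (by linarith)) ?_
  rw [div_eq_mul_inv]
  refine mul_nonneg hA.trace_nonneg ?_
  have h : (0 : ℂ) ≤ ((((2 : ℝ) ^ n)⁻¹ : ℝ) : ℂ) := Complex.zero_le_real.2 (by positivity)
  push_cast at h
  exact h

/-- Only the product `r s` enters, so the statistics do not show how depolarization is split between
state and effect. -/
lemma trace_depolarize_mul_depolarize (r s : ℝ) (A A' : Matrix (Bits n) (Bits n) ℂ) :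
    (depolarize r A * depolarize s A').trace =
      r * s * (A * A').trace + (1 - r * s) * (A.trace * A'.trace / 2 ^ n) := by
  have h2 : (2 : ℂ) ^ n ≠ 0 := pow_ne_zero n two_ne_zero
  simp only [depolarize, Matrix.add_mul, Matrix.mul_add, Matrix.smul_mul, Matrix.mul_smul,
    Matrix.mul_one, Matrix.one_mul, Matrix.trace_add, Matrix.trace_smul, trace_one_bits,
    smul_eq_mul]
  push_cast
  field_simp
  ring

lemma depolarize_map {Φ : SuperOp (Bits n)} (h : IsCPTP Φ) (h1 : Φ 1 = 1) (r : ℝ)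
    (A : Matrix (Bits n) (Bits n) ℂ) : Φ (depolarize r A) = depolarize r (Φ A) := by
  simp only [depolarize, map_add, map_smul, h1, h.2]

lemma depolarize_isPOVM {β : Type*} [Fintype β] {r : ℝ} (h0 : 0 ≤ r) (h1 : r ≤ 1)
    {M : β → Matrix (Bits n) (Bits n) ℂ} (hM : IsPOVM M) :
    IsPOVM fun b => depolarize r (M b) := by
  have h2 : (2 : ℂ) ^ n ≠ 0 := pow_ne_zero n two_ne_zero
  refine ⟨fun b => depolarize_posSemidef h0 h1 (hM.1 b), ?_⟩
  simp only [depolarize]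
  rw [Finset.sum_add_distrib, ← Finset.smul_sum, hM.2, ← Finset.sum_smul, ← Finset.mul_sum,
    ← Finset.sum_div, ← Matrix.trace_sum, hM.2, trace_one_bits, div_self h2, mul_one, ← add_smul]
  push_cast
  simp

lemma isCPTP_id {D : Type*} [Fintype D] : IsCPTP (LinearMap.id : SuperOp D) :=
  ⟨fun _ _ h => h, fun _ => rfl⟩

lemma isCPTP_conjMap {C : Matrix (Bits n) (Bits n) ℂ} (hC : Cᴴ * C = 1) : IsCPTP (conjMap C) := by
  refine ⟨fun k A hA => ?_, fun A => conj_trace hC⟩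
  let K : Matrix (Bits n × Fin k) (Bits n × Fin k) ℂ :=
    Matrix.of fun p q => if p.2 = q.2 then C p.1 q.1 else 0
  have h : ampliation (Fin k) (conjMap C) A = K * A * Kᴴ := by
    ext p q
    simp only [ampliation, conjMap_apply, Matrix.of_apply, Matrix.mul_apply, Fintype.sum_prod_type,
      Matrix.conjTranspose_apply, K]
    simp [ite_mul, apply_ite]
  rw [h]
  exact hA.mul_mul_conjTranspose_same K

/-- Gates which share a name differ by a phase, which conjugation does not see, so the channel of a
named gate is well defined. All other actions do nothing. -/
lemma exists_ideal_channels {X : Type u} {Y : Type v} {Z : Type w} {B : Z → Type t}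
    (ℓ : CliffordLabels n X Y Z B) :
    ∃ Φ : Y → SuperOp (Bits n), (∀ y, IsCPTP (Φ y)) ∧ (∀ y, Φ y 1 = 1) ∧
      ∀ C A, Φ (ℓ.gate C) A = C.1 * A * C.1ᴴ := by
  classical
  refine ⟨fun y => if h : ∃ C, ℓ.gate C = y then conjMap h.choose.1 else LinearMap.id,
    fun y => ?_, fun y => ?_, fun C A => ?_⟩
  · dsimp only
    split_ifs with h
    · exact isCPTP_conjMap h.choose.2.conjTranspose_mul_self
    · exact isCPTP_id
  · dsimp only
    split_ifs with h
    · rw [conjMap_apply, Matrix.mul_one, h.choose.2.mul_conjTranspose_self]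
    · rfl
  · have h : ∃ C', ℓ.gate C' = ℓ.gate C := ⟨C, rfl⟩
    simp only [dif_pos h]
    obtain ⟨c, hc⟩ := ℓ.gate_phase _ _ h.choose_spec
    have h1 := h.choose.2.mul_conjTranspose_self
    rw [conjMap_apply, hc, Matrix.conjTranspose_smul, Matrix.smul_mul, Matrix.smul_mul,
      Matrix.mul_smul, smul_smul]
    rw [hc, Matrix.conjTranspose_smul, Matrix.smul_mul, Matrix.mul_smul, smul_smul,
      C.2.mul_conjTranspose_self] at h1
    have h2 : c * star c = 1 := by simpa using congrFun (congrFun h1 0) 0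
    rw [h2, one_smul]

/-- All other measurements return a uniformly random outcome, which needs a nonempty outcome set. -/
lemma exists_ideal_povms {X : Type u} {Y : Type v} {Z : Type w} {B : Z → Type t}
    [∀ z, Fintype (B z)] [∀ z, Nonempty (B z)] (ℓ : CliffordLabels n X Y Z B) :
    ∃ P : (z : Z) → B z → Matrix (Bits n) (Bits n) ℂ, (∀ z, IsPOVM (P z)) ∧
      ∀ b, P ℓ.comp (ℓ.outcome b) = basisProj b := by
  classical
  refine ⟨Function.update (fun z _ => (((Fintype.card (B z) : ℝ)⁻¹ : ℝ) : ℂ) • 1) ℓ.comp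
    fun b => basisProj (ℓ.outcome.symm b), fun z => ?_, fun b => ?_⟩
  · by_cases hz : z = ℓ.comp
    · subst hz
      rw [Function.update_self]
      refine ⟨fun b => (basisProj_isState _).1, ?_⟩
      rw [Equiv.sum_comp ℓ.outcome.symm fun b => basisProj b]
      ext i j
      by_cases hij : i = j <;>
        simp [basisProj, Matrix.sum_apply, Matrix.single_apply, Matrix.one_apply, hij]
    · rw [Function.update_of_ne hz]
      refine ⟨fun b => Matrix.PosSemidef.one.smul (Complex.zero_le_real.2 (by positivity)), ?_⟩
      rw [← Finset.sum_smul]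
      simp
  · rw [Function.update_self, Equiv.symm_apply_apply]

end Depolarization

/-- All channels are ideal gates or the identity, hence unital, so depolarization passes from the
preparation to the measurement. The gate noise is the identity, so its distance from the identity is
zero. -/
theorem CliffordLabels.exists_indistinguishable {n : ℕ} {X : Type u} {Y : Type v} {Z : Type w}
    {B : Z → Type t} [∀ z, Fintype (B z)] [∀ z, Nonempty (B z)] (ℓ : CliffordLabels n X Y Z B)
    {ν η : ℝ} (hn : 1 ≤ n) (hν0 : 0 < ν) (hν : ν ≤ 1 / 10) (hη : 0 ≤ η) :
    ∃ W₁ ∈ ℓ.modelClass ν η, ∃ W₂ ∈ ℓ.modelClass ν η,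
      W₁.WeaklyIndistinguishable W₂ ∧ ℓ.fidelity W₁ ≠ ℓ.fidelity W₂ := by
  obtain ⟨Φ, hΦ, hΦ1, hΦg⟩ := exists_ideal_channels ℓ
  obtain ⟨P, hP, hPb⟩ := exists_ideal_povms ℓ
  have h2 : (2 : ℝ) ≤ 2 ^ n := two_le_two_pow hn
  let W : (r s : ℝ) → (0 ≤ r ∧ r ≤ 1) → (0 ≤ s ∧ s ≤ 1) → WorldModel (Bits n) X Y Z B :=
    fun r s hr hs =>
    { state := fun _ => depolarize r (basisProj 0)
      channel := Φ
      povm := fun z b => depolarize s (P z b)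
      isState := fun _ => ⟨depolarize_posSemidef hr.1 hr.2 (basisProj_isState 0).1,
        (depolarize_trace _ _).trans (basisProj_trace 0)⟩
      isCPTP := hΦ
      isPOVM := fun z => depolarize_isPOVM hs.1 hs.2 (hP z) }
  have hfid : ∀ r s hr hs, ℓ.fidelity (W r s hr hs) = r + (1 - r) / 2 ^ n := by
    intro r s hr hs
    have e : (W r s hr hs).state ℓ.zero 0 0 = ((r + (1 - r) / 2 ^ n : ℝ) : ℂ) :=
      depolarize_basisProj_apply r 0
    rw [fidelity, e, Complex.ofReal_re]
  have hge : ∀ r : ℝ, 1 - ν ≤ r → r ≤ 1 → 1 - ν ≤ r + (1 - r) / 2 ^ n := fun r h h' =>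
    h.trans (le_add_of_nonneg_right (div_nonneg (by linarith) (by positivity)))
  have hmem : ∀ r s hr hs, 1 - ν ≤ r → 1 - ν ≤ s → W r s hr hs ∈ ℓ.modelClass ν η := by
    intro r s hr hs hr' hs'
    refine ⟨LinearMap.id, ⟨isCPTP_id, fun C ρ => hΦg C ρ⟩, ⟨?_, fun b => ?_⟩, ?_⟩
    · exact (hge r hr' hr.2).trans_eq (hfid r s hr hs).symm
    · have e : ((W r s hr hs).povm ℓ.comp (ℓ.outcome b) * basisProj b).trace =
          ((s + (1 - s) / 2 ^ n : ℝ) : ℂ) := by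
        rw [trace_mul_basisProj]
        simp only [W, hPb]
        exact depolarize_basisProj_apply s b
      rw [LinearMap.id_apply, e, Complex.ofReal_re]
      exact hge s hs' hs.2
    · intro A
      have e : ampliation (Bits n) (LinearMap.id - LinearMap.id : SuperOp (Bits n)) A = 0 := by
        ext p q
        simp [ampliation]
      have e0 : traceNorm (0 : Matrix (Bits n × Bits n) (Bits n × Bits n) ℂ) = 0 := by
        have h3 := sum_eigenvalues_conjTranspose_mul_self
          (0 : Matrix (Bits n × Bits n) (Bits n × Bits n) ℂ)
        rw [Matrix.frobenius_norm_def] at h3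
        simp only [Matrix.zero_apply, norm_zero] at h3
        rw [Finset.sum_eq_zero fun i _ => Finset.sum_eq_zero fun j _ =>
          Real.zero_rpow two_ne_zero, Real.zero_rpow (by norm_num), zero_pow two_ne_zero,
          Finset.sum_eq_zero_iff_of_nonneg fun i _ =>
            eigenvalues_conjTranspose_mul_self_nonneg _ i] at h3
        exact Finset.sum_eq_zero fun i hi => by rw [h3 i hi, Real.sqrt_zero]
      rw [e, e0]
      exact mul_nonneg hη (traceNorm_nonneg A)
  have hr : 0 ≤ 1 - ν ∧ 1 - ν ≤ 1 := ⟨by linarith, by linarith⟩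
  have h1 : (0 : ℝ) ≤ 1 ∧ (1 : ℝ) ≤ 1 := ⟨zero_le_one, le_rfl⟩
  -- The same depolarization sits on the measurements in the first model and on the states in the
  -- second. The fidelities are `1` and `1 - ν + ν / d`.
  refine ⟨W 1 (1 - ν) h1 hr, hmem _ _ h1 hr (by linarith) le_rfl, W (1 - ν) 1 hr h1,
    hmem _ _ hr h1 le_rfl (by linarith), fun E b => ?_, ?_⟩
  · have hfold : ∀ (r : ℝ) (l : List Y) (A : Matrix (Bits n) (Bits n) ℂ),
        l.foldl (fun σ y => Φ y σ) (depolarize r A) =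
          depolarize r (l.foldl (fun σ y => Φ y σ) A) := by
      intro r l
      induction l with
      | nil => intro A; rfl
      | cons y l ih =>
        intro A
        rw [List.foldl_cons, List.foldl_cons, depolarize_map (hΦ y) (hΦ1 y), ih]
    simp only [WorldModel.outcomeProb, W, hfold, trace_depolarize_mul_depolarize]
    rw [mul_comm ((1 - ν : ℝ) : ℂ)]
  · rw [hfid _ _ h1 hr, hfid _ _ hr h1]
    have h3 : (1 : ℝ) / 2 ^ n ≤ 1 / 2 := one_div_le_one_div_of_le two_pos h2
    have h4 : (1 - (1 - ν)) / 2 ^ n = ν * (1 / 2 ^ n) := by ring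
    rw [h4, sub_self, zero_div, add_zero]
    intro h5
    nlinarith

/-! ### Learning the Choi matrix of unital gate noise -/

namespace Agent

variable {X : Type u} {Y : Type v} {Z : Type w} {B : Z → Type t} {α β : Type}

/-- Run two agents and output both outputs. -/
def pair (A : Agent X Y Z B α) (A' : Agent X Y Z B β) : Agent X Y Z B (α × β) :=
  A.bind fun a => A'.bind fun b => output (a, b)

variable [∀ z, Fintype (B z)]

lemma expect_pair {D : Type} [Fintype D] [DecidableEq D] (W : WorldModel D X Y Z B)
    (A : Agent X Y Z B α) (A' : Agent X Y Z B β) (g : α → ℝ) (h : β → ℝ) :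
    (A.pair A').expect W (fun p => g p.1 + h p.2) = A.expect W g + A'.expect W h := by
  simp only [pair, expect_bind, expect, expect_add, expect_const]

lemma count_pair_le (P : Experiment X Y Z → Prop) (A : Agent X Y Z B α) (A' : Agent X Y Z B β) :
    (A.pair A').count P ≤ A.count P + A'.count P :=
  count_bind_le P _ _ fun _ => (count_bind_le P _ _ (c := 0) fun _ => le_rfl).trans (by simp)

end Agent

namespace CliffordLabels

variable {n m : ℕ} {X : Type u} {Y : Type v} {Z : Type w} {B : Z → Type t} [∀ z, Fintype (B z)]
  {ℓ : CliffordLabels n X Y Z B} {W : WorldModel (Bits n) X Y Z B} {N : SuperOp (Bits n)}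
  {C : Fin m → CliffordGate n}

variable (ℓ C) in
/-- Apply a random gate of the design and measure. -/
def oneGateSample (hm : 0 < m) : Agent X Y Z B (Fin m × Bits n) :=
  (Agent.uniform m hm).bind fun i =>
    Agent.experiment ⟨ℓ.zero, [ℓ.gate (C i)], ℓ.comp⟩ fun b =>
      Agent.output (i, ℓ.outcome.symm b)

variable (ℓ C) in
/-- Apply a random gate of the design and a random adjoint gate of the design, and measure. -/
def twoGateSample (hm : 0 < m) : Agent X Y Z B (Fin m × Fin m × Bits n) :=
  (Agent.uniform m hm).bind fun i => (Agent.uniform m hm).bind fun j =>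
    Agent.experiment ⟨ℓ.zero, [ℓ.gate (C i), ℓ.gate (C j).adjoint], ℓ.comp⟩ fun b =>
      Agent.output (i, j, ℓ.outcome.symm b)

lemma expect_oneGateSample (hm : 0 < m) (g : Fin m × Bits n → ℝ) :
    (ℓ.oneGateSample C hm).expect W g = (m : ℝ)⁻¹ * ∑ i, ∑ b,
      W.outcomeProb ⟨ℓ.zero, [ℓ.gate (C i)], ℓ.comp⟩ (ℓ.outcome b) * g (i, b) := by
  simp only [oneGateSample, Agent.expect_bind, Agent.expect_uniform, Agent.expect]
  congr 1
  refine Finset.sum_congr rfl fun i _ => ?_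
  rw [← Equiv.sum_comp ℓ.outcome]
  simp only [Equiv.symm_apply_apply]

lemma expect_twoGateSample (hm : 0 < m) (g : Fin m × Fin m × Bits n → ℝ) :
    (ℓ.twoGateSample C hm).expect W g = ((m : ℝ) ^ 2)⁻¹ * ∑ i, ∑ j, ∑ b,
      W.outcomeProb ⟨ℓ.zero, [ℓ.gate (C i), ℓ.gate (C j).adjoint], ℓ.comp⟩ (ℓ.outcome b) *
        g (i, j, b) := by
  simp only [twoGateSample, Agent.expect_bind, Agent.expect_uniform, Agent.expect]
  rw [sq, mul_inv, mul_assoc, ← Finset.mul_sum]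
  congr 2
  refine Finset.sum_congr rfl fun i _ => Finset.sum_congr rfl fun j _ => ?_
  rw [← Equiv.sum_comp ℓ.outcome]
  simp only [Equiv.symm_apply_apply]

lemma not_twoGate_oneGate {C C' : CliffordGate n} :
    ¬ ℓ.OneGate ⟨ℓ.zero, [ℓ.gate C, ℓ.gate C'], ℓ.comp⟩ := by
  rintro ⟨C'', h⟩
  simp at h

open Classical in
lemma count_oneGateSample_le (hm : 0 < m) (P : Experiment X Y Z → Prop) {c : ℕ}
    (hP : ∀ i, (if P ⟨ℓ.zero, [ℓ.gate (C i)], ℓ.comp⟩ then 1 else 0) ≤ c) :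
    (ℓ.oneGateSample C hm).count P ≤ c := by
  refine (Agent.count_bind_le P _ _ (c := c) fun i => ?_).trans
    (by rw [Agent.count_uniform, zero_add])
  have h0 : (Finset.univ.sup fun _ : B ℓ.comp => 0) = 0 :=
    Nat.le_zero.1 (Finset.sup_le fun _ _ => le_rfl)
  simpa only [Agent.count, h0, add_zero] using hP i

open Classical in
lemma count_twoGateSample_le (hm : 0 < m) (P : Experiment X Y Z → Prop) {c : ℕ}
    (hP : ∀ i j, (if P ⟨ℓ.zero, [ℓ.gate (C i), ℓ.gate (C j).adjoint], ℓ.comp⟩ then 1 else 0) ≤ c) :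
    (ℓ.twoGateSample C hm).count P ≤ c := by
  refine (Agent.count_bind_le P _ _ (c := c) fun i => (Agent.count_bind_le P _ _ (c := c)
    fun j => ?_).trans (by rw [Agent.count_uniform, zero_add])).trans
    (by rw [Agent.count_uniform, zero_add])
  have h0 : (Finset.univ.sup fun _ : B ℓ.comp => 0) = 0 :=
    Nat.le_zero.1 (Finset.sup_le fun _ _ => le_rfl)
  simpa only [Agent.count, h0, add_zero] using hP i j

variable (ℓ W N) in
/-- The factor by which the noise enters the two-gate experiments. -/
def contrast : ℝ := (ℓ.fidelity W - 1 / 2 ^ n) / (4 ^ n - 1) * ℓ.visibility W N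

/-- Inner tomography recovers the output of the noise on each orbit element, and the outer weighting
replaces the orbit by `A`. Unitality keeps the trace part a multiple of 1, so the only unknown
besides `N A` is the contrast. -/
lemma GateIndependentNoise.sum_twoGate (hN : ℓ.GateIndependentNoise W N) (hC : IsDesign C)
    (hN1 : N 1 = 1) (A : Matrix (Bits n) (Bits n) ℂ) :
    ∑ i, (A * ((C i).1 * basisProj 0 * (C i).1ᴴ)).trace • ∑ j, ∑ b,
      (W.outcomeProb ⟨ℓ.zero, [ℓ.gate (C i), ℓ.gate (C j).adjoint], ℓ.comp⟩ (ℓ.outcome b) : ℂ) •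
        ((C j).1 * basisProj b * (C j).1ᴴ) =
      ((m : ℂ) ^ 2) • ((ℓ.contrast W N : ℂ) • N A +
        (A.trace * (1 / 4 ^ n - ℓ.contrast W N / 2 ^ n)) • (1 : Matrix (Bits n) (Bits n) ℂ)) := by
  have h2 : (2 : ℂ) ^ n ≠ 0 := pow_ne_zero n two_ne_zero
  set β : ℂ := ((ℓ.fidelity W : ℂ) - 1 / 2 ^ n) / (4 ^ n - 1) with hβ
  set α : ℂ := (ℓ.visibility W N : ℂ)
  have hκ : (ℓ.contrast W N : ℂ) = β * α := by
    rw [contrast, Complex.ofReal_mul, ← prepWeight_coe]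
  have h1 : ∀ i, ∑ j, ∑ b,
      (W.outcomeProb ⟨ℓ.zero, [ℓ.gate (C i), ℓ.gate (C j).adjoint], ℓ.comp⟩ (ℓ.outcome b) : ℂ) •
        ((C j).1 * basisProj b * (C j).1ᴴ) =
      (m : ℂ) • (α • N ((C i).1 * W.state ℓ.zero * (C i).1ᴴ) +
        ((1 - α) / 2 ^ n) • (1 : Matrix (Bits n) (Bits n) ℂ)) := by
    intro i
    have h := hC.tomography (sum_effect_trace (ℓ := ℓ) (W := W) hN.1)
      (N ((C i).1 * W.state ℓ.zero * (C i).1ᴴ))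
    rw [visibility_coe hN.1, hN.1.2, conj_trace (C i).2.conjTranspose_mul_self,
      (W.isState ℓ.zero).2] at h
    have e : ∀ j b, (W.outcomeProb ⟨ℓ.zero, [ℓ.gate (C i), ℓ.gate (C j).adjoint], ℓ.comp⟩
        (ℓ.outcome b) : ℂ) = (ℓ.effect W N b * ((C j).1ᴴ *
          N ((C i).1 * W.state ℓ.zero * (C i).1ᴴ) * (C j).1)).trace := by
      intro j b
      have h3 := outcomeProb_gate hN ℓ.zero [ℓ.gate (C i)] (C j).adjoint b
      simp only [CliffordGate.adjoint, Matrix.conjTranspose_conjTranspose, List.foldl_cons,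
        List.foldl_nil, hN.2] at h3
      exact h3
    simp only [e]
    rw [h]
    congr 1
    module
  have h3 : ∑ i, (A * ((C i).1 * basisProj 0 * (C i).1ᴴ)).trace = m * (A.trace / 2 ^ n) := by
    rw [← Matrix.trace_sum, ← Matrix.mul_sum, hC.sum_conj, basisProj_trace, Matrix.mul_smul,
      Matrix.mul_smul, Matrix.trace_smul, Matrix.trace_smul, Matrix.mul_one, smul_eq_mul,
      smul_eq_mul]
    ring
  have h4 := congrArg N (hC.sum_prep (W.isState ℓ.zero).2 A)
  rw [fidelity_coe] at h4
  rw [← hβ] at h4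
  simp only [map_sum, map_smul, map_add, map_sub, hN1] at h4
  have h5 : ∀ i, (A * ((C i).1 * basisProj 0 * (C i).1ᴴ)).trace • ((m : ℂ) •
      (α • N ((C i).1 * W.state ℓ.zero * (C i).1ᴴ) +
        ((1 - α) / 2 ^ n) • (1 : Matrix (Bits n) (Bits n) ℂ))) =
      ((m : ℂ) * α) • ((A * ((C i).1 * basisProj 0 * (C i).1ᴴ)).trace •
        N ((C i).1 * W.state ℓ.zero * (C i).1ᴴ)) +
      (A * ((C i).1 * basisProj 0 * (C i).1ᴴ)).trace •
        ((m : ℂ) • ((1 - α) / 2 ^ n) • (1 : Matrix (Bits n) (Bits n) ℂ)) := by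
    intro i; module
  simp only [h1, h5]
  rw [Finset.sum_add_distrib, ← Finset.smul_sum, ← Finset.sum_smul, h4, h3, hκ, four_pow_eq]
  ext k l
  simp only [Matrix.smul_apply, Matrix.add_apply, Matrix.sub_apply, smul_eq_mul]
  field_simp
  ring

variable (C) in
/-- The single-shot estimate of the Choi matrix, up to an affine transformation. -/
def shadow (a : Fin m × Fin m × Bits n) : Matrix (Bits n × Bits n) (Bits n × Bits n) ℂ :=
  Matrix.of fun p q => ((C a.2.1).1 * basisProj a.2.2 * (C a.2.1).1ᴴ : Matrix (Bits n) (Bits n) ℂ) p.1 q.1 *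
    -- The ancilla factor is transposed: the Choi block `(r, s)` is the image of `|r⟩⟨s|`, whose
    -- weight against the ideal orbit is the entry `(s, r)`.
    ((C a.1).1 * basisProj 0 * (C a.1).1ᴴ : Matrix (Bits n) (Bits n) ℂ) q.2 p.2

/-- Up to a transpose the estimate is a product of two pure states. The bound is free of the
dimension, so the factor `d⁴` in the sample number comes only from rescaling the mean. -/
lemma norm_shadow_le (a : Fin m × Fin m × Bits n) : ‖shadow C a‖ ≤ 1 := by
  refine le_of_sq_le_sq ?_ zero_le_one
  have e : ‖shadow C a‖ ^ 2 = ‖(C a.2.1).1 * basisProj a.2.2 * (C a.2.1).1ᴴ‖ ^ 2 *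
      ‖(C a.1).1 * basisProj 0 * (C a.1).1ᴴ‖ ^ 2 := by
    have hc : ∀ M : Matrix (Bits n) (Bits n) ℂ, ‖M‖ ^ 2 = ∑ s, ∑ r, ‖M s r‖ ^ 2 :=
      frobenius_norm_sq
    rw [← ampliation_id (Bits n) (shadow C a), ampliation_norm_sq,
      hc ((C a.1).1 * basisProj 0 * (C a.1).1ᴴ), Finset.mul_sum, Finset.sum_comm]
    simp only [Finset.mul_sum]
    refine Finset.sum_congr rfl fun s _ => Finset.sum_congr rfl fun r _ => ?_
    rw [← mul_pow, mul_comm, ← norm_smul]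
    congr 2
    ext i j
    simp [shadow, mul_comm]
  rw [e, one_pow]
  exact mul_le_one₀ (pow_le_one₀ (norm_nonneg _) (norm_conj_basisProj_le _ _)) (by positivity)
    (pow_le_one₀ (norm_nonneg _) (norm_conj_basisProj_le _ _))

/-- The real coordinates of a complex matrix. -/
def realCoord (A : Matrix (Bits n × Bits n) (Bits n × Bits n) ℂ)
    (c : ((Bits n × Bits n) × (Bits n × Bits n)) × Bool) : ℝ :=
  if c.2 then (A c.1.1 c.1.2).re else (A c.1.1 c.1.2).im

/-- The complex matrix with given real coordinates. -/
def ofRealCoord (x : ((Bits n × Bits n) × (Bits n × Bits n)) × Bool → ℝ) :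
    Matrix (Bits n × Bits n) (Bits n × Bits n) ℂ :=
  Matrix.of fun p q => ⟨x ((p, q), true), x ((p, q), false)⟩

lemma norm_ofRealCoord_sub_sq (x : ((Bits n × Bits n) × (Bits n × Bits n)) × Bool → ℝ)
    (A : Matrix (Bits n × Bits n) (Bits n × Bits n) ℂ) :
    ‖ofRealCoord x - A‖ ^ 2 = ∑ c, (x c - realCoord A c) ^ 2 := by
  rw [frobenius_norm_sq, Fintype.sum_prod_type (fun c => (x c - realCoord A c) ^ 2),
    Fintype.sum_prod_type (fun pq => ∑ t, (x (pq, t) - realCoord A (pq, t)) ^ 2)]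
  refine Finset.sum_congr rfl fun p _ => Finset.sum_congr rfl fun q _ => ?_
  rw [Complex.sq_norm, Complex.normSq_apply]
  simp [ofRealCoord, realCoord, sq]

lemma sum_realCoord_sq (A : Matrix (Bits n × Bits n) (Bits n × Bits n) ℂ) :
    ∑ c, realCoord A c ^ 2 = ‖A‖ ^ 2 := by
  have h := norm_ofRealCoord_sub_sq (fun _ => 0) A
  have h0 : (ofRealCoord fun _ => 0 : Matrix (Bits n × Bits n) (Bits n × Bits n) ℂ) = 0 := by
    ext p q; rfl
  rw [h0, zero_sub, norm_neg] at h
  rw [h]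
  simp

variable (ℓ W N) in
/-- The expected value of the single-shot estimate. -/
def meanShadow : Matrix (Bits n × Bits n) (Bits n × Bits n) ℂ :=
  ((2 : ℂ) ^ n * ℓ.contrast W N) • choi N +
    (1 / 4 ^ n - (ℓ.contrast W N : ℂ) / 2 ^ n) • 1

/-- This is `sum_twoGate` for matrix units, read entry by entry and split into real and imaginary
parts. -/
lemma GateIndependentNoise.expect_shadow (hN : ℓ.GateIndependentNoise W N) (hm : 0 < m)
    (hC : IsDesign C) (hN1 : N 1 = 1) (c : ((Bits n × Bits n) × (Bits n × Bits n)) × Bool) :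
    (ℓ.twoGateSample C hm).expect W (fun a => realCoord (shadow C a) c) =
      realCoord (ℓ.meanShadow W N) c := by
  have h2 : (2 : ℂ) ^ n ≠ 0 := pow_ne_zero n two_ne_zero
  have hm' : (m : ℂ) ≠ 0 := by exact_mod_cast hm.ne'
  have h : ((m : ℂ) ^ 2)⁻¹ * ∑ i, ∑ j, ∑ b,
      (W.outcomeProb ⟨ℓ.zero, [ℓ.gate (C i), ℓ.gate (C j).adjoint], ℓ.comp⟩ (ℓ.outcome b) : ℂ) *
        shadow C (i, j, b) c.1.1 c.1.2 = ℓ.meanShadow W N c.1.1 c.1.2 := by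
    obtain ⟨⟨⟨k, r⟩, ⟨l, s⟩⟩, _⟩ := c
    have h1 := congrFun (congrFun (hN.sum_twoGate hC hN1 (Matrix.single r s 1)) k) l
    have h3 : ∀ M : Matrix (Bits n) (Bits n) ℂ, (Matrix.single r s 1 * M).trace = M s r := by
      intro M
      simp [Matrix.trace_single_mul]
    have h4 : (Matrix.single r s (1 : ℂ)).trace = if r = s then 1 else 0 := by
      have := h3 1
      rw [Matrix.mul_one, Matrix.one_apply] at this
      rw [this]
      simp [eq_comm]
    simp only [h3, h4, Matrix.sum_apply, Matrix.smul_apply, Matrix.add_apply, smul_eq_mul,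
      Finset.mul_sum] at h1
    have h5 : ∀ i j b, (W.outcomeProb ⟨ℓ.zero, [ℓ.gate (C i), ℓ.gate (C j).adjoint], ℓ.comp⟩
        (ℓ.outcome b) : ℂ) * shadow C (i, j, b) (k, r) (l, s) =
        ((C i).1 * basisProj 0 * (C i).1ᴴ : Matrix (Bits n) (Bits n) ℂ) s r * ((W.outcomeProb ⟨ℓ.zero,
          [ℓ.gate (C i), ℓ.gate (C j).adjoint], ℓ.comp⟩ (ℓ.outcome b) : ℂ) *
            ((C j).1 * basisProj b * (C j).1ᴴ : Matrix (Bits n) (Bits n) ℂ) k l) := by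
      intro i j b
      simp only [shadow, Matrix.of_apply]
      ring
    simp only [h5]
    rw [h1, inv_mul_cancel_left₀ (pow_ne_zero 2 hm')]
    simp only [meanShadow, Matrix.add_apply, Matrix.smul_apply, smul_eq_mul, choi_apply]
    have h6 : (Fintype.card (Bits n) : ℂ) = 2 ^ n := by simp
    have h7 : (1 : Matrix (Bits n × Bits n) (Bits n × Bits n) ℂ) (k, r) (l, s) =
        (if r = s then 1 else 0) * (1 : Matrix (Bits n) (Bits n) ℂ) k l := by
      simp only [Matrix.one_apply, Prod.mk.injEq]
      by_cases hk : k = l <;> by_cases hr : r = s <;> simp [hk, hr]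
    rw [h6, h7]
    field_simp
  rw [expect_twoGateSample]
  have h8 : ∀ z : ℂ, ((m : ℂ) ^ 2)⁻¹ * z = (((m : ℝ) ^ 2)⁻¹ : ℝ) • z := by
    intro z
    rw [Complex.real_smul]
    push_cast
    rfl
  rw [h8] at h
  simp only [← Complex.real_smul] at h
  cases hc : c.2
  · simp only [realCoord, hc, Bool.false_eq_true, if_false]
    rw [← h, Complex.smul_im, smul_eq_mul, Complex.im_sum]
    simp only [Complex.im_sum, Complex.smul_im, smul_eq_mul]
  · simp only [realCoord, hc, if_true]
    rw [← h, Complex.smul_re, smul_eq_mul, Complex.re_sum]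
    simp only [Complex.re_sum, Complex.smul_re, smul_eq_mul]

variable (C) in
/-- The overlap of the ideal outcome with the ideal state. -/
def overlap (a : Fin m × Bits n) : ℝ :=
  (basisProj a.2 * ((C a.1).1 * basisProj 0 * (C a.1).1ᴴ)).trace.re

lemma overlap_sq_le (a : Fin m × Bits n) : overlap C a ^ 2 ≤ 1 := by
  have h : |overlap C a| ≤ 1 :=
    (Complex.abs_re_le_norm _).trans ((norm_trace_mul_le _ _).trans
      (mul_le_one₀ (basisProj_isState _).norm_le_one (norm_nonneg _)
        (norm_conj_basisProj_le _ _)))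
  rw [← sq_abs]
  exact pow_le_one₀ (abs_nonneg _) h

lemma GateIndependentNoise.expect_overlap (hN : ℓ.GateIndependentNoise W N) (hm : 0 < m)
    (hC : IsDesign C) :
    (ℓ.oneGateSample C hm).expect W (overlap C) =
      (ℓ.fidelity W - 1 / 2 ^ n) * ℓ.visibility W N + 1 / 2 ^ n := by
  have hm' : (m : ℝ) ≠ 0 := by exact_mod_cast hm.ne'
  rw [expect_oneGateSample, inv_mul_eq_iff_eq_mul₀ hm']
  have h := congrArg Complex.re (hN.calibration hC)
  simp only [Complex.re_sum, Complex.re_ofReal_mul] at h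
  refine Eq.trans h ?_
  have e : (m : ℂ) * (((ℓ.fidelity W : ℂ) - 1 / 2 ^ n) * ℓ.visibility W N + 1 / 2 ^ n) =
      ((m * ((ℓ.fidelity W - 1 / 2 ^ n) * ℓ.visibility W N + 1 / 2 ^ n) : ℝ) : ℂ) := by
    push_cast; rfl
  rw [e, Complex.ofReal_re]

/-- The estimate of the Choi matrix from the empirical means of the overlap and of the
single-shot estimates. -/
def choiEstimate (n : ℕ) (x : ℝ) (M : Matrix (Bits n × Bits n) (Bits n × Bits n) ℂ) :
    Matrix (Bits n × Bits n) (Bits n × Bits n) ℂ :=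
  -- With `γ = (f - 1/d) α` and `J = 1 / d²`, the mean shadow is `J + (d γ / (d² - 1)) (Φ - J)`.
  -- Here `x - 1/d` estimates γ, so the affine map is inverted without knowing `f` or α separately.
  ((((4 ^ n - 1) / (2 ^ n * (x - 1 / 2 ^ n)) : ℝ)) : ℂ) • (M - (1 / 4 ^ n : ℂ) • 1) +
    (1 / 4 ^ n : ℂ) • 1

/-- Since `γ ≥ 0.16 / d`, the tolerance on `x` keeps its estimate `y` above `0.13 / d`. Then the
error of the shadow contributes at most `5/13 ε` and that of the scale `6/13 ε`, because the Choi
matrix and `J` each have norm at most 1. -/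
lemma norm_choiEstimate_sub_lt (hn : 1 ≤ n) (hN : IsCPTP N) (hb : ℓ.BoundedNoise (1 / 10) W N)
    {ε : ℝ} (hε : 0 < ε) (hε1 : ε ≤ 1) {x : ℝ}
    {M : Matrix (Bits n × Bits n) (Bits n × Bits n) ℂ}
    (hx : |x - ((ℓ.fidelity W - 1 / 2 ^ n) * ℓ.visibility W N + 1 / 2 ^ n)| ≤
      3 / 100 * ε / 2 ^ n)
    (hM : ‖M - ℓ.meanShadow W N‖ ≤ 5 / 100 * ε / (2 ^ n) ^ 2) :
    ‖choiEstimate n x M - choi N‖ < ε := by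
  have hd := two_le_two_pow hn
  have hf := fidelity_sub_ge hn (f := ℓ.fidelity W) (by linarith [hb.1])
  have hα := visibility_ge hn hb
  have h41 := four_pow_sub_one_pos hn
  have h2 : (2 : ℂ) ^ n ≠ 0 := pow_ne_zero n two_ne_zero
  have h41' : (4 : ℂ) ^ n - 1 ≠ 0 := by
    have : (((4 : ℝ) ^ n - 1 : ℝ) : ℂ) ≠ 0 := Complex.ofReal_ne_zero.2 h41.ne'
    push_cast at this
    exact this
  set γ : ℝ := (ℓ.fidelity W - 1 / 2 ^ n) * ℓ.visibility W N with hγ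
  have hγ0 : 16 / 100 / 2 ^ n ≤ γ := by
    calc (16 / 100 / 2 ^ n : ℝ) = 2 / 5 * (2 / 5 / 2 ^ n) := by ring
      _ ≤ γ := mul_le_mul hf hα (by positivity) (by linarith)
  set y : ℝ := x - 1 / 2 ^ n with hy
  have hyγ : |y - γ| ≤ 3 / 100 * ε / 2 ^ n := by
    rw [show y - γ = x - (γ + 1 / 2 ^ n) by rw [hy]; ring]
    exact hx
  have hy0 : 13 / 100 / 2 ^ n ≤ y := by
    have h1 := (abs_le.1 hyγ).1
    have h3 : 3 / 100 * ε / 2 ^ n ≤ 3 / 100 / 2 ^ n := by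
      gcongr; linarith
    have h4 : (13 / 100 / 2 ^ n : ℝ) = 16 / 100 / 2 ^ n - 3 / 100 / 2 ^ n := by ring
    linarith
  have hγpos : 0 < γ := lt_of_lt_of_le (by positivity) hγ0
  have hypos : 0 < y := lt_of_lt_of_le (by positivity) hy0
  have hγc : (γ : ℂ) ≠ 0 := Complex.ofReal_ne_zero.2 hγpos.ne'
  have hyc : (y : ℂ) ≠ 0 := Complex.ofReal_ne_zero.2 hypos.ne'
  have hκ : (ℓ.contrast W N : ℂ) = (γ : ℂ) / (4 ^ n - 1) := by
    rw [contrast, hγ]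
    push_cast
    ring
  set J : Matrix (Bits n × Bits n) (Bits n × Bits n) ℂ := (1 / 4 ^ n : ℂ) • 1 with hJ
  have hJn : ‖J‖ ≤ 1 := by
    refine le_of_sq_le_sq ?_ zero_le_one
    rw [hJ, norm_smul, mul_pow, norm_one_sq]
    have e : (Fintype.card (Bits n × Bits n) : ℝ) = 4 ^ n := by
      rw [four_pow_eq_real]; simp
    rw [e, norm_div, norm_one, norm_pow, Complex.norm_ofNat, one_pow, div_pow, one_pow,
      one_div, inv_mul_le_iff₀ (by positivity)]
    linarith [sq_nonneg ((4 : ℝ) ^ n - 1), show (1 : ℝ) ≤ 4 ^ n from one_le_pow₀ (by norm_num),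
      show ((4 : ℝ) ^ n) ^ 2 ≥ 4 ^ n * 1 by
        rw [sq]; gcongr; exact one_le_pow₀ (by norm_num)]
  have e : choiEstimate n x M - choi N =
      (((4 ^ n - 1) / (2 ^ n * y) : ℝ) : ℂ) • (M - ℓ.meanShadow W N) +
        (((γ - y) / y : ℝ) : ℂ) • (choi N - J) := by
    have e1 : ℓ.meanShadow W N = ((2 : ℂ) ^ n * (γ / (4 ^ n - 1))) • choi N + J -
        (((2 : ℂ) ^ n * (γ / (4 ^ n - 1)))) • J := by
      rw [meanShadow, hκ, hJ, sub_smul, smul_smul, four_pow_eq]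
      rw [← add_sub_assoc]
      congr 2
      field_simp
    rw [choiEstimate, ← hJ, ← hy, e1]
    ext p q
    simp only [Matrix.smul_apply, Matrix.add_apply, Matrix.sub_apply, smul_eq_mul]
    push_cast
    field_simp
    ring
  have hcJ : ‖choi N - J‖ ≤ 2 :=
    (norm_sub_le _ _).trans (by linarith [hN.isState_choi.norm_le_one])
  have t1 : ‖(((4 ^ n - 1) / (2 ^ n * y) : ℝ) : ℂ) • (M - ℓ.meanShadow W N)‖ ≤ 5 / 13 * ε := by
    rw [norm_smul, Complex.norm_real, Real.norm_of_nonneg (by positivity)]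
    calc (4 ^ n - 1) / (2 ^ n * y) * ‖M - ℓ.meanShadow W N‖
        ≤ (2 ^ n * 2 ^ n) / (2 ^ n * (13 / 100 / 2 ^ n)) * (5 / 100 * ε / (2 ^ n) ^ 2) := by
          gcongr
          rw [four_pow_eq_real]; linarith
      _ = 5 / 13 * ε := by
          field_simp
  have t2 : ‖(((γ - y) / y : ℝ) : ℂ) • (choi N - J)‖ ≤ 6 / 13 * ε := by
    rw [norm_smul, Complex.norm_real, Real.norm_eq_abs, abs_div, abs_of_pos hypos, abs_sub_comm]
    calc |y - γ| / y * ‖choi N - J‖ ≤ (3 / 100 * ε / 2 ^ n) / (13 / 100 / 2 ^ n) * 2 := by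
          gcongr
      _ = 6 / 13 * ε := by
          field_simp
          norm_num
  rw [e]
  refine (norm_add_le _ _).trans_lt ?_
  linarith

/-- The agent which estimates the Choi matrix from `k₁` one-gate and `k₂` two-gate experiments. -/
def choiLearner (ℓ : CliffordLabels n X Y Z B) (C : Fin m → CliffordGate n) (hm : 0 < m)
    (k₁ k₂ : ℕ) : Agent X Y Z B (Matrix (Bits n × Bits n) (Bits n × Bits n) ℂ) :=
  (((ℓ.oneGateSample C hm).rep k₁).pair ((ℓ.twoGateSample C hm).rep k₂)).bind fun p =>
    Agent.output (choiEstimate n ((p.1.map fun a => overlap C a).sum / k₁)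
      (ofRealCoord fun c => (p.2.map fun a => realCoord (shadow C a) c).sum / k₂))

open Classical in
lemma count_choiLearner_le (hm : 0 < m) (k₁ k₂ : ℕ) (P : Experiment X Y Z → Prop) {c₁ c₂ : ℕ}
    (h₁ : ∀ i, (if P ⟨ℓ.zero, [ℓ.gate (C i)], ℓ.comp⟩ then 1 else 0) ≤ c₁)
    (h₂ : ∀ i j, (if P ⟨ℓ.zero, [ℓ.gate (C i), ℓ.gate (C j).adjoint], ℓ.comp⟩ then 1 else 0) ≤
      c₂) :
    (ℓ.choiLearner C hm k₁ k₂).count P ≤ k₁ * c₁ + k₂ * c₂ := by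
  refine (Agent.count_bind_le P _ _ (c := 0) fun _ => le_rfl).trans ?_
  rw [add_zero]
  refine (Agent.count_pair_le P _ _).trans (add_le_add ?_ ?_)
  · exact (Agent.count_rep_le P _ _).trans
      (Nat.mul_le_mul_left _ (count_oneGateSample_le hm P h₁))
  · exact (Agent.count_rep_le P _ _).trans
      (Nat.mul_le_mul_left _ (count_twoGateSample_le hm P h₂))

/-- Samples of norm at most 1 give mean squared errors `1 / k₁` and `1 / k₂`. Measured against the
squared tolerances `T₁` and `T₂` each is at most 1/200, and Markov's inequality for the sum gives
failure probability at most 1/100. -/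
lemma le_prob_choiLearner (hn : 1 ≤ n) (hm : 0 < m) (hC : IsDesign C) {ε : ℝ} (hε : 0 < ε)
    (hε1 : ε ≤ 1) {k₁ k₂ : ℕ} (hk₁ : 10 ^ 6 * ((2 : ℝ) ^ n) ^ 2 / ε ^ 2 ≤ k₁)
    (hk₂ : 10 ^ 6 * ((2 : ℝ) ^ n) ^ 4 / ε ^ 2 ≤ k₂)
    (hN : ℓ.GateIndependentNoise W N) (hb : ℓ.BoundedNoise (1 / 10) W N) (hN1 : N 1 = 1) :
    0.99 ≤ (ℓ.choiLearner C hm k₁ k₂).prob W {Φ | hsNorm (Φ - choi N) < ε} := by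
  have hk₁0 : (0 : ℝ) < k₁ := lt_of_lt_of_le (by positivity) hk₁
  have hk₂0 : (0 : ℝ) < k₂ := lt_of_lt_of_le (by positivity) hk₂
  set μ : ℝ := (ℓ.fidelity W - 1 / 2 ^ n) * ℓ.visibility W N + 1 / 2 ^ n
  set T₁ : ℝ := (3 / 100 * ε / 2 ^ n) ^ 2 with hT₁
  set T₂ : ℝ := (5 / 100 * ε / (2 ^ n) ^ 2) ^ 2 with hT₂
  have hT₁0 : 0 < T₁ := by positivity
  have hT₂0 : 0 < T₂ := by positivity
  rw [choiLearner, Agent.prob_bind_output]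
  have h99 : (0.99 : ℝ) = 1 - 1 / 100 := by norm_num
  rw [h99]
  refine Agent.le_prob_of_expect_le W (fun p =>
    (T₁⁻¹ * ((p.1.map fun a => overlap C a).sum / k₁ - μ) ^ 2) +
    (T₂⁻¹ * ∑ c, ((p.2.map fun a => realCoord (shadow C a) c).sum / k₂ -
      realCoord (ℓ.meanShadow W N) c) ^ 2)) _ ?_ (fun p => ?_) ?_
  · rw [Agent.expect_pair W _ _
      (fun l : List (Fin m × Bits n) => T₁⁻¹ * ((l.map fun a => overlap C a).sum / (k₁ : ℝ) - μ) ^ 2)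
      (fun l : List (Fin m × Fin m × Bits n) => T₂⁻¹ * ∑ c, ((l.map fun a => realCoord (shadow C a) c).sum / (k₂ : ℝ) -
        realCoord (ℓ.meanShadow W N) c) ^ 2), Agent.expect_const_mul, Agent.expect_const_mul]
    have e1 := Agent.expect_rep_mean W (κ := Unit) (fun a _ => overlap C a) (R := 1)
      (fun a => by simpa using overlap_sq_le a) (ℓ.oneGateSample C hm) (k := k₁)
      (by exact_mod_cast hk₁0)
    simp only [Finset.univ_unique, Finset.sum_singleton] at e1
    rw [hN.expect_overlap hm hC] at e1
    have e2 := Agent.expect_rep_mean W (fun a => realCoord (shadow C a)) (R := 1)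
      (fun a => by
        rw [sum_realCoord_sq]
        exact pow_le_one₀ (norm_nonneg _) (norm_shadow_le a)) (ℓ.twoGateSample C hm) (k := k₂)
      (by exact_mod_cast hk₂0)
    simp only [hN.expect_shadow hm hC hN1] at e2
    have b1 : T₁⁻¹ * (1 / k₁) ≤ 1 / 200 := by
      rw [inv_mul_le_iff₀ hT₁0, div_le_iff₀ hk₁0]
      calc (1 : ℝ) ≤ T₁ * (1 / 200) * (10 ^ 6 * ((2 : ℝ) ^ n) ^ 2 / ε ^ 2) := by
            rw [hT₁]
            field_simp
            norm_num
        _ ≤ _ := by gcongr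
    have b2 : T₂⁻¹ * (1 / k₂) ≤ 1 / 200 := by
      rw [inv_mul_le_iff₀ hT₂0, div_le_iff₀ hk₂0]
      calc (1 : ℝ) ≤ T₂ * (1 / 200) * (10 ^ 6 * ((2 : ℝ) ^ n) ^ 4 / ε ^ 2) := by
            rw [hT₂]
            field_simp
            norm_num
        _ ≤ _ := by gcongr
    calc _ ≤ T₁⁻¹ * (1 / k₁) + T₂⁻¹ * (1 / k₂) := by
          refine add_le_add ?_ ?_
          · exact mul_le_mul_of_nonneg_left e1 (by positivity)
          · exact mul_le_mul_of_nonneg_left e2 (by positivity)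
      _ ≤ _ := by linarith
  · exact add_nonneg (mul_nonneg (by positivity) (sq_nonneg _))
      (mul_nonneg (by positivity) (Finset.sum_nonneg fun _ _ => sq_nonneg _))
  · intro p hp
    have n1 : 0 ≤ T₁⁻¹ * ((p.1.map fun a => overlap C a).sum / (k₁ : ℝ) - μ) ^ 2 := by positivity
    have n2 : 0 ≤ T₂⁻¹ * ∑ c, ((p.2.map fun a => realCoord (shadow C a) c).sum / (k₂ : ℝ) -
        realCoord (ℓ.meanShadow W N) c) ^ 2 :=
      mul_nonneg (by positivity) (Finset.sum_nonneg fun _ _ => sq_nonneg _)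
    have l1 : ((p.1.map fun a => overlap C a).sum / (k₁ : ℝ) - μ) ^ 2 ≤ T₁ := by
      have : T₁⁻¹ * ((p.1.map fun a => overlap C a).sum / (k₁ : ℝ) - μ) ^ 2 ≤ 1 := by linarith
      rwa [inv_mul_le_iff₀ hT₁0, mul_one] at this
    have l2 : ∑ c, ((p.2.map fun a => realCoord (shadow C a) c).sum / (k₂ : ℝ) -
        realCoord (ℓ.meanShadow W N) c) ^ 2 ≤ T₂ := by
      have : T₂⁻¹ * ∑ c, ((p.2.map fun a => realCoord (shadow C a) c).sum / (k₂ : ℝ) -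
        realCoord (ℓ.meanShadow W N) c) ^ 2 ≤ 1 := by linarith
      rwa [inv_mul_le_iff₀ hT₂0, mul_one] at this
    rw [← norm_ofRealCoord_sub_sq
      (fun c => (p.2.map fun a => realCoord (shadow C a) c).sum / (k₂ : ℝ))] at l2
    change hsNorm _ < ε
    rw [hsNorm_eq_norm]
    exact norm_choiEstimate_sub_lt hn hN.1 hb hε hε1 (abs_le_of_sq_le_sq l1 (by positivity))
      (le_of_sq_le_sq l2 (by positivity))

theorem exists_choiLearner (ℓ : CliffordLabels n X Y Z B) (hn : 1 ≤ n) {ε : ℝ} (hε : 0 < ε) :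
    ∃ A : Agent X Y Z B (Matrix (Bits n × Bits n) (Bits n × Bits n) ℂ),
      A.count (fun E => ¬ (ℓ.OneGate E ∨ ℓ.TwoGate E)) = 0 ∧
      (A.count ℓ.OneGate : ℝ) ≤ 10 ^ 7 * ((2 : ℝ) ^ n) ^ 2 / ε ^ 2 ∧
      (A.count (fun _ => True) : ℝ) ≤
        10 ^ 7 * ((2 : ℝ) ^ n) ^ 4 * Real.log ((2 : ℝ) ^ n) / ε ^ 2 ∧
      ∀ (W : WorldModel (Bits n) X Y Z B) (N : SuperOp (Bits n)),
        ℓ.GateIndependentNoise W N → ℓ.BoundedNoise (1 / 10) W N → N 1 = 1 →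
        0.99 ≤ A.prob W {Φ | hsNorm (Φ - choi N) < ε} := by
  have hd := two_le_two_pow hn
  -- The sample number is of order `d⁴ / ε²`; this lower bound on `log d` suffices to insert the
  -- logarithm of the statement.
  have hlog : 1 / 2 ≤ Real.log ((2 : ℝ) ^ n) := by
    have h1 := Real.log_two_gt_d9
    have h2 := Real.log_le_log two_pos hd
    linarith
  by_cases hε1 : 1 < ε
  -- The Choi matrix has norm at most 1, so for `ε > 1` the zero matrix is accurate without any
  -- experiment.
  · refine ⟨Agent.output 0, rfl, ?_, ?_, fun W N hN _ _ => ?_⟩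
    · simp only [Agent.count, Nat.cast_zero]; positivity
    · simp only [Agent.count, Nat.cast_zero]; positivity
    · have h : hsNorm (0 - choi N) < ε := by
        rw [hsNorm_eq_norm, zero_sub, norm_neg]
        exact hN.1.isState_choi.norm_le_one.trans_lt hε1
      rw [Agent.prob, if_pos (show (0 : Matrix _ _ ℂ) ∈ {Φ | hsNorm (Φ - choi N) < ε} from h)]
      norm_num
  rw [not_lt] at hε1
  obtain ⟨m, C, hm, hC⟩ := exists_clifford_design hn
  -- For `ε ≤ 1` the 1 lost in each rounding up is absorbed by `d² / ε² ≥ 1`, and the constant `10 ^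
  -- 7` covers both sample sizes.
  have hq : 1 ≤ ((2 : ℝ) ^ n) ^ 2 / ε ^ 2 := by
    rw [one_le_div (by positivity)]
    exact pow_le_pow_left₀ hε.le (by linarith) 2
  have hq4 : ((2 : ℝ) ^ n) ^ 2 / ε ^ 2 ≤ ((2 : ℝ) ^ n) ^ 4 / ε ^ 2 := by
    gcongr
    · linarith
    · norm_num
  have c1 := (Nat.ceil_lt_add_one
    (show 0 ≤ 10 ^ 6 * ((2 : ℝ) ^ n) ^ 2 / ε ^ 2 by positivity)).le
  have c2 := (Nat.ceil_lt_add_one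
    (show 0 ≤ 10 ^ 6 * ((2 : ℝ) ^ n) ^ 4 / ε ^ 2 by positivity)).le
  rw [mul_div_assoc] at c1 c2
  refine ⟨ℓ.choiLearner C hm ⌈10 ^ 6 * ((2 : ℝ) ^ n) ^ 2 / ε ^ 2⌉₊
    ⌈10 ^ 6 * ((2 : ℝ) ^ n) ^ 4 / ε ^ 2⌉₊, ?_, ?_, ?_, fun W N hN hb hN1 =>
      le_prob_choiLearner hn hm hC hε hε1 (Nat.le_ceil _) (Nat.le_ceil _) hN hb hN1⟩
  · refine Nat.le_zero.1 ((count_choiLearner_le hm _ _ _ (c₁ := 0) (c₂ := 0) (fun i => ?_)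
      fun i j => ?_).trans (by simp))
    · rw [if_neg (not_not.2 (Or.inl ⟨C i, rfl⟩))]
    · rw [if_neg (not_not.2 (Or.inr ⟨C i, (C j).adjoint, rfl⟩))]
  · have h := count_choiLearner_le (ℓ := ℓ) (C := C) hm ⌈10 ^ 6 * ((2 : ℝ) ^ n) ^ 2 / ε ^ 2⌉₊
      ⌈10 ^ 6 * ((2 : ℝ) ^ n) ^ 4 / ε ^ 2⌉₊ ℓ.OneGate (c₁ := 1) (c₂ := 0)
      (fun i => by split_ifs <;> norm_num) (fun i j => by rw [if_neg not_twoGate_oneGate])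
    rw [mul_one, mul_zero, add_zero] at h
    refine (Nat.cast_le.2 h).trans ?_
    rw [mul_div_assoc, mul_div_assoc]
    linarith
  · have h := count_choiLearner_le (ℓ := ℓ) (C := C) hm ⌈10 ^ 6 * ((2 : ℝ) ^ n) ^ 2 / ε ^ 2⌉₊
      ⌈10 ^ 6 * ((2 : ℝ) ^ n) ^ 4 / ε ^ 2⌉₊ (fun _ => True) (c₁ := 1) (c₂ := 1)
      (fun i => by simp) (fun i j => by simp)
    rw [mul_one, mul_one] at h
    refine (Nat.cast_le.2 h).trans ?_
    have e : 10 ^ 7 * ((2 : ℝ) ^ n) ^ 4 * Real.log ((2 : ℝ) ^ n) / ε ^ 2 =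
        10 ^ 7 * (((2 : ℝ) ^ n) ^ 4 / ε ^ 2 * Real.log ((2 : ℝ) ^ n)) := by ring
    have h5 : ((2 : ℝ) ^ n) ^ 4 / ε ^ 2 * (1 / 2) ≤
        ((2 : ℝ) ^ n) ^ 4 / ε ^ 2 * Real.log ((2 : ℝ) ^ n) := by gcongr
    rw [e, Nat.cast_add, mul_div_assoc, mul_div_assoc]
    linarith

end CliffordLabels

end

theorem theorem4 :
    -- Learning all actions up to the single unlearnable parameter `f`.
    (∀ (n : ℕ), 1 ≤ n →
      ∀ (X : Type u) (Y : Type v) (Z : Type w) (B : Z → Type t) [∀ z, Fintype (B z)]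
        [∀ z, Nonempty (B z)] (ℓ : CliffordLabels n X Y Z B) (ν η : ℝ),
        0 < ν → ν ≤ 1 / 10 → 0 ≤ η → η < 1 →
        LearnableUpTo (ℓ.modelClass ν η) ℓ.fidelity ∧
        ¬ Predictable (ℓ.modelClass ν η) ℓ.fidelity ∧
        ∃ W₁ ∈ ℓ.modelClass ν η, ∃ W₂ ∈ ℓ.modelClass ν η,
          W₁.WeaklyIndistinguishable W₂ ∧ ℓ.fidelity W₁ ≠ ℓ.fidelity W₂) ∧
    -- Learning the Choi matrix of unital gate noise, with `d = 2 ^ n`.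
    (∃ K : ℝ, 0 < K ∧ ∀ (n : ℕ), 1 ≤ n →
      ∀ (X : Type u) (Y : Type v) (Z : Type w) (B : Z → Type t) [∀ z, Fintype (B z)]
        (ℓ : CliffordLabels n X Y Z B) (ε : ℝ), 0 < ε →
        ∃ A : Agent X Y Z B (Matrix (Bits n × Bits n) (Bits n × Bits n) ℂ),
          A.count (fun E => ¬ (ℓ.OneGate E ∨ ℓ.TwoGate E)) = 0 ∧
          (A.count ℓ.OneGate : ℝ) ≤ K * ((2 : ℝ) ^ n) ^ 2 / ε ^ 2 ∧
          (A.count (fun _ => True) : ℝ) ≤ K * ((2 : ℝ) ^ n) ^ 4 * Real.log ((2 : ℝ) ^ n) / ε ^ 2 ∧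
          ∀ (W : WorldModel (Bits n) X Y Z B) (N : SuperOp (Bits n)),
            ℓ.GateIndependentNoise W N → ℓ.BoundedNoise (1 / 10) W N → N 1 = 1 →
            0.99 ≤ A.prob W {Φ | hsNorm (Φ - choi N) < ε}) := by
  refine ⟨fun n hn X Y Z B _ _ ℓ ν η hν0 hν hη hη1 => ?_, 10 ^ 7, by norm_num,
    fun n hn X Y Z B _ ℓ ε hε => ℓ.exists_choiLearner hn hε⟩
  obtain ⟨W₁, h₁, W₂, h₂, hind, hne⟩ := ℓ.exists_indistinguishable hn hν0 hν hη (η := η)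
  exact ⟨ℓ.learnableUpTo_fidelity hn hν hη hη1,
    not_predictable_of_indistinguishable h₁ h₂ hind hne, W₁, h₁, W₂, h₂, hind, hne⟩
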